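/- Let $G$ be a finite connected simple graph with $n$ vertices and $m$ edges. *Definitions.* $G$ is a *unit* (resp. *proper*) *interval graph* if one can assign to its vertices closed real intervals, all of the same length (resp. none strictly included in another one), such that two distinct vertices are adjacent iff their intervals meet. A *Left-Right ordering* of $G$ is an ordering of all its vertices such that, whenever $a<b<c$ and $ac$ is an edge, both $ab$ and $bc$ are edges. A *maxBFS* (resp. *minBFS*) is a breadth-first search with a queue in which, when a vertex is visited, its unmarked neighbours are put in the queue by non-increasing (resp. non-decreasing) degree, ties being broken arbitrarily. The *two-pass algorithm* performs a maxBFS of $G$, lets $r$ be the last visited vertex, performs a minBFS of $G$ started at $r$, and returns the visiting ordering $\sigma$ of this second search. An *obstruction* in $G$ is a list of vertices inducing a claw $K_{1,3}$, a net, a 3-sun, or a cycle of length at least $4$. **Theorem.** (1) Let $\sigma$ be any ordering returned by the two-pass algorithm on $G$, whatever the start vertex of the maxBFS and the tie-breaking. Then $G$ is a unit interval graph iff $\sigma$ is a Left-Right ordering of $G$; likewise $G$ is a proper interval graph iff $\sigma$ is a Left-Right ordering of $G$. (2) There is a certifying linear-time recognition algorithm: there are a program $P$ of a unit-cost random access machine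 (whose operations are reading and writing registers and array cells, addition, truncated subtraction, comparison) and a constant $C$ such that, for every connected $G$ given by adjacency lists, $P$ halts after at most $C(n+m)$ elementary steps with an ordering $\sigma$ returned by the two-pass algorithm on $G$ (for a maxBFS started at a vertex of maximum degree), with the correct answer to whether $G$ is a unit interval graph, and with a certificate: if the answer is yes, $\sigma$ is a Left-Right ordering of $G$; if it is no, an obstruction in $G$ is also output. (3) The certificates are conclusive: every finite graph (connected or not) with a Left-Right ordering is a unit interval graph, and no finite graph with an obstruction is a unit interval graph. -/

import Mathlib

namespace IUG

section Intervals

variable {V : Type*}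

/-- A realizer of `G` by closed intervals of the real line: distinct vertices are adjacent exactly
when their intervals meet. -/
structure Realizer (G : SimpleGraph V) where
  left : V → ℝ
  right : V → ℝ
  left_le_right : ∀ v, left v ≤ right v
  adj_iff : ∀ u v, u ≠ v →
    (G.Adj u v ↔ (Set.Icc (left u) (right u) ∩ Set.Icc (left v) (right v)).Nonempty)

/-- Unit interval graph: some realizer has all its intervals of the same length. -/
def IsUnitIntervalGraph (G : SimpleGraph V) : Prop :=
  ∃ R : Realizer G, ∃ ℓ : ℝ, ∀ v, R.right v - R.left v = ℓ

/-- Proper interval graph: some realizer has no interval strictly included in another one. -/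
def IsProperIntervalGraph (G : SimpleGraph V) : Prop :=
  ∃ R : Realizer G, ∀ u v,
    ¬ Set.Icc (R.left u) (R.right u) ⊂ Set.Icc (R.left v) (R.right v)

/-- `σ` lists every vertex exactly once, and whenever `a`, `b`, `c` occur in this order in `σ`
and `ac` is an edge, then so are `ab` and `bc`. -/
def IsLeftRightOrdering (G : SimpleGraph V) (σ : List V) : Prop :=
  σ.Nodup ∧ (∀ v, v ∈ σ) ∧
    ∀ a b c, List.Sublist [a, b, c] σ → G.Adj a c → G.Adj a b ∧ G.Adj b c

end Intervals

section Search

variable {V : Type*}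

/-- One step of a queue-based breadth-first search. A configuration is the list of the vertices
already visited (in visiting order) and the queue. The head `u` of the queue is visited, and its
unmarked neighbours (neither visited nor in the queue) are appended to the queue in an order `l`
that is sorted with respect to the priority `le`; ties are broken arbitrarily. -/
inductive BFSStep (G : SimpleGraph V) (le : V → V → Prop) :
    List V × List V → List V × List V → Prop
  | visit (done : List V) (u : V) (queue l : List V) :
      l.Nodup →
      (∀ w, w ∈ l ↔ G.Adj u w ∧ w ∉ done ∧ w ∉ u :: queue) →
      l.Pairwise le →
      BFSStep G le (done, u :: queue) (done ++ [u], queue ++ l)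

/-- `σ` is the visiting ordering of a complete breadth-first search started at `x`. -/
def IsBFSOrdering (G : SimpleGraph V) (le : V → V → Prop) (x : V) (σ : List V) : Prop :=
  Relation.ReflTransGen (BFSStep G le) ([], [x]) (σ, [])

variable [Fintype V] (G : SimpleGraph V) [DecidableRel G.Adj]

/-- maxBFS started at `x`: neighbours enter the queue by non-increasing degree. -/
def IsMaxBFSOrdering (x : V) (σ : List V) : Prop :=
  IsBFSOrdering G (fun u v => G.degree v ≤ G.degree u) x σ

/-- minBFS started at `x`: neighbours enter the queue by non-decreasing degree. -/
def IsMinBFSOrdering (x : V) (σ : List V) : Prop :=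
  IsBFSOrdering G (fun u v => G.degree u ≤ G.degree v) x σ

/-- `σ` is a possible output of the two-pass algorithm: a maxBFS started at `x` whose last visited
vertex is `r`, followed by a minBFS started at `r` with visiting ordering `σ`. -/
def IsTwoPassOutput (x : V) (σ : List V) : Prop :=
  ∃ (τ : List V) (r : V), IsMaxBFSOrdering G x (τ ++ [r]) ∧ IsMinBFSOrdering G r σ

end Search

section Obstructions

/-- The claw `K_{1,3}`, with centre `0`. -/
def claw : SimpleGraph (Fin 4) :=
  SimpleGraph.fromEdgeSet {s(0, 1), s(0, 2), s(0, 3)}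

/-- The net: a triangle `0, 1, 2` with one pendant vertex attached to each of its vertices. -/
def net : SimpleGraph (Fin 6) :=
  SimpleGraph.fromEdgeSet {s(0, 1), s(1, 2), s(0, 2), s(0, 3), s(1, 4), s(2, 5)}

/-- The 3-sun: a triangle `0, 1, 2` with one further vertex attached to both ends of each of its
edges. -/
def sun : SimpleGraph (Fin 6) :=
  SimpleGraph.fromEdgeSet
    {s(0, 1), s(1, 2), s(0, 2), s(3, 0), s(3, 1), s(4, 1), s(4, 2), s(5, 0), s(5, 2)}

/-- The vertices in the list `w` induce, in this order, a copy of `H` in `G`. -/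
def InducesCopy {V : Type*} (G : SimpleGraph V) {k : ℕ} (H : SimpleGraph (Fin k))
    (w : List V) : Prop :=
  ∃ f : H ↪g G, w = List.ofFn f

/-- `w` lists the vertices of an induced claw, net, 3-sun, or cycle of length at least four. -/
def IsObstruction {V : Type*} (G : SimpleGraph V) (w : List V) : Prop :=
  InducesCopy G claw w ∨ InducesCopy G net w ∨ InducesCopy G sun w ∨
    ∃ k : ℕ, 4 ≤ k ∧ InducesCopy G (SimpleGraph.cycleGraph k) w

end Obstructions

/-! A random access machine with unit-cost operations, programmed by structured programs.
The memory consists of scalar registers and of arrays, all holding natural numbers. -/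

section Machine

/-- A memory: `var i` is the `i`-th register, `arr a j` is the cell `j` of the array `a`. -/
structure Memory where
  var : ℕ → ℕ
  arr : ℕ → ℕ → ℕ

/-- Write `k` into register `i`. -/
def Memory.setVar (s : Memory) (i k : ℕ) : Memory :=
  { s with var := Function.update s.var i k }

/-- Write `k` into cell `j` of array `a`. -/
def Memory.setArr (s : Memory) (a j k : ℕ) : Memory :=
  { s with arr := Function.update s.arr a (Function.update (s.arr a) j k) }

/-- Expressions: constants, registers, array cells, sums and truncated differences. -/
inductive Expr where
  | lit (k : ℕ)
  | var (i : ℕ)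
  | get (a : ℕ) (e : Expr)
  | add (e₁ e₂ : Expr)
  | sub (e₁ e₂ : Expr)

/-- The value of an expression. -/
def Expr.eval (s : Memory) : Expr → ℕ
  | .lit k => k
  | .var i => s.var i
  | .get a e => s.arr a (e.eval s)
  | .add e₁ e₂ => e₁.eval s + e₂.eval s
  | .sub e₁ e₂ => e₁.eval s - e₂.eval s

/-- The number of elementary operations in the evaluation of an expression. -/
def Expr.cost : Expr → ℕ
  | .lit _ => 1
  | .var _ => 1
  | .get _ e => e.cost + 1
  | .add e₁ e₂ => e₁.cost + e₂.cost + 1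
  | .sub e₁ e₂ => e₁.cost + e₂.cost + 1

/-- Programs; the tests are of the form `e₁ < e₂`. -/
inductive Program where
  | skip
  | assign (i : ℕ) (e : Expr)
  | put (a : ℕ) (e₁ e₂ : Expr)
  | seq (p q : Program)
  | ifLt (e₁ e₂ : Expr) (p q : Program)
  | whileLt (e₁ e₂ : Expr) (p : Program)

/-- `Exec p s t s'`: the program `p`, started on the memory `s`, halts after `t` elementary steps
with memory `s'`. -/
inductive Exec : Program → Memory → ℕ → Memory → Prop
  | skip (s : Memory) : Exec .skip s 1 s
  | assign (i : ℕ) (e : Expr) (s : Memory) :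
      Exec (.assign i e) s (e.cost + 1) (s.setVar i (e.eval s))
  | put (a : ℕ) (e₁ e₂ : Expr) (s : Memory) :
      Exec (.put a e₁ e₂) s (e₁.cost + e₂.cost + 1) (s.setArr a (e₁.eval s) (e₂.eval s))
  | seq {p q : Program} {s s' s'' : Memory} {t t' : ℕ} :
      Exec p s t s' → Exec q s' t' s'' → Exec (.seq p q) s (t + t') s''
  | ifTrue {e₁ e₂ : Expr} {p q : Program} {s s' : Memory} {t : ℕ} :
      e₁.eval s < e₂.eval s → Exec p s t s' →
      Exec (.ifLt e₁ e₂ p q) s (e₁.cost + e₂.cost + 1 + t) s'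
  | ifFalse {e₁ e₂ : Expr} {p q : Program} {s s' : Memory} {t : ℕ} :
      ¬ e₁.eval s < e₂.eval s → Exec q s t s' →
      Exec (.ifLt e₁ e₂ p q) s (e₁.cost + e₂.cost + 1 + t) s'
  | whileTrue {e₁ e₂ : Expr} {p : Program} {s s' s'' : Memory} {t t' : ℕ} :
      e₁.eval s < e₂.eval s → Exec p s t s' → Exec (.whileLt e₁ e₂ p) s' t' s'' →
      Exec (.whileLt e₁ e₂ p) s (e₁.cost + e₂.cost + 1 + t + t') s''
  | whileFalse {e₁ e₂ : Expr} {p : Program} {s : Memory} :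
      ¬ e₁.eval s < e₂.eval s →
      Exec (.whileLt e₁ e₂ p) s (e₁.cost + e₂.cost + 1) s

/-- The list `l` is stored in array `a` from cell `j` on. -/
def Memory.Stores {n : ℕ} (s : Memory) (a j : ℕ) (l : List (Fin n)) : Prop :=
  ∀ (i : ℕ) (h : i < l.length), s.arr a (j + i) = (l[i] : ℕ)

/-- `s` contains the graph `G` given by its adjacency lists, each in arbitrary order: the number of
vertices is in register `0`, and the list of the neighbours of the vertex `v` occupies the cells of
array `1` from `s.arr 0 v` (included) to `s.arr 0 (v + 1)` (excluded). The rest of the memory is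
arbitrary. -/
def Memory.Encodes {n : ℕ} (s : Memory) (G : SimpleGraph (Fin n)) : Prop :=
  s.var 0 = n ∧ s.arr 0 0 = 0 ∧
    ∀ v : Fin n, ∃ l : List (Fin n), l.Nodup ∧ (∀ w, w ∈ l ↔ G.Adj v w) ∧
      s.arr 0 (v + 1) = s.arr 0 v + l.length ∧ s.Stores 1 (s.arr 0 v) l

end Machine

/-- `p` is a certifying recognition algorithm for connected unit interval graphs which runs in
time `C * (n + m)`: started on the adjacency lists of a connected graph with `n` vertices and `m`
edges, it halts within this time and leaves

* in array `2` an ordering `σ` produced by the two-pass algorithm, its maxBFS being started at a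
  vertex of maximum degree;
* in register `1` the answer, which is `1` if the graph is a unit interval graph and `0` otherwise;
* a certificate: if the answer is `1`, then `σ` is a Left-Right ordering; if it is `0`, then
  array `3` holds an obstruction, whose number of vertices is in register `2`. -/
def IsCertifyingRecognition (p : Program) (C : ℕ) : Prop :=
  ∀ (n : ℕ) (G : SimpleGraph (Fin n)) [DecidableRel G.Adj], G.Connected →
    ∀ s : Memory, s.Encodes G →
      ∃ (t : ℕ) (s' : Memory), Exec p s t s' ∧ t ≤ C * (n + G.edgeFinset.card) ∧
        ∃ σ : List (Fin n), s'.Stores 2 0 σ ∧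
          (∃ x, (∀ y, G.degree y ≤ G.degree x) ∧ IsTwoPassOutput G x σ) ∧
          ((s'.var 1 = 1 ∧ IsUnitIntervalGraph G ∧ IsLeftRightOrdering G σ) ∨
            (s'.var 1 = 0 ∧ ¬ IsUnitIntervalGraph G ∧
              ∃ w : List (Fin n), s'.var 2 = w.length ∧ s'.Stores 3 0 w ∧ IsObstruction G w))

end IUG

/-! The link between models and orderings is an indifference rank: real ranks, ties allowed, such
that a vertex whose rank lies weakly between those of the ends of an edge is adjacent to both ends.
The left endpoints of a proper interval model form such a rank. Conversely, a Left-Right ordering is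
realised by unit intervals placed one after another (`exists_unit_placement`). Unit models are
proper, so (1) reduces to the claim that the two-pass ordering is Left-Right as soon as some rank
exists.

Twins (vertices with equal closed neighbourhoods) may exchange ranks. Let `r` be the last vertex of
the maxBFS and `z` the vertex of extreme rank on its side of the root. If `z` is neither `r` nor the
root, then `z` and `r` are siblings, N[z] is contained in N[r], and `z` is visited before `r`, so
deg r ≤ deg z and they are twins (`BFSLayout.last_isTwin`). Hence some rank has `r` as its least
vertex. From there a minBFS visits the vertices by non-decreasing rank up to twins, again by
comparing nested neighbourhoods of siblings (`BFSLayout.rank_le_or_twin`), and disorder among twins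
does not affect the Left-Right property.

For (2), a BFS ordering is Left-Right as soon as every vertex strictly between the parent of `c` and
`c` is adjacent to `c`, for all `c`. The parent is the first neighbour, so it suffices to count the
neighbours of `c` before `c` (`isViolation_iff`). At the first failure, twelve vertices computed
from `c` and the two search trees contain an induced claw, net or 3-sun, or three consecutive
vertices of an induced cycle (`isLocated_of_violation`). The degree orders supply private neighbours
there, and the trees supply claws or paths to the root avoiding a neighbourhood. In the cycle case,
a further BFS outside the neighbourhood of the middle vertex finds the rest, its parent path being
induced (`isObstruction_of_parents`). Trying all tuples of the twelve vertices is a constant number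
of linear-time tests.

No obstruction admits a rank, which gives (3) and the correctness of a negative answer. A positive
answer is correct by the unit placement. So (2) does not rely on (1).

Running times are measured in multiples of the size of the program (`Runs`). This absorbs the
constants and leaves only loop rounds to count, which stay within n + 2m + 1 up to the fixed length
of the program. -/

namespace IUG

/-! ### Interval models, indifference ranks and unit placements. -/

section Intervals

variable {V : Type*}

/-- A weak linear arrangement of the vertices in which every edge spans a clique. -/
def IsIndifferenceRank (G : SimpleGraph V) (f : V → ℝ) : Prop :=
  ∀ a b c, f a ≤ f b → f b ≤ f c → a ≠ b → b ≠ c → G.Adj a c → G.Adj a b ∧ G.Adj b c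

theorem IsUnitIntervalGraph.isProper {G : SimpleGraph V} (h : IsUnitIntervalGraph G) :
    IsProperIntervalGraph G := by
  obtain ⟨R, ℓ, hR⟩ := h
  refine ⟨R, fun u v hs => ?_⟩
  have h1 := (Set.Icc_subset_Icc_iff (R.left_le_right u)).1 hs.1
  apply hs.2
  have := hR u
  have := hR v
  exact Set.Icc_subset_Icc (by linarith) (by linarith)

/-- Left endpoints are the ranks. An interval starting later cannot end earlier without being
strictly contained, so right endpoints follow the same order, and an interval reaching from `a` to
`c` forces the one of `b` to meet both. -/
theorem IsProperIntervalGraph.exists_rank {G : SimpleGraph V} (h : IsProperIntervalGraph G) :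
    ∃ f, IsIndifferenceRank G f := by
  obtain ⟨R, hR⟩ := h
  refine ⟨R.left, fun a b c hab hbc nab nbc hac => ?_⟩
  obtain ⟨y, hy1, hy2⟩ := (R.adj_iff a c hac.ne).1 hac
  have hb := R.left_le_right b
  have hc := R.left_le_right c
  simp only [Set.mem_Icc] at hy1 hy2
  have hr : R.right a ≤ R.right b := by
    by_contra hlt
    push Not at hlt
    refine hR b a ⟨Set.Icc_subset_Icc hab hlt.le, fun hs => ?_⟩
    have := (Set.Icc_subset_Icc_iff (R.left_le_right a)).1 hs
    linarith [this.2]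
  constructor
  · exact (R.adj_iff a b nab).2 ⟨R.left b, ⟨⟨hab, by linarith⟩, ⟨le_rfl, hb⟩⟩⟩
  · exact (R.adj_iff b c nbc).2 ⟨R.left c, ⟨⟨hbc, by linarith⟩, ⟨le_rfl, hc⟩⟩⟩

theorem sublist_pair_of_mem {σ : List V} {a b : V} (ha : a ∈ σ) (hb : b ∈ σ) (hab : a ≠ b) :
    List.Sublist [a, b] σ ∨ List.Sublist [b, a] σ := by
  obtain ⟨s, t, rfl⟩ := List.append_of_mem ha
  rcases List.mem_append.1 hb with hb | hb
  · right
    exact (List.singleton_sublist.2 hb).append (List.singleton_sublist.2 (by simp))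
  · left
    have hb : b ∈ t := by simpa [hab.symm] using hb
    exact ((List.singleton_sublist.2 hb).cons_cons a).trans (List.sublist_append_right _ _)

/-- Vertices are placed from left to right, and distance exactly 1 is never used. Because all
conditions are strict, the new vertex only has to lie above finitely many lower bounds and below
finitely many upper bounds. -/
theorem exists_unit_placement [Fintype V] (G : SimpleGraph V) (σ : List V) (hnd : σ.Nodup)
    (hσ : ∀ a b c, List.Sublist [a, b, c] σ → G.Adj a c → G.Adj a b ∧ G.Adj b c) :
    ∃ f : V → ℝ, ∀ a b, List.Sublist [a, b] σ →
      f a < f b ∧ (G.Adj a b → f b < f a + 1) ∧ (¬ G.Adj a b → f a + 1 < f b) := by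
  classical
  induction σ using List.reverseRecOn with
  | nil => exact ⟨fun _ => 0, fun a b h => by simp at h⟩
  | append_singleton σ v ih =>
    have hnd' := List.nodup_append.1 hnd
    have hv : v ∉ σ := fun h => hnd'.2.2 v h v (by simp) rfl
    obtain ⟨f, hf⟩ := ih hnd'.1
      (fun a b c h => hσ a b c (h.trans (List.sublist_append_left _ _)))
    have key3 : ∀ a b, List.Sublist [a, b] σ → List.Sublist [a, b, v] (σ ++ [v]) :=
      fun a b h => h.append (List.Sublist.refl [v])
    have total : ∀ a ∈ σ, ∀ b ∈ σ, a ≠ b → List.Sublist [a, b] σ ∨ List.Sublist [b, a] σ :=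
      fun a ha b hb hab => sublist_pair_of_mem ha hb hab
    -- Lower bounds: all earlier vertices, and the points at distance 1 after the non-neighbours of
    -- `v`. Upper bounds: the points at distance 1 after its neighbours.
    let lo : Finset ℝ := (σ.toFinset.image f) ∪
      ((σ.toFinset.filter (fun a => ¬ G.Adj a v)).image (fun a => f a + 1))
    let hi : Finset ℝ := (σ.toFinset.filter (fun a => G.Adj a v)).image (fun a => f a + 1)
    have hlohi : ∀ x ∈ lo, ∀ y ∈ hi, x < y := by
      intro x hx y hy
      simp only [lo, hi, Finset.mem_union, Finset.mem_image, Finset.mem_filter,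
        List.mem_toFinset] at hx hy
      obtain ⟨b, ⟨hb, hbv⟩, rfl⟩ := hy
      -- By the Left-Right property, whatever comes after a neighbour `b` of `v` is adjacent to both
      -- `b` and `v`. So it is within distance 1 of `b`, and every non-neighbour of `v` comes before
      -- `b`.
      rcases hx with ⟨a, ha, rfl⟩ | ⟨a, ⟨ha, hav⟩, rfl⟩
      · by_cases hab : a = b
        · subst hab; linarith
        · rcases total a ha b hb hab with h | h
          · linarith [(hf a b h).1]
          · exact (hf b a h).2.1 (hσ b a v (key3 b a h) hbv).1
      · have hab : a ≠ b := fun h => hav (h ▸ hbv)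
        rcases total a ha b hb hab with h | h
        · linarith [(hf a b h).1]
        · exact absurd (hσ b a v (key3 b a h) hbv).2 hav
    obtain ⟨m, hm1, hm2⟩ := Order.exists_between_finsets lo hi hlohi
    refine ⟨Function.update f v m, fun a b hab => ?_⟩
    have hab' : List.Sublist [a, b] σ ∨ (a ∈ σ ∧ b = v) := by
      rcases List.sublist_append_iff.1 hab with ⟨l1, l2, h12, h1, h2⟩
      rcases List.sublist_singleton.1 h2 with rfl | rfl
      · left; rw [List.append_nil] at h12; exact h12 ▸ h1
      · have : [a] ++ [b] = l1 ++ [v] := by simpa using h12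
        obtain ⟨rfl, h4⟩ := List.append_inj' this rfl
        right
        exact ⟨List.singleton_sublist.1 h1, by simpa using h4⟩
    rcases hab' with h | ⟨ha, rfl⟩
    · have ha : a ≠ v := fun e => hv (e ▸ h.subset (by simp))
      have hb : b ≠ v := fun e => hv (e ▸ h.subset (by simp))
      simpa [Function.update_of_ne ha, Function.update_of_ne hb] using hf a b h
    · have hav : a ≠ b := fun e => hv (e ▸ ha)
      simp only [Function.update_of_ne hav, Function.update_self]
      refine ⟨hm1 _ (Finset.mem_union_left _ (Finset.mem_image.2 ⟨a, by simpa using ha, rfl⟩)),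
        fun h => hm2 _ ?_, fun h => hm1 _ ?_⟩
      · simp only [hi, Finset.mem_image, Finset.mem_filter]
        exact ⟨a, ⟨by simpa using ha, h⟩, rfl⟩
      · simp only [lo, Finset.mem_union, Finset.mem_image, Finset.mem_filter]
        right
        exact ⟨a, ⟨by simpa using ha, h⟩, rfl⟩

theorem IsLeftRightOrdering.isUnit [Fintype V] {G : SimpleGraph V} {σ : List V}
    (h : IsLeftRightOrdering G σ) : IsUnitIntervalGraph G := by
  obtain ⟨f, hf⟩ := exists_unit_placement G σ h.1 h.2.2
  have key : ∀ a b, List.Sublist [a, b] σ → (G.Adj a b ↔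
      (Set.Icc (f a) (f a + 1) ∩ Set.Icc (f b) (f b + 1)).Nonempty) := by
    intro a b hab
    obtain ⟨h1, h2, h3⟩ := hf a b hab
    constructor
    · intro had
      exact ⟨f b, ⟨h1.le, (h2 had).le⟩, ⟨le_rfl, by linarith⟩⟩
    · rintro ⟨y, hy1, hy2⟩
      by_contra hn
      have := h3 hn
      simp only [Set.mem_Icc] at hy1 hy2
      linarith
  refine ⟨⟨f, fun v => f v + 1, fun v => by linarith, fun u v huv => ?_⟩, 1, fun v => by simp⟩
  rcases sublist_pair_of_mem (h.2.1 u) (h.2.1 v) huv with h | h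
  · exact key u v h
  · rw [G.adj_comm, Set.inter_comm]; exact key v u h

end Intervals

section NoRank

variable {V W : Type*} {G : SimpleGraph V} {f : V → ℝ}

theorem IsIndifferenceRank.comp {H : SimpleGraph W} (hf : IsIndifferenceRank G f) (e : H ↪g G) :
    IsIndifferenceRank H (f ∘ e) := by
  intro a b c h1 h2 nab nbc hac
  have := hf (e a) (e b) (e c) h1 h2 (e.injective.ne nab) (e.injective.ne nbc) (e.map_rel_iff.2 hac)
  simpa using this

/-- Were the rank of `w` weakly between those of the ends, `w` would be adjacent to both. Applied
along a path whose edges all satisfy the hypothesis, this keeps the whole path strictly on one side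
of `w`. -/
theorem IsIndifferenceRank.same_side (hf : IsIndifferenceRank G f) {u v w : V} (huv : G.Adj u v)
    (hu : u ≠ w) (hv : v ≠ w) (h : ¬ G.Adj w u ∨ ¬ G.Adj w v) :
    (f u < f w ∧ f v < f w) ∨ (f w < f u ∧ f w < f v) := by
  by_contra hcon
  have h2 : (f u ≤ f w ∧ f w ≤ f v) ∨ (f v ≤ f w ∧ f w ≤ f u) := by
    rcases le_total (f u) (f w) with h1 | h1 <;> rcases le_total (f v) (f w) with h2 | h2 <;>
      grind
  rcases h2 with ⟨h1, h2⟩ | ⟨h1, h2⟩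
  · have := hf u w v h1 h2 hu hv.symm huv
    grind [G.adj_comm]
  · have := hf v w u h1 h2 hv hu.symm huv.symm
    grind [G.adj_comm]

/-- Each leaf has the other two, joined through the centre, on one side. So none of the three leaves
has the middle rank. -/
theorem IsIndifferenceRank.not_claw {f : Fin 4 → ℝ} : ¬ IsIndifferenceRank claw f := by
  intro h
  have a1 : claw.Adj 0 1 := by simp [claw]
  have a2 : claw.Adj 0 2 := by simp [claw]
  have a3 : claw.Adj 0 3 := by simp [claw]
  have n1 : ¬ claw.Adj 1 2 := by simp [claw]
  have n2 : ¬ claw.Adj 1 3 := by simp [claw]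
  have n3 : ¬ claw.Adj 2 3 := by simp [claw]
  have s1 := h.same_side (w := 1) a2 (by decide) (by decide) (by tauto)
  have s2 := h.same_side (w := 1) a3 (by decide) (by decide) (by tauto)
  have s3 := h.same_side (w := 2) a1 (by decide) (by decide) (by grind [SimpleGraph.adj_comm])
  have s4 := h.same_side (w := 2) a3 (by decide) (by decide) (by tauto)
  have s5 := h.same_side (w := 3) a1 (by decide) (by decide) (by grind [SimpleGraph.adj_comm])
  have s6 := h.same_side (w := 3) a2 (by decide) (by decide) (by grind [SimpleGraph.adj_comm])
  grind

/-- The pendant vertices form an asteroidal triple: any two are joined by a path avoiding the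
neighbourhood of the third. Again none of the three can have the middle rank. -/
theorem IsIndifferenceRank.not_net {f : Fin 6 → ℝ} : ¬ IsIndifferenceRank net f := by
  intro h
  have key : ∀ u v w : Fin 6, net.Adj u v → u ≠ w → v ≠ w → (¬ net.Adj w u ∨ ¬ net.Adj w v) →
      (f u < f w ∧ f v < f w) ∨ (f w < f u ∧ f w < f v) := fun u v w => h.same_side
  have h1 := key 3 0 4 (by simp [net]) (by decide) (by decide) (by simp [net])
  have h2 := key 0 2 4 (by simp [net]) (by decide) (by decide) (by simp [net])
  have h3 := key 2 5 4 (by simp [net]) (by decide) (by decide) (by simp [net])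
  have h4 := key 4 1 3 (by simp [net]) (by decide) (by decide) (by simp [net])
  have h5 := key 1 2 3 (by simp [net]) (by decide) (by decide) (by simp [net])
  have h6 := key 2 5 3 (by simp [net]) (by decide) (by decide) (by simp [net])
  have h7 := key 3 0 5 (by simp [net]) (by decide) (by decide) (by simp [net])
  have h8 := key 0 1 5 (by simp [net]) (by decide) (by decide) (by simp [net])
  have h9 := key 1 4 5 (by simp [net]) (by decide) (by decide) (by simp [net])
  grind

/-- The outer vertices form an asteroidal triple, any two being joined through a single vertex of
the triangle. -/
theorem IsIndifferenceRank.not_sun {f : Fin 6 → ℝ} : ¬ IsIndifferenceRank sun f := by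
  intro h
  have key : ∀ u v w : Fin 6, sun.Adj u v → u ≠ w → v ≠ w → (¬ sun.Adj w u ∨ ¬ sun.Adj w v) →
      (f u < f w ∧ f v < f w) ∨ (f w < f u ∧ f w < f v) := fun u v w => h.same_side
  have h1 := key 3 0 4 (by simp [sun]) (by decide) (by decide) (by simp [sun])
  have h2 := key 0 5 4 (by simp [sun]) (by decide) (by decide) (by simp [sun])
  have h3 := key 4 2 3 (by simp [sun]) (by decide) (by decide) (by simp [sun])
  have h4 := key 2 5 3 (by simp [sun]) (by decide) (by decide) (by simp [sun])
  have h5 := key 3 1 5 (by simp [sun]) (by decide) (by decide) (by simp [sun])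
  have h6 := key 1 4 5 (by simp [sun]) (by decide) (by decide) (by simp [sun])
  grind

/-- Of the two neighbours of the vertex of least rank, the lower one lies between that vertex and
the other neighbour. Hence the two neighbours are adjacent, which fails in a cycle of length at
least 4. -/
theorem IsIndifferenceRank.not_cycle {k : ℕ} (hk : 4 ≤ k) {f : Fin k → ℝ} :
    ¬ IsIndifferenceRank (SimpleGraph.cycleGraph k) f := by
  intro h
  obtain ⟨n, rfl⟩ : ∃ n, k = n + 4 := ⟨k - 4, by omega⟩
  obtain ⟨v, -, hv⟩ := Finset.exists_min_image Finset.univ f ⟨0, Finset.mem_univ _⟩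
  have h1 : (SimpleGraph.cycleGraph (n + 4)).Adj v (v + 1) := by
    rw [SimpleGraph.cycleGraph_adj]; right; simp
  have h2 : (SimpleGraph.cycleGraph (n + 4)).Adj v (v - 1) := by
    rw [SimpleGraph.cycleGraph_adj]; left; simp
  have two : (1 : Fin (n + 4)) + 1 = ⟨2, by omega⟩ := by
    ext; simp [Fin.val_add]
  have h3 : ¬ (SimpleGraph.cycleGraph (n + 4)).Adj (v + 1) (v - 1) := by
    rw [SimpleGraph.cycleGraph_adj]
    have e1 : v + 1 - (v - 1) = 1 + 1 := by abel
    have e2 : v - 1 - (v + 1) = - (1 + 1) := by abel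
    rw [e1, e2]
    rintro (h | h)
    · rw [two] at h
      simp [Fin.ext_iff] at h
    · have h : (1 : Fin (n + 4)) + 1 + 1 = 0 := by rw [neg_eq_iff_add_eq_zero] at h; exact h
      rw [two] at h
      simp only [Fin.ext_iff, Fin.val_add, Fin.val_one, Fin.val_zero] at h
      rw [Nat.mod_eq_of_lt (by omega)] at h
      omega
  have hne : v + 1 ≠ v - 1 := by
    intro e
    have : (1 : Fin (n + 4)) + 1 = 0 := by
      have : v + 1 - (v - 1) = 0 := by rw [e]; simp
      rw [← this]; abel
    rw [two] at this
    simp [Fin.ext_iff] at this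
  rcases le_total (f (v + 1)) (f (v - 1)) with h' | h'
  · exact h3 (h v _ _ (hv _ (Finset.mem_univ _)) h' h1.ne hne h2).2
  · exact h3 (h v _ _ (hv _ (Finset.mem_univ _)) h' h2.ne hne.symm h1).2.symm

theorem IsObstruction.not_isUnit {w : List V} (hw : IsObstruction G w) :
    ¬ IsUnitIntervalGraph G := by
  intro hG
  obtain ⟨f, hf⟩ := hG.isProper.exists_rank
  rcases hw with ⟨e, -⟩ | ⟨e, -⟩ | ⟨e, -⟩ | ⟨k, hk, e, -⟩
  · exact (hf.comp e).not_claw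
  · exact (hf.comp e).not_net
  · exact (hf.comp e).not_sun
  · exact (hf.comp e).not_cycle hk

end NoRank

/-! ### Positions and parents in a breadth-first search. -/

section Layout

variable {V : Type*}

/-- The positions `pos` and the parents `par` of the vertices in a complete breadth-first search
started at `x`; the root is its own parent. -/
structure BFSLayout (G : SimpleGraph V) (le : V → V → Prop) (x : V) (pos : V → ℕ) (par : V → V) :
    Prop where
  inj : Function.Injective pos
  root_par : par x = x
  par_adj : ∀ v, v ≠ x → G.Adj (par v) v
  par_lt : ∀ v, v ≠ x → pos (par v) < pos v
  par_le : ∀ q v, G.Adj q v → pos (par v) ≤ pos q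
  mono : ∀ a b, pos a < pos b → pos (par a) ≤ pos (par b)
  le_of : ∀ a b, pos a < pos b → a ≠ x → par a = par b → le a b

namespace BFSLayout

variable {G : SimpleGraph V} {le : V → V → Prop} {x : V} {pos : V → ℕ} {par : V → V}

theorem root_lt (B : BFSLayout G le x pos par) {v : V} (hv : v ≠ x) : pos x < pos v := by
  induction hn : pos v using Nat.strong_induction_on generalizing v with
  | _ n ih =>
    subst hn
    have h1 := B.par_lt v hv
    by_cases h : par v = x
    · rwa [h] at h1
    · exact (ih _ h1 h rfl).trans h1

theorem root_le (B : BFSLayout G le x pos par) (v : V) : pos x ≤ pos v := by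
  by_cases h : v = x
  · rw [h]
  · exact (B.root_lt h).le

theorem ne_root (B : BFSLayout G le x pos par) {u v : V} (h : pos u < pos v) : v ≠ x := by
  rintro rfl
  exact absurd (B.root_le u) (by omega)

theorem par_pos_le (B : BFSLayout G le x pos par) (v : V) : pos (par v) ≤ pos v := by
  by_cases h : v = x
  · rw [h, B.root_par]
  · exact (B.par_lt v h).le

theorem mono' (B : BFSLayout G le x pos par) {a b : V} (h : pos a ≤ pos b) :
    pos (par a) ≤ pos (par b) := by
  rcases h.eq_or_lt with h | h
  · rw [B.inj h]
  · exact B.mono a b h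

end BFSLayout

/-- The index of the first vertex of `l` adjacent to `v`. -/
noncomputable def firstNbr (G : SimpleGraph V) (l : List V) (v : V) : ℕ :=
  open Classical in l.findIdx (fun q => decide (G.Adj q v))

/-- A vertex that has a visited neighbour keeps its first neighbour forever. This makes its parent
independent of the rest of the search. -/
theorem firstNbr_append_of_lt {G : SimpleGraph V} {l l' : List V} {v : V}
    (h : firstNbr G l v < l.length) : firstNbr G (l ++ l') v = firstNbr G l v := by
  unfold firstNbr at *
  rw [List.findIdx_append, if_pos]
  simpa using List.findIdx_lt_length.1 h

theorem firstNbr_concat {G : SimpleGraph V} {l : List V} {v u : V}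
    (h : ∀ q ∈ l, ¬ G.Adj q v) (hu : G.Adj u v) : firstNbr G (l ++ [u]) v = l.length := by
  unfold firstNbr
  rw [List.findIdx_append, if_neg]
  · simp [List.findIdx_cons, hu]
  · simpa using h

theorem firstNbr_adj {G : SimpleGraph V} {l : List V} {v p : V}
    (h : l[firstNbr G l v]? = some p) : G.Adj p v := by
  unfold firstNbr at h
  simpa using List.findIdx_of_getElem?_eq_some h

theorem firstNbr_le_of_getElem? {G : SimpleGraph V} {l : List V} {v q : V} {i : ℕ}
    (hi : l[i]? = some q) (h : G.Adj q v) : firstNbr G l v ≤ i := by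
  unfold firstNbr
  by_contra hlt
  push Not at hlt
  obtain ⟨hi', he⟩ := List.getElem?_eq_some_iff.1 hi
  have := List.not_of_lt_findIdx hlt
  simp [he, h] at this

/-- The invariant of a breadth-first search with visited list `d` and queue `q`. -/
structure BFSInv (G : SimpleGraph V) (le : V → V → Prop) (x : V) (d q : List V) : Prop where
  nodup : (d ++ q).Nodup
  head : (d ++ q)[0]? = some x
  closed : ∀ u ∈ d, ∀ v, G.Adj u v → v ∈ d ++ q
  first_lt : ∀ v ∈ d ++ q, v ≠ x → firstNbr G d v < d.length
  first_before : ∀ i v, (d ++ q)[i]? = some v → v ≠ x → firstNbr G d v < i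
  sorted : (d ++ q).Pairwise (fun a b => a = x ∨ b = x ∨ (firstNbr G d a ≤ firstNbr G d b ∧
    (firstNbr G d a = firstNbr G d b → le a b)))

/-- By `closed`, the vertices queued now have no neighbour visited before `u`, so their first
neighbour has index `d.length`, larger than that of any older vertex other than the root; the older
indices are frozen. Sortedness follows, the priority deciding only among the children of `u`. -/
theorem BFSInv.step {G : SimpleGraph V} {le : V → V → Prop} {x : V} {c c' : List V × List V}
    (hs : BFSStep G le c c') (h : BFSInv G le x c.1 c.2) : BFSInv G le x c'.1 c'.2 := by
  obtain ⟨d, u, q, l, hnd, hl, hle⟩ := hs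
  simp only at *
  have hall : d ++ [u] ++ (q ++ l) = (d ++ u :: q) ++ l := by simp
  have hfresh : ∀ w ∈ l, w ∉ d ++ u :: q := by
    intro w hw hm
    rcases List.mem_append.1 hm with hm | hm
    · exact ((hl w).1 hw).2.1 hm
    · exact ((hl w).1 hw).2.2 hm
  have hold : ∀ v ∈ d ++ u :: q, v ≠ x → firstNbr G (d ++ [u]) v = firstNbr G d v :=
    fun v hv hx => firstNbr_append_of_lt (h.first_lt v hv hx)
  have hnew : ∀ w ∈ l, firstNbr G (d ++ [u]) w = d.length := by
    intro w hw
    refine firstNbr_concat (fun q' hq' had => ?_) ((hl w).1 hw).1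
    exact hfresh w hw (h.closed q' hq' w had)
  have hx : x ∈ d ++ u :: q := List.mem_of_getElem? h.head
  have hlen : 0 < (d ++ u :: q).length := by simp
  refine ⟨?_, ?_, ?_, ?_, ?_, ?_⟩
  · rw [hall, List.nodup_append]
    exact ⟨h.nodup, hnd, fun a ha b hb hab => hfresh b hb (hab ▸ ha)⟩
  · rw [hall, List.getElem?_append_left hlen]; exact h.head
  · intro v hv w hvw
    rw [hall]
    rcases List.mem_append.1 hv with hv | hv
    · exact List.mem_append_left _ (h.closed v hv w hvw)
    · rw [List.mem_singleton] at hv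
      subst hv
      by_cases hw : w ∈ d ++ v :: q
      · exact List.mem_append_left _ hw
      · rw [List.mem_append] at hw
        push Not at hw
        exact List.mem_append_right _ ((hl w).2 ⟨hvw, hw.1, hw.2⟩)
  · intro v hv hvx
    rw [hall] at hv
    rw [List.length_append, List.length_singleton]
    rcases List.mem_append.1 hv with hv | hv
    · rw [hold v hv hvx]
      have := h.first_lt v hv hvx
      omega
    · rw [hnew v hv]; omega
  · intro i v hi hvx
    rw [hall] at hi
    rcases lt_or_ge i (d ++ u :: q).length with hlt | hge
    · rw [List.getElem?_append_left hlt] at hi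
      rw [hold v (List.mem_of_getElem? hi) hvx]
      exact h.first_before i v hi hvx
    · rw [List.getElem?_append_right hge] at hi
      rw [hnew v (List.mem_of_getElem? hi)]
      simp at hge
      omega
  · rw [hall, List.pairwise_append]
    refine ⟨h.sorted.imp_of_mem ?_, hle.imp_of_mem ?_, ?_⟩
    · intro a b ha hb hab
      by_cases hax : a = x
      · exact Or.inl hax
      by_cases hbx : b = x
      · exact Or.inr (Or.inl hbx)
      · rwa [hold a ha hax, hold b hb hbx]
    · intro a b ha hb hab
      right; right
      rw [hnew a ha, hnew b hb]
      exact ⟨le_rfl, fun _ => hab⟩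
    · intro a ha b hb
      by_cases hax : a = x
      · exact Or.inl hax
      · right; right
        rw [hnew b hb, hold a ha hax]
        have := h.first_lt a ha hax
        exact ⟨by omega, fun e => by omega⟩

theorem BFSInv.start (G : SimpleGraph V) (le : V → V → Prop) (x : V) : BFSInv G le x [] [x] := by
  refine ⟨by simp, by simp, by simp, by simp, ?_, by simp⟩
  intro i v hi hv
  rcases i with _ | i
  · simp at hi; exact absurd hi.symm hv
  · simp at hi

theorem BFSInv.of_steps {G : SimpleGraph V} {le : V → V → Prop} {x : V} {c : List V × List V}
    (h : Relation.ReflTransGen (BFSStep G le) ([], [x]) c) : BFSInv G le x c.1 c.2 := by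
  induction h with
  | refl => exact BFSInv.start G le x
  | tail _ hs ih => exact ih.step hs

theorem BFSInv.mem_of_reachable {G : SimpleGraph V} {le : V → V → Prop} {x : V} {σ : List V}
    (h : BFSInv G le x σ []) {u v : V} (hu : u ∈ σ) (huv : G.Reachable u v) : v ∈ σ := by
  obtain ⟨p⟩ := huv
  induction p with
  | nil => exact hu
  | cons hadj _ ih => exact ih (by simpa using h.closed _ hu _ hadj)

/-- The position of a parent is the index of the first neighbour, so every field can be read off the
invariant. The parents are an argument so that they may be those computed by the program. -/
theorem BFSInv.layout [DecidableEq V] {G : SimpleGraph V} {le : V → V → Prop} {x : V} {σ : List V}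
    (h : BFSInv G le x σ []) (hall : ∀ v, v ∈ σ) {par : V → V} (hx : par x = x)
    (hpar : ∀ v, v ≠ x → σ[firstNbr G σ v]? = some (par v)) :
    BFSLayout G le x (fun v => σ.idxOf v) par := by
  have hnd : σ.Nodup := by simpa using h.nodup
  have hget : ∀ v, σ[σ.idxOf v]? = some v := fun v => List.getElem?_idxOf (hall v)
  have hidx : ∀ i v, σ[i]? = some v → σ.idxOf v = i := by
    intro i v hi
    obtain ⟨hi', he⟩ := List.getElem?_eq_some_iff.1 hi
    rw [← he]
    exact hnd.idxOf_getElem i hi'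
  have hx0 : σ.idxOf x = 0 := hidx 0 x (by simpa using h.head)
  have hfn : ∀ v, v ≠ x → σ.idxOf (par v) = firstNbr G σ v := fun v hv => hidx _ _ (hpar v hv)
  have hsort : ∀ a b, σ.idxOf a < σ.idxOf b → a = x ∨ b = x ∨ (firstNbr G σ a ≤ firstNbr G σ b ∧
    (firstNbr G σ a = firstNbr G σ b → le a b)) := by
    intro a b hab
    have := h.sorted
    simp only [List.append_nil] at this
    have h2 := List.pairwise_iff_getElem.1 this (σ.idxOf a) (σ.idxOf b)
      (List.idxOf_lt_length_iff.2 (hall a)) (List.idxOf_lt_length_iff.2 (hall b)) hab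
    simpa using h2
  have hnex : ∀ {a b : V}, σ.idxOf a < σ.idxOf b → b ≠ x := by
    rintro a b hab rfl
    omega
  refine ⟨fun a b hab => ?_, hx, fun v hv => firstNbr_adj (hpar v hv), fun v hv => ?_,
    fun q v hqv => ?_, fun a b hab => ?_, fun a b hab hax hp => ?_⟩
  · exact (List.idxOf_inj (hall a)).1 hab
  · rw [hfn v hv]
    exact h.first_before _ v (by simpa using hget v) hv
  · by_cases hv : v = x
    · rw [hv, hx]; omega
    · rw [hfn v hv]
      exact firstNbr_le_of_getElem? (hget q) hqv
  · by_cases ha : a = x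
    · rw [ha, hx]; omega
    · rw [hfn a ha, hfn b (hnex hab)]
      exact (((hsort a b hab).resolve_left ha).resolve_left (hnex hab)).1
  · refine (((hsort a b hab).resolve_left hax).resolve_left (hnex hab)).2 ?_
    rw [← hfn a hax, ← hfn b (hnex hab), hp]

theorem IsBFSOrdering.inv {G : SimpleGraph V} {le : V → V → Prop} {x : V} {σ : List V}
    (h : IsBFSOrdering G le x σ) : BFSInv G le x σ [] :=
  BFSInv.of_steps h

theorem BFSInv.mem_of_connected {G : SimpleGraph V} {le : V → V → Prop} {x : V} {σ : List V}
    (h : BFSInv G le x σ []) (hG : G.Connected) (v : V) : v ∈ σ :=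
  h.mem_of_reachable (by simpa using List.mem_of_getElem? h.head) (hG.preconnected x v)

theorem IsBFSOrdering.exists_layout [DecidableEq V] {G : SimpleGraph V} {le : V → V → Prop} {x : V}
    {σ : List V} (h : IsBFSOrdering G le x σ) (hG : G.Connected) :
    ∃ par, BFSLayout G le x (fun v => σ.idxOf v) par := by
  have hall := h.inv.mem_of_connected hG
  -- The default of `getD` is never used, since every vertex other than the root has a visited
  -- neighbour.
  refine ⟨fun v => if v = x then x else (σ[firstNbr G σ v]?).getD x,
    h.inv.layout hall (by simp) fun v hv => ?_⟩
  have := h.inv.first_lt v (by simpa using hall v) hv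
  simp [hv, List.getElem?_eq_getElem this]

end Layout

/-! ### Twins, and the Left-Right property of the two-pass ordering. -/

section TwoPass

variable {V : Type*} {G : SimpleGraph V}

/-- `u` and `v` have the same closed neighbourhood. -/
def IsTwin (G : SimpleGraph V) (u v : V) : Prop :=
  ∀ w, (G.Adj u w ∨ u = w) ↔ (G.Adj v w ∨ v = w)

theorem IsTwin.adj {u v w : V} (h : IsTwin G u v) (hu : u ≠ w) (hv : v ≠ w) :
    G.Adj u w ↔ G.Adj v w := by
  have := h w
  tauto

/-- The hypotheses say that N[u] is contained in N[v] and is at least as large. All consequences of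
the degree orders of the two searches are drawn through this comparison. -/
theorem isTwin_of_degree_le [Fintype V] [DecidableRel G.Adj] {u v : V} (huv : G.Adj u v)
    (hsub : ∀ w, G.Adj u w → w ≠ v → G.Adj v w) (hd : G.degree v ≤ G.degree u) : IsTwin G u v := by
  classical
  have h1 : insert u (G.neighborFinset u) ⊆ insert v (G.neighborFinset v) := by
    intro w hw
    simp only [Finset.mem_insert, SimpleGraph.mem_neighborFinset] at hw ⊢
    rcases hw with rfl | hw
    · exact Or.inr huv.symm
    · by_cases hwv : w = v
      · exact Or.inl hwv
      · exact Or.inr (hsub w hw hwv)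
  have h2 := Finset.eq_of_subset_of_card_le h1 (by
    rw [Finset.card_insert_of_notMem (by simp), Finset.card_insert_of_notMem (by simp)]
    simpa using hd)
  intro w
  have := Finset.ext_iff.1 h2 w
  simp only [Finset.mem_insert, SimpleGraph.mem_neighborFinset] at this
  grind

/-- Exchanging two twins is an automorphism of the graph. -/
theorem IsIndifferenceRank.swap [DecidableEq V] {f : V → ℝ} (hf : IsIndifferenceRank G f)
    {u v : V} (h : IsTwin G u v) : IsIndifferenceRank G (f ∘ Equiv.swap u v) := by
  have key : ∀ a b, G.Adj (Equiv.swap u v a) (Equiv.swap u v b) ↔ G.Adj a b := by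
    intro a b
    have ha := h a
    have hb := h b
    have := G.adj_comm
    have h0 : ∀ w, ¬ G.Adj w w := fun w => G.irrefl
    simp only [Equiv.swap_apply_def]
    grind
  intro a b c h1 h2 nab nbc hac
  have := hf _ _ _ h1 h2 ((Equiv.swap u v).injective.ne nab) ((Equiv.swap u v).injective.ne nbc)
    ((key a c).2 hac)
  rwa [key, key] at this

theorem IsIndifferenceRank.neg {f : V → ℝ} (hf : IsIndifferenceRank G f) :
    IsIndifferenceRank G (fun v => - f v) := by
  intro a b c h1 h2 nab nbc hac
  have := hf c b a (by linarith) (by linarith) nbc.symm nab.symm hac.symm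
  exact ⟨this.2.symm, this.1.symm⟩

variable [Fintype V] [DecidableRel G.Adj]

/-- The last vertex of a maxBFS is a twin of the last vertex on its side of the root. -/
theorem BFSLayout.last_isTwin {x r : V} {pos : V → ℕ} {par : V → V} {f : V → ℝ}
    (B : BFSLayout G (fun u v => G.degree v ≤ G.degree u) x pos par)
    (hr : ∀ v, v ≠ r → pos v < pos r) (hf : IsIndifferenceRank G f) (hxr : f x ≤ f r)
    {z : V} (hz : ∀ v, f v ≤ f z) (hzr : z ≠ r) (hzx : z ≠ x) : IsTwin G z r := by
  -- Follow the parents from `v` to the root, which ranks no higher than `r`. The first edge that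
  -- passes over the rank of `r` has its lower end adjacent to `r`.
  have hB : ∀ v, v ≠ x → v ≠ r → f r ≤ f v → ∃ q, G.Adj q r ∧ pos q < pos v := by
    intro v
    induction hn : pos v using Nat.strong_induction_on generalizing v with
    | _ n ih =>
      subst hn
      intro hvx hvr hrv
      have h1 := B.par_lt v hvx
      have hpr : par v ≠ r := by
        intro e
        rw [e] at h1
        have := hr v hvr
        omega
      rcases le_total (f (par v)) (f r) with h | h
      · exact ⟨par v, (hf _ _ _ h hrv hpr hvr.symm (B.par_adj v hvx)).1, h1⟩
      · by_cases hpx : par v = x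
        · refine ⟨par v, (hf _ _ _ ?_ hrv hpr hvr.symm (B.par_adj v hvx)).1, h1⟩
          rw [hpx]; exact hxr
        · obtain ⟨q, hq, hlt⟩ := ih _ h1 _ rfl hpx hpr h
          exact ⟨q, hq, hlt.trans h1⟩
  have hzr' := hr z hzr
  have hrx : r ≠ x := B.ne_root hzr'
  have hpp := B.mono z r hzr'
  have hpz := B.par_lt z hzx
  have hpzr : par z ≠ r := by
    intro e
    rw [e] at hpz
    omega
  -- Otherwise `r` would have a neighbour visited before `par z`, hence an earlier parent than `z`,
  -- although `z` is visited before `r`.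
  have hle : par z = x ∨ f (par z) ≤ f r := by
    by_contra hcon
    push Not at hcon
    obtain ⟨q, hq, hlt⟩ := hB (par z) hcon.1 hpzr hcon.2.le
    have := B.par_le q r hq
    omega
  have hle' : f (par z) ≤ f r := by
    rcases hle with h | h
    · rw [h]; exact hxr
    · exact h
  obtain ⟨h1, h2⟩ := hf _ _ _ hle' (hz r) hpzr hzr.symm (B.par_adj z hzx)
  have hpe : par z = par r := B.inj (le_antisymm hpp (B.par_le _ _ h1))
  have hd := B.le_of z r hzr' hzx hpe
  -- Since `z` has the greatest rank, a neighbour of `z` either lies below `r`, so that its edge to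
  -- `z` spans `r`, or lies between `r` and `z`. Thus N[z] is contained in N[r].
  refine isTwin_of_degree_le h2.symm (fun w hw hwr => ?_) hd
  rcases le_total (f w) (f r) with h | h
  · exact (hf w r z h (hz r) hwr hzr.symm hw.symm).1.symm
  · exact (hf r w z h (hz w) hwr.symm hw.ne.symm h2).1

/-- Induction on the position of `a`, supposing that `b` ranks below `a`. If the parent of `a` ranks
no higher than `b`, its edge to `a` spans `b`, so `a` and `b` are siblings with N[b] contained in
N[a], and the degree order makes them twins. If the parent ranks above `b`, it is a twin of `b` by
induction. Then `b` is adjacent to the grandparent of `a` and its parent precedes that of `a`,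
contrary to the visiting order. -/
theorem BFSLayout.rank_le_or_twin {r : V} {pos : V → ℕ} {par : V → V} {f : V → ℝ}
    (B : BFSLayout G (fun u v => G.degree u ≤ G.degree v) r pos par)
    (hf : IsIndifferenceRank G f) (hr : ∀ v, f r ≤ f v) :
    ∀ a b, pos a < pos b → f a ≤ f b ∨ IsTwin G a b := by
  intro a
  induction hn : pos a using Nat.strong_induction_on generalizing a with
  | _ n ih =>
  subst hn
  intro b hab
  by_contra hcon
  push Not at hcon
  obtain ⟨hlt, hnt⟩ := hcon
  have har : a ≠ r := by rintro rfl; exact absurd (hr b) (by linarith)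
  have hbr : b ≠ r := B.ne_root hab
  have hpa := B.par_lt a har
  have hpadj := B.par_adj a har
  have hpb : par a ≠ b := by rintro e; rw [e] at hpa; omega
  have hba : b ≠ a := by rintro rfl; omega
  have hmono := B.mono a b hab
  rcases le_or_gt (f (par a)) (f b) with h | h
  · obtain ⟨h1, h2⟩ := hf _ _ _ h hlt.le hpb hba hpadj
    have hpe : par a = par b := B.inj (le_antisymm hmono (B.par_le _ _ h1))
    have hd := B.le_of a b hab har hpe
    refine hnt fun w => ((isTwin_of_degree_le h2 (fun w hw hwa => ?_) hd) w).symm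
    rcases le_total (f b) (f w) with hbw | hbw
    · rcases le_total (f a) (f w) with haw | haw
      · exact (hf b a w hlt.le haw hba hwa.symm hw).2
      · exact (hf b w a hbw haw hw.ne hwa h2).2.symm
    -- A neighbour `w` of `b` of lower rank is not visited before the common parent. By induction it
    -- is the parent, ranks at least as high, or is a twin of the parent; in each case it is
    -- adjacent to `a`.
    · have hpw : pos (par a) ≤ pos w := by rw [hpe]; exact B.par_le _ _ hw.symm
      rcases hpw.eq_or_lt with hpw | hpw
      · rw [← B.inj hpw]; exact hpadj.symm
      · have hne : par a ≠ w := by rintro e; rw [e] at hpw; omega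
        rcases ih _ hpa _ rfl w hpw with h3 | h3
        · exact (hf (par a) w a h3 (hbw.trans hlt.le) hne hwa hpadj).2.symm
        · exact ((h3.adj hpadj.ne hwa).1 hpadj).symm
  · have htw : IsTwin G (par a) b := (ih _ hpa _ rfl b (hpa.trans hab)).resolve_left (by linarith)
    have hpr : par a ≠ r := by intro e; rw [e] at h; exact absurd (hr b) (by linarith)
    have hpp := B.par_lt _ hpr
    have h4 := B.par_adj _ hpr
    have hne : b ≠ par (par a) := by intro e; rw [← e] at hpp; omega
    have h5 : G.Adj b (par (par a)) := (htw.adj h4.ne.symm hne).1 h4.symm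
    have := B.par_le _ _ h5.symm
    omega

/-- A reversal and a twin exchange, where needed, produce a rank `g` with `r` least. Positions then
agree with `g` up to twins. When two consecutive vertices of the triple are twins, they are adjacent
and the edge `ac` passes from one to the other. -/
theorem IsTwoPassOutput.isLeftRight (hG : G.Connected) {x : V} {σ : List V}
    (h : IsTwoPassOutput G x σ) {f : V → ℝ} (hf : IsIndifferenceRank G f) :
    IsLeftRightOrdering G σ := by
  classical
  obtain ⟨τ, r, hτ, hσ⟩ := h
  obtain ⟨P, B⟩ := hτ.exists_layout hG
  have hτnd : (τ ++ [r]).Nodup := by simpa using hτ.inv.nodup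
  have hτall := hτ.inv.mem_of_connected hG
  have hσall := hσ.inv.mem_of_connected hG
  have hlast : ∀ v, v ≠ r → (τ ++ [r]).idxOf v < (τ ++ [r]).idxOf r := by
    intro v hv
    have hr : r ∉ τ := fun hm => (List.nodup_append.1 hτnd).2.2 r hm r (by simp) rfl
    have hvτ : v ∈ τ := by simpa [hv] using hτall v
    rw [List.idxOf_append_of_mem hvτ, List.idxOf_append_of_notMem hr]
    have := List.idxOf_lt_length_iff.2 hvτ
    omega
  have hext : ∃ g, IsIndifferenceRank G g ∧ ∀ v, g r ≤ g v := by
    have main : ∀ f : V → ℝ, IsIndifferenceRank G f → f x ≤ f r →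
        ∃ g, IsIndifferenceRank G g ∧ ∀ v, g v ≤ g r := by
      intro f hf hxr
      obtain ⟨z, -, hz⟩ := Finset.exists_max_image Finset.univ f ⟨r, Finset.mem_univ _⟩
      have hz : ∀ v, f v ≤ f z := fun v => hz v (Finset.mem_univ v)
      by_cases hzr : z = r
      · exact ⟨f, hf, hzr ▸ hz⟩
      by_cases hzx : z = x
      · exact ⟨f, hf, fun v => (hz v).trans (hzx ▸ hxr)⟩
      refine ⟨_, hf.swap (B.last_isTwin hlast hf hxr hz hzr hzx), fun v => ?_⟩
      simpa using hz _
    rcases le_total (f x) (f r) with h | h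
    · obtain ⟨g, hg, hgr⟩ := main f hf h
      exact ⟨_, hg.neg, fun v => neg_le_neg (hgr v)⟩
    · obtain ⟨g, hg, hgr⟩ := main _ hf.neg (neg_le_neg h)
      exact ⟨_, hg.neg, fun v => neg_le_neg (hgr v)⟩
  obtain ⟨g, hg, hgr⟩ := hext
  obtain ⟨par, B'⟩ := hσ.exists_layout hG
  have hnd : σ.Nodup := by simpa using hσ.inv.nodup
  refine ⟨hnd, hσall, fun a b c hs hac => ?_⟩
  have hlt : ∀ a b, List.Sublist [a, b] σ → σ.idxOf a < σ.idxOf b := by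
    intro a b hs
    have := List.pairwise_iff_forall_sublist (l := σ) (R := fun a b => σ.idxOf a < σ.idxOf b)
    refine this.1 ?_ hs
    rw [List.pairwise_iff_getElem]
    intro i j hi hj hij
    rwa [hnd.idxOf_getElem, hnd.idxOf_getElem]
  have hab := hlt a b (List.Sublist.trans (by simp) hs)
  have hbc := hlt b c (List.Sublist.trans (by simp) hs)
  have nab : a ≠ b := by rintro rfl; omega
  have nbc : b ≠ c := by rintro rfl; omega
  have h1 := B'.rank_le_or_twin hg hgr a b hab
  have h2 := B'.rank_le_or_twin hg hgr b c hbc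
  rcases h1 with h1 | h1
  · rcases h2 with h2 | h2
    · exact hg a b c h1 h2 nab nbc hac
    · have hb := (h2.adj nab.symm hac.ne.symm).2 hac.symm
      exact ⟨hb.symm, ((h2 c).2 (Or.inr rfl)).resolve_right nbc⟩
  · have hb := (h1.adj hac.ne nbc).1 hac
    exact ⟨(((h1 b).2 (Or.inr rfl)).resolve_right nab), hb⟩

theorem IsTwoPassOutput.iff_unit (hG : G.Connected) {x : V} {σ : List V}
    (h : IsTwoPassOutput G x σ) : IsUnitIntervalGraph G ↔ IsLeftRightOrdering G σ :=
  ⟨fun hu => let ⟨_, hf⟩ := hu.isProper.exists_rank; h.isLeftRight hG hf, fun hl => hl.isUnit⟩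

theorem IsTwoPassOutput.iff_proper (hG : G.Connected) {x : V} {σ : List V}
    (h : IsTwoPassOutput G x σ) : IsProperIntervalGraph G ↔ IsLeftRightOrdering G σ :=
  ⟨fun hu => let ⟨_, hf⟩ := hu.exists_rank; h.isLeftRight hG hf, fun hl => hl.isUnit.isProper⟩

end TwoPass

/-! ### Locating an obstruction behind the first violation. -/

section Violation

variable {V : Type*} {G : SimpleGraph V}

/-- The graph `G` with all edges meeting `F` removed. -/
def avoid (G : SimpleGraph V) (F : Set V) : SimpleGraph V where
  Adj u v := G.Adj u v ∧ u ∉ F ∧ v ∉ F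
  symm := ⟨fun _ _ h => ⟨h.1.symm, h.2.2, h.2.1⟩⟩
  loopless := ⟨fun _ h => G.irrefl h.1⟩

@[simp]
theorem avoid_adj {F : Set V} {u v : V} : (avoid G F).Adj u v ↔ G.Adj u v ∧ u ∉ F ∧ v ∉ F :=
  Iff.rfl

/-- The closed neighbourhood of `c` without `a` and `b`. -/
def rim (G : SimpleGraph V) (c a b : V) : Set V :=
  {v | (v = c ∨ G.Adj c v) ∧ v ≠ a ∧ v ≠ b}

/-- `a` and `b` are nonadjacent neighbours of `c`, and some path between them has no other vertex
in the closed neighbourhood of `c`: there is an induced cycle through `a`, `c`, `b`. -/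
structure IsHoleTriple (G : SimpleGraph V) (c a b : V) : Prop where
  adj_left : G.Adj c a
  adj_right : G.Adj c b
  ne : a ≠ b
  not_adj : ¬ G.Adj a b
  reachable : (avoid G (rim G c a b)).Reachable a b

/-- An obstruction that can be found from the vertices in `S`. -/
def IsLocated (G : SimpleGraph V) (S : Set V) : Prop :=
  (∃ e : claw ↪g G, ∀ i, e i ∈ S) ∨ (∃ e : net ↪g G, ∀ i, e i ∈ S) ∨
    (∃ e : sun ↪g G, ∀ i, e i ∈ S) ∨ ∃ c ∈ S, ∃ a ∈ S, ∃ b ∈ S, IsHoleTriple G c a b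

theorem exists_embedding {k : ℕ} {H : SimpleGraph (Fin k)} {w : Fin k → V}
    (hinj : Function.Injective w) (h : ∀ i j, i < j → (G.Adj (w i) (w j) ↔ H.Adj i j)) :
    ∃ e : H ↪g G, ∀ i, e i = w i := by
  refine ⟨⟨⟨w, hinj⟩, fun {i j} => ?_⟩, fun i => rfl⟩
  change G.Adj (w i) (w j) ↔ H.Adj i j
  rcases lt_trichotomy i j with hij | rfl | hij
  · exact h i j hij
  · simp
  · rw [G.adj_comm, H.adj_comm]; exact h j i hij

/-- In the net and in the sun, distinct vertices have distinct neighbourhoods, so the adjacencies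
alone force the images to be distinct. The leaves of a claw share their neighbourhood, and there
distinctness has to be assumed. -/
theorem exists_embedding_of_distinguishing {k : ℕ} {H : SimpleGraph (Fin k)} {w : Fin k → V}
    (hH : ∀ i j, i ≠ j → ∃ l, ¬ (H.Adj i l ↔ H.Adj j l))
    (h : ∀ i j, i < j → (G.Adj (w i) (w j) ↔ H.Adj i j)) : ∃ e : H ↪g G, ∀ i, e i = w i := by
  have h' : ∀ i j, (G.Adj (w i) (w j) ↔ H.Adj i j) := by
    intro i j
    rcases lt_trichotomy i j with hij | rfl | hij
    · exact h i j hij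
    · simp
    · rw [G.adj_comm, H.adj_comm]; exact h j i hij
  refine exists_embedding (fun i j hij => ?_) h
  by_contra hne
  obtain ⟨l, hl⟩ := hH i j hne
  rw [← h', ← h', hij] at hl
  exact hl Iff.rfl

instance : DecidableRel net.Adj := fun i j =>
  decidable_of_iff ((s(i, j) = s(0, 1) ∨ s(i, j) = s(1, 2) ∨ s(i, j) = s(0, 2) ∨
    s(i, j) = s(0, 3) ∨ s(i, j) = s(1, 4) ∨ s(i, j) = s(2, 5)) ∧ i ≠ j) (by simp [net])

instance : DecidableRel sun.Adj := fun i j =>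
  decidable_of_iff ((s(i, j) = s(0, 1) ∨ s(i, j) = s(1, 2) ∨ s(i, j) = s(0, 2) ∨
    s(i, j) = s(3, 0) ∨ s(i, j) = s(3, 1) ∨ s(i, j) = s(4, 1) ∨ s(i, j) = s(4, 2) ∨
    s(i, j) = s(5, 0) ∨ s(i, j) = s(5, 2)) ∧ i ≠ j) (by simp [sun])

instance : DecidableRel claw.Adj := fun i j =>
  decidable_of_iff ((s(i, j) = s(0, 1) ∨ s(i, j) = s(0, 2) ∨ s(i, j) = s(0, 3)) ∧ i ≠ j)
    (by simp [claw])

theorem isLocated_claw {S : Set V} {c x y z : V} (hc : c ∈ S) (hx : x ∈ S) (hy : y ∈ S)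
    (hz : z ∈ S) (cx : G.Adj c x) (cy : G.Adj c y) (cz : G.Adj c z) (nxy : ¬ G.Adj x y)
    (nxz : ¬ G.Adj x z) (nyz : ¬ G.Adj y z) (exy : x ≠ y) (exz : x ≠ z) (eyz : y ≠ z) :
    IsLocated G S := by
  left
  have := cx.ne
  have := cy.ne
  have := cz.ne
  obtain ⟨e, he⟩ := exists_embedding (G := G) (H := claw)
    (w := ![c, x, y, z]) (by
      intro i j hij
      fin_cases i <;> fin_cases j <;> simp_all) (fun i j hij => by
      fin_cases i <;> fin_cases j <;>
        first
          | exact absurd hij (by decide)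
          | exact iff_of_true (by assumption) (by decide)
          | exact iff_of_false (by assumption) (by decide))
  refine ⟨e, fun i => ?_⟩
  rw [he]
  fin_cases i <;> assumption

theorem isLocated_net {S : Set V} {p q s u v w : V} (hp : p ∈ S) (hq : q ∈ S) (hs : s ∈ S)
    (hu : u ∈ S) (hv : v ∈ S) (hw : w ∈ S) (pq : G.Adj p q) (qs : G.Adj q s) (ps : G.Adj p s)
    (pu : G.Adj p u) (qv : G.Adj q v) (sw : G.Adj s w) (npv : ¬ G.Adj p v) (npw : ¬ G.Adj p w)
    (nqu : ¬ G.Adj q u) (nqw : ¬ G.Adj q w) (nsu : ¬ G.Adj s u) (nsv : ¬ G.Adj s v)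
    (nuv : ¬ G.Adj u v) (nuw : ¬ G.Adj u w) (nvw : ¬ G.Adj v w) : IsLocated G S := by
  right; left
  obtain ⟨e, he⟩ := exists_embedding_of_distinguishing (G := G) (H := net) (by decide)
    (w := ![p, q, s, u, v, w]) (fun i j hij => by
      fin_cases i <;> fin_cases j <;>
        first
          | exact absurd hij (by decide)
          | exact iff_of_true (by assumption) (by decide)
          | exact iff_of_false (by assumption) (by decide))
  refine ⟨e, fun i => ?_⟩
  rw [he]
  fin_cases i <;> assumption

theorem isLocated_sun {S : Set V} {p q s u v w : V} (hp : p ∈ S) (hq : q ∈ S) (hs : s ∈ S)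
    (hu : u ∈ S) (hv : v ∈ S) (hw : w ∈ S) (pq : G.Adj p q) (qs : G.Adj q s) (ps : G.Adj p s)
    (pu : G.Adj p u) (qu : G.Adj q u) (qv : G.Adj q v) (sv : G.Adj s v) (pw : G.Adj p w)
    (sw : G.Adj s w) (npv : ¬ G.Adj p v) (nqw : ¬ G.Adj q w) (nsu : ¬ G.Adj s u)
    (nuv : ¬ G.Adj u v) (nuw : ¬ G.Adj u w) (nvw : ¬ G.Adj v w) : IsLocated G S := by
  right; right; left
  obtain ⟨e, he⟩ := exists_embedding_of_distinguishing (G := G) (H := sun) (by decide)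
    (w := ![p, q, s, u, v, w]) (fun i j hij => by
      fin_cases i <;> fin_cases j <;>
        first
          | exact absurd hij (by decide)
          | exact iff_of_true (by assumption) (by decide)
          | exact iff_of_false (by assumption) (by decide))
  refine ⟨e, fun i => ?_⟩
  rw [he]
  fin_cases i <;> assumption

theorem isLocated_hole {S : Set V} {c a b : V} (hc : c ∈ S) (ha : a ∈ S) (hb : b ∈ S)
    (h : IsHoleTriple G c a b) : IsLocated G S :=
  Or.inr (Or.inr (Or.inr ⟨c, hc, a, ha, b, hb, h⟩))

/-- Three vertices and a common neighbour of two of them outside the neighbourhood of the third. -/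
theorem isHoleTriple_of_common {c a b d : V} (ca : G.Adj c a) (cb : G.Adj c b) (ne : a ≠ b)
    (nab : ¬ G.Adj a b) (ad : G.Adj a d) (db : G.Adj d b) (hd : d ≠ c) (ncd : ¬ G.Adj c d) :
    IsHoleTriple G c a b := by
  refine ⟨ca, cb, ne, nab, ?_⟩
  have h1 : (avoid G (rim G c a b)).Adj a d := by simp [rim, ad, hd, ncd]
  have h2 : (avoid G (rim G c a b)).Adj d b := by simp [rim, db, hd, ncd]
  exact h1.reachable.trans h2.reachable

namespace BFSLayout

variable {le : V → V → Prop} {x : V} {pos : V → ℕ} {par : V → V}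

/-- Positions do not increase along the parents. Beyond `v` itself, the tree path to the root only
meets vertices visited no later than the parent of `v`. -/
theorem reachable_root (B : BFSLayout G le x pos par) {F : Set V} {v : V} (hv : v ∉ F)
    (h : ∀ w, pos w ≤ pos (par v) → w ∉ F) : (avoid G F).Reachable v x := by
  induction hn : pos v using Nat.strong_induction_on generalizing v with
  | _ n ih =>
    subst hn
    by_cases hvx : v = x
    · rw [hvx]
    · have hp := h _ le_rfl
      have hadj : (avoid G F).Adj v (par v) := ⟨(B.par_adj v hvx).symm, hv, hp⟩
      exact hadj.reachable.trans (ih _ (B.par_lt v hvx) hp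
        (fun w hw => h w (hw.trans (B.par_pos_le _))) rfl)

theorem not_adj_of_lt (B : BFSLayout G le x pos par) {v w : V} (h : pos w < pos (par v)) :
    ¬ G.Adj w v := fun hadj => by
  have := B.par_le w v hadj
  omega

end BFSLayout

variable [Fintype V] [DecidableRel G.Adj] {x r : V} {pos : V → ℕ} {P : V → V}

/-- Otherwise N[u] lies in N[r]. If `u` is not the root, its parent is then adjacent to `r`, so `u`
and `r` are siblings, and the degree order makes them twins; but `v` sees only one of them. If `u`
is the root, it is the parent of `r`, hence of `v`, which is visited earlier. -/
theorem exists_private_nbr (B : BFSLayout G (fun u v => G.degree v ≤ G.degree u) x pos P)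
    (hr : ∀ v, v ≠ r → pos v < pos r) {u v : V} (hu : G.Adj r u) (hv : G.Adj r v) (huv : u ≠ v)
    (nuv : ¬ G.Adj u v) : ∃ y, G.Adj u y ∧ y ≠ r ∧ ¬ G.Adj r y := by
  by_contra hcon
  push Not at hcon
  have hur := hr u hu.ne.symm
  by_cases hux : u = x
  · have h1 := B.par_le u r hu.symm
    have h2 := B.mono v r (hr v hv.ne.symm)
    have h3 : P v = x := by
      apply B.inj
      have := B.root_le (P v)
      subst hux
      omega
    have h4 := B.par_adj v (by rw [← hux]; exact huv.symm)
    rw [h3, ← hux] at h4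
    exact nuv h4
  · have h1 := B.par_adj u hux
    have h2 := B.par_lt u hux
    have h3 : P u ≠ r := by intro e; rw [e] at h2; omega
    have h4 := B.par_le _ _ (hcon _ h1.symm h3).symm
    have h5 : P u = P r := B.inj (le_antisymm (B.mono u r hur) h4)
    have h6 := isTwin_of_degree_le hu.symm hcon (B.le_of u r hur hux h5)
    exact nuv ((h6.adj huv hv.ne).2 hv)

/-- The last vertex of a maxBFS has two nonadjacent neighbours. -/
theorem isLocated_of_not_simplicial
    (B : BFSLayout G (fun u v => G.degree v ≤ G.degree u) x pos P)
    (hr : ∀ v, v ≠ r → pos v < pos r) {b c y z : V} (hb : G.Adj r b) (hc : G.Adj r c) (hbc : b ≠ c)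
    (nbc : ¬ G.Adj b c) (hz : (∃ w, G.Adj b w ∧ w ≠ r ∧ ¬ G.Adj r w) →
      G.Adj b z ∧ z ≠ r ∧ ¬ G.Adj r z)
    (hy : (∃ w, G.Adj c w ∧ w ≠ r ∧ ¬ G.Adj r w) → G.Adj c y ∧ y ≠ r ∧ ¬ G.Adj r y)
    {S : Set V} (hS : ∀ v ∈ [c, b, z, y, r, P r, P (P r)], v ∈ S) : IsLocated G S := by
  obtain ⟨hbz, hzr, nrz⟩ := hz (exists_private_nbr B hr hb hc hbc nbc)
  obtain ⟨hcy, hyr, nry⟩ := hy (exists_private_nbr B hr hc hb hbc.symm (fun h => nbc h.symm))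
  have hrx : r ≠ x := B.ne_root (hr z hzr)
  have htr := B.par_adj r hrx
  -- If the parent of `r` is the root, every non-root vertex visited before `r` is also its child.
  -- So `y` and `z` see the root, which is the centre of a claw with leaves `r`, `y`, `z`, unless
  -- `y` and `z` coincide or are adjacent and close a cycle.
  by_cases ht : P r = x
  · have main : ∀ w, w ≠ r → ¬ G.Adj r w → G.Adj (P r) w := by
      intro w hwr nrw
      have hwx : w ≠ x := by rintro rfl; rw [ht] at htr; exact nrw htr.symm
      have h1 : P w = P r := by
        apply B.inj
        have := B.mono w r (hr w hwr)
        have := B.root_le (P w)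
        rw [ht] at *
        omega
      exact h1 ▸ B.par_adj w hwx
    by_cases hyz : y = z
    · subst hyz
      exact isLocated_hole (hS r (by simp)) (hS b (by simp)) (hS c (by simp))
        (isHoleTriple_of_common hb hc hbc nbc hbz hcy.symm hzr nrz)
    by_cases ayz : G.Adj y z
    · refine isLocated_hole (hS r (by simp)) (hS b (by simp)) (hS c (by simp))
        ⟨hb, hc, hbc, nbc, ?_⟩
      have h1 : (avoid G (rim G r b c)).Adj b z := by simp [rim, hbz, hzr, nrz]
      have h2 : (avoid G (rim G r b c)).Adj z y := by simp [rim, ayz.symm, hzr, nrz, hyr, nry]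
      have h3 : (avoid G (rim G r b c)).Adj y c := by simp [rim, hcy.symm, hyr, nry]
      exact (h1.reachable.trans h2.reachable).trans h3.reachable
    · exact isLocated_claw (hS (P r) (by simp)) (hS r (by simp)) (hS y (by simp)) (hS z (by simp))
        htr (main y hyr nry) (main z hzr nrz) nry nrz ayz hyr.symm hzr.symm hyz
  · have hpt := B.par_lt _ ht
    -- A sibling of `r` not adjacent to `r`, together with `r` and their grandparent, gives a claw
    -- centred at the common parent.
    have claw_case : ∀ w, w ∈ S → w ≠ r → ¬ G.Adj r w → P w = P r → IsLocated G S := by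
      intro w hw hwr nrw hP
      have hwx : w ≠ x := by rintro rfl; rw [B.root_par] at hP; exact ht hP.symm
      have h1 : ¬ G.Adj (P (P r)) w := B.not_adj_of_lt (by rw [hP]; exact hpt)
      have h2 := B.par_adj w hwx
      rw [hP] at h2
      refine isLocated_claw (hS (P r) (by simp)) (hS (P (P r)) (by simp)) (hS r (by simp)) hw
        (B.par_adj _ ht).symm htr h2 (B.not_adj_of_lt hpt) h1 nrw ?_ ?_ hwr.symm
      · intro e
        have := hr (P r) htr.ne
        rw [e] at hpt
        omega
      · rintro rfl
        exact B.not_adj_of_lt hpt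
          (by have := B.par_lt _ hwx; rw [hP] at this; omega)
    by_cases hPz : P z = P r
    · exact claw_case z (hS z (by simp)) hzr nrz hPz
    by_cases hPy : P y = P r
    · exact claw_case y (hS y (by simp)) hyr nry hPy
    refine isLocated_hole (hS r (by simp)) (hS b (by simp)) (hS c (by simp))
      ⟨hb, hc, hbc, nbc, ?_⟩
    -- A parent strictly before that of `r` precedes every neighbour of `r`, and so does the rest of
    -- its tree path. The paths from `z` and `y` meet at the root and close a cycle through `b`,
    -- `r`, `c`.
    have hreach : ∀ w, w ≠ r → ¬ G.Adj r w → P w ≠ P r →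
        (avoid G (rim G r b c)).Reachable w x := by
      intro w hwr nrw hP
      refine B.reachable_root (by simp [rim, hwr, nrw]) fun v hv => ?_
      have h1 := B.mono w r (hr w hwr)
      have h2 := B.inj.ne hP
      have h3 : ¬ G.Adj v r := B.not_adj_of_lt (by omega)
      have h4 : v ≠ r := by
        rintro rfl
        have := hr _ htr.ne
        omega
      have h5 : ¬ G.Adj r v := fun h => h3 h.symm
      simp [rim, h4, h5]
    have h1 : (avoid G (rim G r b c)).Adj b z := by simp [rim, hbz, hzr, nrz]
    have h3 : (avoid G (rim G r b c)).Adj y c := by simp [rim, hcy.symm, hyr, nry]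
    exact ((h1.reachable.trans (hreach z hzr nrz hPz)).trans (hreach y hyr nry hPy).symm).trans
      h3.reachable

/-- Let t' be the grandparent of `r`. If `p` and `q` both see t', then `p`, `q`, t' and `r`, `u`,
`v` give a 3-sun or a claw. If `q` does not, no vertex up to t' lies in N[q], and the hypothesis
`ntv` puts the parent of `v` strictly before that of `r`. So the tree paths of t' and of this parent
towards the root avoid N[q], apart possibly from the parent itself, and close a cycle through `p`,
`q`. The exception is a parent of `v` adjacent to both `p` and `q`, which takes the role of t' in a
3-sun or claw. -/
theorem isLocated_of_bull_aux
    (B : BFSLayout G (fun u v => G.degree v ≤ G.degree u) x pos P)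
    (hr : ∀ v, v ≠ r → pos v < pos r) (ht : P r ≠ x) {p q u v : V} (hp : G.Adj r p) (hq : G.Adj r q)
    (hpq : G.Adj p q) (hpu : G.Adj p u) (hqv : G.Adj q v) (nqu : ¬ G.Adj q u) (npv : ¬ G.Adj p v)
    (nuv : ¬ G.Adj u v) (nru : ¬ G.Adj r u) (nrv : ¬ G.Adj r v) (hur : u ≠ r) (hvr : v ≠ r)
    (hpt : G.Adj p (P (P r))) (ntv : ¬ G.Adj (P r) v)
    {S : Set V} (hS : ∀ w ∈ [p, q, u, v, r, P (P r), P v], w ∈ S) : IsLocated G S := by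
  have hrx : r ≠ x := B.ne_root (hr v hvr)
  have htr := B.par_adj r hrx
  have htt := B.par_lt _ ht
  have htt' := B.par_adj _ ht
  have hrt : pos (P r) < pos r := hr _ htr.ne
  have nrt : ¬ G.Adj r (P (P r)) := fun h => B.not_adj_of_lt htt h.symm
  have ert : P (P r) ≠ r := by intro e; rw [e] at htt; omega
  have htp := B.par_le p r hp.symm
  have htq := B.par_le q r hq.symm
  have huv : u ≠ v := by rintro rfl; exact npv hpu
  set t' := P (P r) with ht'
  by_cases hqt : G.Adj q t'
  · have hut : u ≠ t' := by rintro rfl; exact nqu hqt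
    have hvt : v ≠ t' := by rintro rfl; exact npv hpt
    by_cases aut : G.Adj u t'
    · by_cases avt : G.Adj v t'
      · exact isLocated_sun (hS p (by simp)) (hS q (by simp)) (hS t' (by simp)) (hS r (by simp))
          (hS v (by simp)) (hS u (by simp)) hpq hqt hpt hp.symm hq.symm hqv avt.symm hpu aut.symm
          npv nqu (fun h => nrt h.symm) nrv nru (fun h => nuv h.symm)
      · exact isLocated_claw (hS q (by simp)) (hS r (by simp)) (hS v (by simp)) (hS t' (by simp))
          hq.symm hqv hqt nrv nrt avt hvr.symm ert.symm hvt
    · exact isLocated_claw (hS p (by simp)) (hS r (by simp)) (hS u (by simp)) (hS t' (by simp))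
        hp.symm hpu hpt nru nrt aut hur.symm ert.symm hut
  · have hPq := B.mono' htq
    rw [← ht'] at hPq
    have hlow : ∀ w, pos w ≤ pos t' → w ≠ q ∧ ¬ G.Adj q w := by
      intro w hw
      refine ⟨by rintro rfl; omega, fun h => ?_⟩
      have h1 := B.par_le w q h.symm
      have h2 : w = t' := B.inj (by omega)
      exact hqt (h2 ▸ h)
    have hvx : v ≠ x := by
      rintro rfl
      exact (hlow v (B.root_le _)).2 hqv
    have hv0 := B.par_adj v hvx
    have hv0t : pos (P v) < pos (P r) := by
      have h1 := B.mono v r (hr v hvr)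
      have h2 : P v ≠ P r := by intro e; rw [e] at hv0; exact ntv hv0
      have := B.inj.ne h2
      omega
    have nrv0 : ¬ G.Adj r (P v) := fun h => B.not_adj_of_lt hv0t h.symm
    have hPv0 : pos (P (P v)) ≤ pos t' := B.mono' hv0t.le
    have hv0q : P v ≠ q := by intro e; rw [e] at hv0t; omega
    have hv0p : P v ≠ p := by intro e; rw [e] at hv0t; omega
    have hv0r : P v ≠ r := by intro e; rw [e] at hv0t; omega
    have htq' := hlow t' le_rfl
    have hpv : p ≠ v := by rintro rfl; exact nrv hp
    have hv0u : P v ≠ u := by intro e; rw [e] at hv0; exact nuv hv0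
    have hreach : ∀ b, (avoid G (rim G q p b)).Reachable p x := by
      intro b
      have h1 : (avoid G (rim G q p b)).Adj p t' := by simp [rim, hpt, htq']
      refine h1.reachable.trans (B.reachable_root h1.2.2 fun w hw => ?_)
      have := hlow w (hw.trans (B.par_pos_le _))
      simp [rim, this]
    have hreach' : ∀ b, (b = P v ∨ ¬ G.Adj q (P v)) →
        (avoid G (rim G q p b)).Reachable (P v) x := by
      intro b hb
      refine B.reachable_root ?_ fun w hw => ?_
      · rcases hb with rfl | hb <;> simp [rim, *]
      · have := hlow w (hw.trans hPv0)
        simp [rim, this]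
    by_cases aqv0 : G.Adj q (P v)
    · by_cases apv0 : G.Adj p (P v)
      · by_cases auv0 : G.Adj u (P v)
        · exact isLocated_sun (hS p (by simp)) (hS q (by simp)) (hS (P v) (by simp))
            (hS r (by simp)) (hS v (by simp)) (hS u (by simp)) hpq aqv0 apv0 hp.symm hq.symm hqv
            hv0 hpu auv0.symm npv nqu (fun h => nrv0 h.symm) nrv nru (fun h => nuv h.symm)
        · exact isLocated_claw (hS p (by simp)) (hS r (by simp)) (hS u (by simp))
            (hS (P v) (by simp)) hp.symm hpu apv0 nru nrv0 auv0 hur.symm hv0r.symm hv0u.symm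
      · exact isLocated_hole (hS q (by simp)) (hS p (by simp)) (hS (P v) (by simp))
          ⟨hpq.symm, aqv0, hv0p.symm, apv0, (hreach _).trans (hreach' _ (Or.inl rfl)).symm⟩
    · refine isLocated_hole (hS q (by simp)) (hS p (by simp)) (hS v (by simp))
          ⟨hpq.symm, hqv, hpv, npv, ((hreach _).trans (hreach' _ (Or.inr aqv0)).symm).trans ?_⟩
      have : (avoid G (rim G q p v)).Adj (P v) v := by simp [rim, hv0, hv0q, aqv0]
      exact this.reachable

/-- The last vertex `r` of a maxBFS is the nose of a bull with horns `u`, `v`. -/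
theorem isLocated_of_bull
    (B : BFSLayout G (fun u v => G.degree v ≤ G.degree u) x pos P)
    (hr : ∀ v, v ≠ r → pos v < pos r)
    (hcl : ∀ w w', G.Adj r w → G.Adj r w' → w ≠ w' → G.Adj w w')
    {p q u v : V} (hp : G.Adj r p) (hq : G.Adj r q)
    (hpu : G.Adj p u) (hqv : G.Adj q v) (nqu : ¬ G.Adj q u) (npv : ¬ G.Adj p v)
    (nuv : ¬ G.Adj u v) (nru : ¬ G.Adj r u) (nrv : ¬ G.Adj r v) (hur : u ≠ r) (hvr : v ≠ r)
    {S : Set V} (hS : ∀ w ∈ [p, q, u, v, r, P r, P (P r), P u, P v], w ∈ S) : IsLocated G S := by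
  have hrx : r ≠ x := B.ne_root (hr v hvr)
  have htr := B.par_adj r hrx
  have huv : u ≠ v := by rintro rfl; exact npv hpu
  have hpq := hcl p q hp hq (by rintro rfl; exact npv hqv)
  by_cases atuv : G.Adj (P r) u ∧ G.Adj (P r) v
  · exact isLocated_claw (hS (P r) (by simp)) (hS r (by simp)) (hS u (by simp)) (hS v (by simp))
      htr atuv.1 atuv.2 nru nrv nuv hur.symm hvr.symm huv
  -- A root that is the parent of `r` is adjacent to every other vertex not adjacent to `r`, in
  -- particular to both horns.
  have ht : P r ≠ x := by
    intro ht
    have main : ∀ w, w ≠ r → ¬ G.Adj r w → G.Adj (P r) w := by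
      intro w hwr nrw
      have hwx : w ≠ x := by rintro rfl; rw [ht] at htr; exact nrw htr.symm
      have h1 : P w = P r := by
        apply B.inj
        have := B.mono w r (hr w hwr)
        have := B.root_le (P w)
        rw [ht] at *
        omega
      exact h1 ▸ B.par_adj w hwx
    exact atuv ⟨main u hur nru, main v hvr nrv⟩
  have htt' := B.par_adj _ ht
  -- If the parent of `r` sees exactly one horn, it can replace the vertex of the bull carrying that
  -- horn, and it is adjacent to its own parent as the auxiliary lemma requires.
  by_cases atu : G.Adj (P r) u
  · have ntv : ¬ G.Adj (P r) v := fun h => atuv ⟨atu, h⟩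
    have htq : P r ≠ q := by intro e; rw [e] at atu; exact nqu atu
    exact isLocated_of_bull_aux B hr ht htr.symm hq (hcl _ _ htr.symm hq htq) atu hqv nqu ntv nuv
      nru nrv hur hvr htt'.symm ntv (fun w hw => hS w (by simp only [List.mem_cons] at hw ⊢; tauto))
  by_cases atv : G.Adj (P r) v
  · have htp : P r ≠ p := by intro e; rw [e] at atv; exact npv atv
    exact isLocated_of_bull_aux B hr ht htr.symm hp (hcl _ _ htr.symm hp htp) atv hpu npv atu
      (fun h => nuv h.symm) nrv nru hvr hur htt'.symm atu
      (fun w hw => hS w (by simp only [List.mem_cons] at hw ⊢; tauto))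
  -- Now `P r` sees neither horn. If the grandparent of `r` sees neither `p` nor `q`, then the
  -- triangle `P r`, `p`, `q` with `P (P r)`, `u`, `v` is a net, unless the grandparent sees a horn
  -- and a four-cycle arises.
  by_cases apt : G.Adj p (P (P r))
  · exact isLocated_of_bull_aux B hr ht hp hq hpq hpu hqv nqu npv nuv nru nrv hur hvr apt atv
      (fun w hw => hS w (by simp only [List.mem_cons] at hw ⊢; tauto))
  by_cases aqt : G.Adj q (P (P r))
  · exact isLocated_of_bull_aux B hr ht hq hp hpq.symm hqv hpu npv nqu (fun h => nuv h.symm) nrv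
      nru hvr hur aqt atu (fun w hw => hS w (by simp only [List.mem_cons] at hw ⊢; tauto))
  have htp : P r ≠ p := by intro e; rw [← e] at hpu; exact atu hpu
  have htq : P r ≠ q := by intro e; rw [← e] at hqv; exact atv hqv
  have atp := hcl _ _ htr.symm hp htp
  have atq := hcl _ _ htr.symm hq htq
  have net' : P (P r) ≠ p := by
    intro e
    have h1 := B.par_le p r hp.symm
    have h2 := B.par_lt _ ht
    rw [e] at h2
    omega
  have neq' : P (P r) ≠ q := by
    intro e
    have h1 := B.par_le q r hq.symm
    have h2 := B.par_lt _ ht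
    rw [e] at h2
    omega
  have hut : u ≠ P r := by rintro e; rw [e] at nru; exact nru htr.symm
  have hvt : v ≠ P r := by rintro e; rw [e] at nrv; exact nrv htr.symm
  by_cases aut : G.Adj (P (P r)) u
  · exact isLocated_hole (hS (P r) (by simp)) (hS (P (P r)) (by simp)) (hS p (by simp))
      (isHoleTriple_of_common htt'.symm atp net' (fun h => apt h.symm) aut hpu.symm hut atu)
  by_cases avt : G.Adj (P (P r)) v
  · exact isLocated_hole (hS (P r) (by simp)) (hS (P (P r)) (by simp)) (hS q (by simp))
      (isHoleTriple_of_common htt'.symm atq neq' (fun h => aqt h.symm) avt hqv.symm hvt atv)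
  exact isLocated_net (hS (P r) (by simp)) (hS p (by simp)) (hS q (by simp))
    (hS (P (P r)) (by simp)) (hS u (by simp)) (hS v (by simp)) atp hpq atq htt'.symm hpu hqv
    atu atv apt npv aqt nqu aut avt nuv

/-- The obstruction behind the first place where the ordering of a minBFS started at the last
vertex of a maxBFS is not a Left-Right ordering. -/
theorem isLocated_of_violation {pos' : V → ℕ} {par : V → V}
    (B : BFSLayout G (fun u v => G.degree v ≤ G.degree u) x pos' P)
    (hr : ∀ v, v ≠ r → pos' v < pos' r)
    (B' : BFSLayout G (fun u v => G.degree u ≤ G.degree v) r pos par)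
    {b c y z : V} (hab : pos (par c) < pos b) (hbc : pos b < pos c) (nbc : ¬ G.Adj b c)
    (hfirst : ∀ c', pos c' < pos c → ∀ b', pos (par c') < pos b' → pos b' < pos c' → G.Adj b' c')
    (hz : (∃ w, G.Adj b w ∧ w ≠ par c ∧ ¬ G.Adj (par c) w) →
      G.Adj b z ∧ z ≠ par c ∧ ¬ G.Adj (par c) z)
    (hy : (∃ w, G.Adj c w ∧ w ≠ par c ∧ ¬ G.Adj (par c) w) →
      G.Adj c y ∧ y ≠ par c ∧ ¬ G.Adj (par c) y)
    {S : Set V} (hS : ∀ v ∈ [c, par c, b, z, y, par (par c), par (par (par c)), r, P r, P (P r),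
      P z, P c], v ∈ S) : IsLocated G S := by
  have hcr : c ≠ r := B'.ne_root hbc
  have hbr : b ≠ r := B'.ne_root hab
  have hac := B'.par_adj c hcr
  have enbc : b ≠ c := by rintro rfl; omega
  -- If `par c` is not the parent of `b`, it lies strictly between that parent and `b`, and there is
  -- no violation at `b`.
  have hadj_ab : G.Adj (par c) b := by
    rcases (B'.mono b c hbc).eq_or_lt with h | h
    · rw [← B'.inj h]; exact B'.par_adj b hbr
    · exact hfirst b hbc _ h hab
  by_cases har : par c = r
  · rw [har] at hadj_ab hac hz hy hS
    exact isLocated_of_not_simplicial B hr hadj_ab hac enbc nbc hz hy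
      (fun w hw => hS w (by simp only [List.mem_cons] at hw ⊢; tauto))
  set a := par c with ha
  have hpa := B'.par_adj a har
  have hpalt := B'.par_lt a har
  have npc : ¬ G.Adj (par a) c := B'.not_adj_of_lt hpalt
  -- The parent of `a` precedes the first neighbour `a` of `c`, so it misses `c`. If it also misses
  -- `b`, there is a claw centred at `a`.
  by_cases apb : G.Adj (par a) b
  swap
  · exact isLocated_claw (hS a (by simp)) (hS (par a) (by simp)) (hS b (by simp)) (hS c (by simp))
      hpa.symm hadj_ab hac apb npc nbc (by intro e; rw [e] at hpalt; omega)
      (by intro e; rw [e] at hpalt; omega) enbc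
  have hpab : par a = par b :=
    B'.inj (le_antisymm (B'.mono a b hab) (B'.par_le _ _ apb))
  have hd := B'.le_of a b hab har hpab
  -- `a` and `b` are siblings with deg a ≤ deg b. If N[b] were contained in N[a] they would be
  -- twins, but `c` sees `a` and not `b`.
  obtain ⟨hbz, hza, naz⟩ := hz (by
    by_contra hcon
    push Not at hcon
    have := isTwin_of_degree_le hadj_ab.symm hcon hd
    exact nbc ((this.adj enbc hac.ne).2 hac))
  have hzc : z ≠ c := by rintro rfl; exact naz hac
  by_cases azc : G.Adj z c
  · exact isLocated_hole (hS a (by simp)) (hS b (by simp)) (hS c (by simp))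
      (isHoleTriple_of_common hadj_ab hac enbc nbc hbz azc hza naz)
  -- Were `z` before `c`, the absence of earlier violations would make it adjacent to `a`, whichever
  -- of `z` and `a` comes first.
  have hcz : pos c < pos z := by
    by_contra hcon
    have hlt : pos z < pos c := by
      have := B'.inj.ne hzc
      omega
    have hparz := B'.mono z c hlt
    rw [← ha] at hparz
    rcases lt_trichotomy (pos a) (pos z) with h | h | h
    · rcases hparz.eq_or_lt with h1 | h1
      · have := B'.par_adj z (B'.ne_root h)
        rw [B'.inj h1] at this
        exact naz this
      · exact naz (hfirst z hlt a h1 h)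
    · exact hza (B'.inj h).symm
    · have h1 := B'.par_le z b hbz.symm
      rw [← hpab] at h1
      rcases h1.eq_or_lt with h1 | h1
      · rw [← B'.inj h1] at naz; exact naz hpa.symm
      · exact naz (hfirst a (by omega) z h1 h).symm
  have nqz : ¬ G.Adj (par a) z := by
    apply B'.not_adj_of_lt
    have := B'.mono c z hcz
    rw [← ha] at this
    omega
  -- The triangle `par a`, `a`, `b` has `c` attached at `a` and `z` at `b`. If `par a` is not the
  -- root, its parent completes a net. If it is, there is a bull with nose `r`, and the first search
  -- has to supply the rest.
  by_cases hqr : par a = r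
  · have hcl : ∀ w w', G.Adj r w → G.Adj r w' → pos w < pos w' → G.Adj w w' := by
      intro w w' hw hw' hlt
      have h1 := B'.par_le _ _ hw'
      have h2 := B'.root_le (par w')
      have h3 : pos w' < pos c := by
        by_contra hcon
        have : w' ≠ c := by rintro rfl; rw [hqr] at npc; exact npc hw'
        have := B'.inj.ne this
        have := B'.mono c w' (by omega)
        rw [← ha] at this
        have := B'.root_lt har
        omega
      have := B'.root_lt hw.ne.symm
      exact hfirst w' h3 w (by omega) hlt
    have hcl' : ∀ w w', G.Adj r w → G.Adj r w' → w ≠ w' → G.Adj w w' := by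
      intro w w' hw hw' hne
      rcases lt_or_gt_of_ne (B'.inj.ne hne) with h | h
      · exact hcl w w' hw hw' h
      · exact (hcl w' w hw' hw h).symm
    rw [hqr] at hpa apb npc nqz
    refine isLocated_of_bull B hr hcl' hpa apb hac hbz nbc naz (fun h => azc h.symm) npc nqz hcr
      (B'.ne_root hcz) (fun w hw => hS w (List.Subset.trans ?_ (List.Subset.refl _) hw))
    simp [List.cons_subset]
  · have hqq := B'.par_lt _ hqr
    have hpac := B'.mono c z hcz
    rw [← ha] at hpac
    exact isLocated_net (hS (par a) (by simp)) (hS a (by simp)) (hS b (by simp))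
      (hS (par (par a)) (by simp)) (hS c (by simp)) (hS z (by simp)) hpa hadj_ab apb
      (B'.par_adj _ hqr).symm hac hbz npc nqz
      (fun h => B'.not_adj_of_lt hqq h.symm) naz
      (fun h => B'.not_adj_of_lt (v := b) (by rw [← hpab]; exact hqq) h.symm) nbc
      (B'.not_adj_of_lt (by rw [← ha]; omega)) (B'.not_adj_of_lt (by omega)) (fun h => azc h.symm)

end Violation

/-! ### From searches to certificates: orderings and induced cycles. -/

section Certificates

variable {V : Type*} {G : SimpleGraph V}

/-- If `ac` is an edge, the parent of `c` is no later than `a`, so `b` lies between that parent and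
`c`. In turn the parent of `b` is no later than that of `c`, so it is either `a` or before `a`. -/
theorem BFSLayout.isLeftRight [DecidableEq V] {le : V → V → Prop} {r : V} {par : V → V} {σ : List V}
    (B : BFSLayout G le r (fun v => σ.idxOf v) par) (hnd : σ.Nodup) (hall : ∀ v, v ∈ σ)
    (h : ∀ b c, σ.idxOf (par c) < σ.idxOf b → σ.idxOf b < σ.idxOf c → G.Adj b c) :
    IsLeftRightOrdering G σ := by
  refine ⟨hnd, hall, fun a b c hs hac => ?_⟩
  have hlt : ∀ a b, List.Sublist [a, b] σ → σ.idxOf a < σ.idxOf b := by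
    intro a b hs
    have := List.pairwise_iff_forall_sublist (l := σ) (R := fun a b => σ.idxOf a < σ.idxOf b)
    refine this.1 ?_ hs
    rw [List.pairwise_iff_getElem]
    intro i j hi hj hij
    rwa [hnd.idxOf_getElem, hnd.idxOf_getElem]
  have hab := hlt a b (List.Sublist.trans (by simp) hs)
  have hbc := hlt b c (List.Sublist.trans (by simp) hs)
  have h1 := B.par_le a c hac
  have h2 := B.mono b c hbc
  refine ⟨?_, h b c (by omega) hbc⟩
  rcases (h2.trans h1).eq_or_lt with h3 | h3
  · rw [← B.inj h3]; exact B.par_adj b (B.ne_root hab)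
  · exact h a b h3 hab

theorem cycleGraph_adj_of_lt {n : ℕ} {i j : Fin n} (hij : i < j) :
    (SimpleGraph.cycleGraph n).Adj i j ↔ (j : ℕ) = i + 1 ∨ ((i : ℕ) = 0 ∧ (j : ℕ) + 1 = n) := by
  rw [SimpleGraph.cycleGraph_adj']
  have hi := i.2
  have hj := j.2
  have hlt : (i : ℕ) < j := hij
  rw [Fin.sub_val_of_le hij.le, Fin.coe_sub_iff_lt.2 hij]
  omega

theorem isObstruction_of_cycle {c : V} {l : List V} (hl : 3 ≤ l.length) (hnd : l.Nodup)
    (hc : c ∉ l)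
    (hadj : ∀ i j (_ : i < j) (hj : j < l.length), G.Adj (l[i]) l[j] ↔ j = i + 1)
    (hcadj : ∀ i (hi : i < l.length), G.Adj c l[i] ↔ i = 0 ∨ i + 1 = l.length) :
    IsObstruction G (c :: l) := by
  right; right; right
  refine ⟨(c :: l).length, by simpa using hl, ?_⟩
  have hnd' : (c :: l).Nodup := List.nodup_cons.2 ⟨hc, hnd⟩
  obtain ⟨e, he⟩ := exists_embedding (G := G)
    (H := SimpleGraph.cycleGraph (c :: l).length) (w := (c :: l).get)
    (List.nodup_iff_injective_get.1 hnd') (fun i j hij => by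
      have hlen : (c :: l).length = l.length + 1 := rfl
      rw [cycleGraph_adj_of_lt hij]
      obtain ⟨i, hi⟩ := i
      obtain ⟨j, hj⟩ := j
      simp only [Fin.mk_lt_mk] at hij
      rcases j with _ | j
      · omega
      rcases i with _ | i
      · simp only [List.get_eq_getElem, List.getElem_cons_zero, List.getElem_cons_succ,
          List.length_cons]
        rw [hcadj]
        simp only [true_and]
        omega
      · simp only [List.get_eq_getElem, List.getElem_cons_succ, List.length_cons]
        rw [hadj i j (by omega) (by simpa using hj)]
        omega)
  refine ⟨e, ?_⟩
  rw [show (⇑e : Fin (c :: l).length → V) = (c :: l).get from funext he, List.ofFn_get]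

/-- The path traced by the parents of a breadth-first search closes up to an induced cycle. -/
theorem isObstruction_of_parents {c a b : V} (hca : G.Adj c a) (hcb : G.Adj c b)
    (nab : ¬ G.Adj a b) {le : V → V → Prop} {σ : List V}
    (h : BFSInv (avoid G (rim G c a b)) le a σ []) (hb : b ∈ σ) (hne : a ≠ b) {par : V → V}
    (hpar : ∀ v ∈ σ, v ≠ a → σ[firstNbr (avoid G (rim G c a b)) σ v]? = some (par v)) :
    ∃ k, k < σ.length ∧ par^[k] b = a ∧ (∀ i < k, par^[i] b ≠ a) ∧
      IsObstruction G (c :: (List.range (k + 1)).map (fun i => par^[i] b)) := by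
  classical
  have hnd : σ.Nodup := by simpa using h.nodup
  set H := avoid G (rim G c a b) with hH
  have hget : ∀ v ∈ σ, σ[σ.idxOf v]? = some v := fun v hv => List.getElem?_idxOf hv
  have hidx : ∀ i v, σ[i]? = some v → σ.idxOf v = i := by
    intro i v hi
    obtain ⟨hi', he⟩ := List.getElem?_eq_some_iff.1 hi
    rw [← he]
    exact hnd.idxOf_getElem i hi'
  have hmem : ∀ v ∈ σ, v ≠ a → par v ∈ σ := fun v hv hva => List.mem_of_getElem? (hpar v hv hva)
  have hadj : ∀ v ∈ σ, v ≠ a → H.Adj (par v) v := fun v hv hva => firstNbr_adj (hpar v hv hva)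
  have hlt : ∀ v ∈ σ, v ≠ a → σ.idxOf (par v) < σ.idxOf v := by
    intro v hv hva
    rw [hidx _ _ (hpar v hv hva)]
    exact h.first_before _ v (by simpa using hget v hv) hva
  have hle : ∀ v ∈ σ, v ≠ a → ∀ q ∈ σ, H.Adj q v → σ.idxOf (par v) ≤ σ.idxOf q := by
    intro v hv hva q hq hqv
    rw [hidx _ _ (hpar v hv hva)]
    exact firstNbr_le_of_getElem? (hget q hq) hqv
  have hex : ∃ k, par^[k] b = a := by
    by_contra hcon
    push Not at hcon
    have : ∀ k, par^[k] b ∈ σ ∧ σ.idxOf (par^[k] b) + k ≤ σ.idxOf b := by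
      intro k
      induction k with
      | zero => simpa using hb
      | succ k ih =>
        rw [Function.iterate_succ_apply']
        have := hlt _ ih.1 (hcon k)
        exact ⟨hmem _ ih.1 (hcon k), by omega⟩
    have := (this (σ.idxOf b + 1)).2
    omega
  let k := Nat.find hex
  have hk : par^[k] b = a := Nat.find_spec hex
  have hmin : ∀ i < k, par^[i] b ≠ a := fun i hi => Nat.find_min hex hi
  have hin : ∀ i ≤ k, par^[i] b ∈ σ := by
    intro i
    induction i with
    | zero => intro _; simpa using hb
    | succ i ih =>
      intro hi
      rw [Function.iterate_succ_apply']
      exact hmem _ (ih (by omega)) (hmin i (by omega))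
  have hdec : ∀ i j, i < j → j ≤ k → σ.idxOf (par^[j] b) + (j - i) ≤ σ.idxOf (par^[i] b) := by
    intro i j hij
    induction j, hij using Nat.le_induction with
    | base =>
      intro hi
      rw [Function.iterate_succ_apply']
      have := hlt _ (hin i (by omega)) (hmin i (by omega))
      omega
    | succ j hij ih =>
      intro hj
      rw [Function.iterate_succ_apply']
      have := hlt _ (hin j (by omega)) (hmin j (by omega))
      have := ih (by omega)
      omega
  have hab : ∀ u v, H.Adj u v ↔ G.Adj u v ∧ u ∉ rim G c a b ∧ v ∉ rim G c a b := by
    intro u v; rw [hH, avoid_adj]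
  have hrim : ∀ i ≤ k, par^[i] b ∉ rim G c a b := by
    intro i hi
    rcases i with _ | i
    · simp [rim]
    · rw [Function.iterate_succ_apply']
      exact ((hab _ _).1 (hadj _ (hin i (by omega)) (hmin i (by omega)))).2.1
  have hpath : ∀ i j, i < j → j ≤ k → (G.Adj (par^[i] b) (par^[j] b) ↔ j = i + 1) := by
    intro i j hij hj
    have hi := hmin i (by omega)
    constructor
    · intro h1
      by_contra hne
      -- A chord would give `par^[i] b` a neighbour visited before its parent, which is its first
      -- neighbour.
      have h2 : H.Adj (par^[j] b) (par^[i] b) :=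
        (hab _ _).2 ⟨h1.symm, hrim j hj, hrim i (by omega)⟩
      have h3 := hle _ (hin i (by omega)) hi _ (hin j hj) h2
      rw [← Function.iterate_succ_apply' par i b, Nat.succ_eq_add_one] at h3
      have := hdec (i + 1) j (by omega) hj
      omega
    · rintro rfl
      rw [Function.iterate_succ_apply']
      exact ((hab _ _).1 (hadj _ (hin i (by omega)) hi)).1.symm
  -- `a` and `b` are distinct and not adjacent. The cycle has `k + 2` vertices, hence at least four.
  have hk1 : 2 ≤ k := by
    rcases Nat.lt_or_ge k 2 with hlt' | hge
    · exfalso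
      have h01 : k = 0 ∨ k = 1 := by omega
      rcases h01 with h0 | h1
      · rw [h0] at hk; exact hne hk.symm
      · have := (hpath 0 1 (by omega) (by omega)).2 rfl
        rw [← h1, hk] at this
        exact nab this.symm
    · exact hge
  have hcne : ∀ i ≤ k, par^[i] b ≠ c := by
    intro i hi e
    have h1 := hrim i hi
    rw [e] at h1
    exact h1 ⟨Or.inl rfl, hca.ne, hcb.ne⟩
  have hinj : ∀ i j, i < j → j ≤ k → par^[i] b ≠ par^[j] b := by
    intro i j hij hj e
    have := hdec i j hij hj
    rw [e] at this
    omega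
  refine ⟨k, ?_, hk, hmin, isObstruction_of_cycle ?_ ?_ ?_ ?_ ?_⟩
  · have := hdec 0 k (by omega) le_rfl
    have := List.idxOf_lt_length_iff.2 hb
    simp only [Function.iterate_zero, id] at *
    omega
  · simp; omega
  · rw [List.nodup_iff_pairwise_ne, List.pairwise_iff_getElem]
    intro i j hi hj hij
    simp only [List.length_map, List.length_range] at hi hj
    simp only [List.getElem_map, List.getElem_range]
    exact hinj i j hij (by omega)
  · simp only [List.mem_map, List.mem_range, not_exists, not_and]
    intro i hi
    exact hcne i (by omega)
  · intro i j hij hj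
    simp only [List.length_map, List.length_range] at hj
    simp only [List.getElem_map, List.getElem_range]
    exact hpath i j hij (by omega)
  · intro i hi
    simp only [List.length_map, List.length_range] at hi
    simp only [List.getElem_map, List.getElem_range, List.length_map, List.length_range]
    constructor
    · intro h1
      have h2 := hrim i (by omega)
      simp only [rim, Set.mem_ofPred_eq, h1, or_true, true_and, not_and, not_not] at h2
      by_contra hcon
      push Not at hcon
      have h3 : par^[i] b ≠ a := hmin i (by omega)
      exact hinj 0 i (by omega) (by omega) (h2 h3).symm
    · rintro (rfl | hi')
      · exact hcb
      · have : i = k := by omega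
        rw [this, hk]; exact hca

end Certificates

/-! ### Program logic: frames, running times and loop rules. -/

section Framework

@[simp] theorem Memory.setVar_var (s : Memory) (i k j : ℕ) :
    (s.setVar i k).var j = if j = i then k else s.var j := by
  simp [Memory.setVar, Function.update_apply]

@[simp] theorem Memory.setVar_arr (s : Memory) (i k : ℕ) : (s.setVar i k).arr = s.arr := rfl

@[simp] theorem Memory.setArr_var (s : Memory) (a j k : ℕ) : (s.setArr a j k).var = s.var := rfl

theorem Memory.setArr_arr_of_ne (s : Memory) {a a' : ℕ} (j k : ℕ) (h : a' ≠ a) :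
    (s.setArr a j k).arr a' = s.arr a' := by
  simp [Memory.setArr, h]

@[simp] theorem Memory.setArr_arr (s : Memory) (a j k a' j' : ℕ) :
    (s.setArr a j k).arr a' j' = if a' = a ∧ j' = j then k else s.arr a' j' := by
  by_cases h : a' = a
  · subst h; simp [Memory.setArr, Function.update_apply]
  · simp [Memory.setArr, h]

/-- The length of a program, up to a constant factor. -/
def Program.size : Program → ℕ
  | .skip => 1
  | .assign _ e => e.cost + 1
  | .put _ e₁ e₂ => e₁.cost + e₂.cost + 1
  | .seq p q => p.size + q.size
  | .ifLt e₁ e₂ p q => e₁.cost + e₂.cost + 1 + p.size + q.size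
  | .whileLt e₁ e₂ p => e₁.cost + e₂.cost + 1 + p.size

/-- The program has no loops. -/
def Program.LoopFree : Program → Prop
  | .seq p q => p.LoopFree ∧ q.LoopFree
  | .ifLt _ _ p q => p.LoopFree ∧ q.LoopFree
  | .whileLt _ _ _ => False
  | _ => True

/-- The result of a loop-free program. -/
def Program.run : Program → Memory → Memory
  | .skip, s => s
  | .assign i e, s => s.setVar i (e.eval s)
  | .put a e₁ e₂, s => s.setArr a (e₁.eval s) (e₂.eval s)
  | .seq p q, s => q.run (p.run s)
  | .ifLt e₁ e₂ p q, s => if e₁.eval s < e₂.eval s then p.run s else q.run s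
  | .whileLt _ _ _, s => s

/-- The program may write into register `i`. -/
def Program.WritesVar : Program → ℕ → Prop
  | .assign j _, i => i = j
  | .seq p q, i => p.WritesVar i ∨ q.WritesVar i
  | .ifLt _ _ p q, i => p.WritesVar i ∨ q.WritesVar i
  | .whileLt _ _ p, i => p.WritesVar i
  | _, _ => False

/-- The program may write into array `a`. -/
def Program.WritesArr : Program → ℕ → Prop
  | .put b _ _, a => a = b
  | .seq p q, a => p.WritesArr a ∨ q.WritesArr a
  | .ifLt _ _ p q, a => p.WritesArr a ∨ q.WritesArr a
  | .whileLt _ _ p, a => p.WritesArr a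
  | _, _ => False

/-- `s` and `s'` agree on everything that `p` does not write. -/
structure Frame (p : Program) (s s' : Memory) : Prop where
  var : ∀ i, ¬ p.WritesVar i → s'.var i = s.var i
  arr : ∀ a, ¬ p.WritesArr a → s'.arr a = s.arr a

theorem Frame.refl (p : Program) (s : Memory) : Frame p s s := ⟨fun _ _ => rfl, fun _ _ => rfl⟩

theorem Frame.trans {p : Program} {s s' s'' : Memory} (h : Frame p s s') (h' : Frame p s' s'') :
    Frame p s s'' :=
  ⟨fun i hi => (h'.var i hi).trans (h.var i hi), fun a ha => (h'.arr a ha).trans (h.arr a ha)⟩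

theorem Frame.of_writes {p q : Program} {s s' : Memory} (h : Frame p s s')
    (hv : ∀ i, p.WritesVar i → q.WritesVar i) (ha : ∀ a, p.WritesArr a → q.WritesArr a) :
    Frame q s s' :=
  ⟨fun i hi => h.var i (fun h => hi (hv i h)), fun a hi => h.arr a (fun h => hi (ha a h))⟩

theorem Exec.frame {p : Program} {s s' : Memory} {t : ℕ} (h : Exec p s t s') : Frame p s s' := by
  induction h with
  | skip s => exact Frame.refl _ _
  | assign i e s => exact ⟨fun j hj => by simp [Program.WritesVar] at hj; simp [hj], fun _ _ => rfl⟩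
  | put a e₁ e₂ s =>
    exact ⟨fun _ _ => rfl, fun b hb => Memory.setArr_arr_of_ne _ _ _
      (by simpa [Program.WritesArr] using hb)⟩
  | seq _ _ ih1 ih2 =>
    exact (ih1.of_writes (fun _ => Or.inl) (fun _ => Or.inl)).trans
      (ih2.of_writes (fun _ => Or.inr) (fun _ => Or.inr))
  | ifTrue _ _ ih => exact ih.of_writes (fun _ => Or.inl) (fun _ => Or.inl)
  | ifFalse _ _ ih => exact ih.of_writes (fun _ => Or.inr) (fun _ => Or.inr)
  | whileTrue _ _ _ ih1 ih2 => exact Frame.trans (ih1.of_writes (fun _ => id) (fun _ => id)) ih2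
  | whileFalse _ => exact Frame.refl _ _

/-- Started on `s`, the program `p` halts within `X * p.size` steps in a memory satisfying `Q`. -/
def Runs (X : ℕ) (p : Program) (s : Memory) (Q : Memory → Prop) : Prop :=
  ∃ t s', Exec p s t s' ∧ t ≤ X * p.size ∧ Q s'

namespace Runs

variable {X Y : ℕ} {p q : Program} {s : Memory} {Q R : Memory → Prop}

theorem mono (h : Runs X p s Q) (hXY : X ≤ Y) (hQ : ∀ s', Q s' → R s') : Runs Y p s R := by
  obtain ⟨t, s', h1, h2, h3⟩ := h
  exact ⟨t, s', h1, h2.trans (Nat.mul_le_mul_right _ hXY), hQ _ h3⟩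

theorem frame (h : Runs X p s Q) : Runs X p s (fun s' => Q s' ∧ Frame p s s') := by
  obtain ⟨t, s', h1, h2, h3⟩ := h
  exact ⟨t, s', h1, h2, h3, h1.frame⟩

/-- Time is counted in multiples of the program size, and sizes add under composition. So the factor
`X` is inherited unchanged, and no constants accumulate. -/
theorem seq (h : Runs X p s Q) (h' : ∀ s', Q s' → Frame p s s' → Runs X q s' R) :
    Runs X (.seq p q) s R := by
  obtain ⟨t, s', h1, h2, h3⟩ := h
  obtain ⟨t', s'', h1', h2', h3'⟩ := h' s' h3 h1.frame
  refine ⟨t + t', s'', h1.seq h1', ?_, h3'⟩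
  rw [Program.size, mul_add]
  omega

/-- Without loops, each instruction is executed at most once. -/
theorem _root_.IUG.Program.LoopFree.exec {p : Program} (h : p.LoopFree) (s : Memory) :
    ∃ t ≤ p.size, Exec p s t (p.run s) := by
  induction p generalizing s with
  | skip => exact ⟨1, le_rfl, .skip s⟩
  | assign i e => exact ⟨_, le_rfl, .assign i e s⟩
  | put a e₁ e₂ => exact ⟨_, le_rfl, .put a e₁ e₂ s⟩
  | seq p q ihp ihq =>
    obtain ⟨t, ht, h1⟩ := ihp h.1 s
    obtain ⟨t', ht', h2⟩ := ihq h.2 (p.run s)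
    exact ⟨t + t', by rw [Program.size]; omega, h1.seq h2⟩
  | ifLt e₁ e₂ p q ihp ihq =>
    by_cases hlt : e₁.eval s < e₂.eval s
    · obtain ⟨t, ht, h1⟩ := ihp h.1 s
      exact ⟨e₁.cost + e₂.cost + 1 + t, by rw [Program.size]; omega,
        by simpa [Program.run, hlt] using Exec.ifTrue hlt h1⟩
    · obtain ⟨t, ht, h1⟩ := ihq h.2 s
      exact ⟨e₁.cost + e₂.cost + 1 + t, by rw [Program.size]; omega,
        by simpa [Program.run, hlt] using Exec.ifFalse hlt h1⟩
  | whileLt => exact absurd h (by simp [Program.LoopFree])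

theorem of_loopFree (hX : 1 ≤ X) (hp : p.LoopFree) (hQ : Q (p.run s)) : Runs X p s Q := by
  obtain ⟨t, ht, h⟩ := hp.exec s
  exact ⟨t, _, h, ht.trans (Nat.le_mul_of_pos_left _ hX), hQ⟩

theorem ite {e₁ e₂ : Expr} (hX : 1 ≤ X) (hp : e₁.eval s < e₂.eval s → Runs X p s Q)
    (hq : ¬ e₁.eval s < e₂.eval s → Runs X q s Q) : Runs X (.ifLt e₁ e₂ p q) s Q := by
  have key : e₁.cost + e₂.cost + 1 ≤ X * (e₁.cost + e₂.cost + 1) := Nat.le_mul_of_pos_left _ hX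
  by_cases hlt : e₁.eval s < e₂.eval s
  · obtain ⟨t, s', h1, h2, h3⟩ := hp hlt
    refine ⟨_, s', Exec.ifTrue hlt h1, ?_, h3⟩
    rw [Program.size, mul_add, mul_add]
    omega
  · obtain ⟨t, s', h1, h2, h3⟩ := hq hlt
    refine ⟨_, s', Exec.ifFalse hlt h1, ?_, h3⟩
    rw [Program.size, mul_add, mul_add]
    omega

/-- The rule for loops: `φ` bounds the time that remains. -/
theorem whileLt {e₁ e₂ : Expr} {φ : ℕ} {I : ℕ → Memory → Prop}
    (hstep : ∀ φ s', I φ s' → Frame (.whileLt e₁ e₂ p) s s' → e₁.eval s' < e₂.eval s' →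
      ∃ f, 1 ≤ f ∧ Runs f p s' (fun s'' => ∃ φ', φ' + f ≤ φ ∧ I φ' s''))
    (hend : ∀ φ s', I φ s' → Frame (.whileLt e₁ e₂ p) s s' → ¬ e₁.eval s' < e₂.eval s' → Q s')
    (h0 : I φ s) : Runs (φ + 1) (.whileLt e₁ e₂ p) s Q := by
  have main : ∀ φ s', I φ s' → Frame (.whileLt e₁ e₂ p) s s' →
      Runs (φ + 1) (.whileLt e₁ e₂ p) s' Q := by
    intro φ
    induction φ using Nat.strong_induction_on with
    | _ φ ih =>
      intro s' hs hfr
      by_cases hlt : e₁.eval s' < e₂.eval s'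
      · obtain ⟨f, hf, t, s'', h1, h2, φ', h3, h4⟩ := hstep φ s' hs hfr hlt
        have hfr' : Frame (.whileLt e₁ e₂ p) s s'' :=
          hfr.trans (h1.frame.of_writes (fun _ => id) (fun _ => id))
        obtain ⟨t', s₃, h5, h6, h7⟩ := ih φ' (by omega) s'' h4 hfr'
        refine ⟨_, s₃, Exec.whileTrue hlt h1 h5, ?_, h7⟩
        -- The test of this round is paid from its budget `f`, which is at least 1. The extra 1 in
        -- `φ + 1` pays for the last, failing test.
        have key : e₁.cost + e₂.cost + 1 ≤ f * (e₁.cost + e₂.cost + 1) :=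
          Nat.le_mul_of_pos_left _ hf
        have key2 : (φ' + 1 + f) * Program.size (.whileLt e₁ e₂ p) ≤
            (φ + 1) * Program.size (.whileLt e₁ e₂ p) := Nat.mul_le_mul_right _ (by omega)
        rw [add_mul (φ' + 1) f] at key2
        have key3 : f * Program.size (.whileLt e₁ e₂ p) =
            f * (e₁.cost + e₂.cost + 1) + f * p.size := by rw [Program.size, mul_add]
        omega
      · refine ⟨_, s', Exec.whileFalse hlt, ?_, hend φ s' hs hfr hlt⟩
        refine le_trans ?_ (Nat.le_mul_of_pos_left _ (Nat.succ_pos _))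
        rw [Program.size]
        omega
  exact main φ s h0 (Frame.refl _ _)

end Runs

/-- The loop that counts register `i` up to the value of `e`. -/
def Program.forTo (i : ℕ) (e : Expr) (p : Program) : Program :=
  .whileLt (.var i) e (.seq p (.assign i (.add (.var i) (.lit 1))))

theorem Runs.forTo {i : ℕ} {e : Expr} {p : Program} {s : Memory} {o N : ℕ} {f : ℕ → ℕ}
    {I : ℕ → Memory → Prop} (hf : ∀ k < N, 1 ≤ f k)
    (hI : ∀ k s', k ≤ N → I k s' → Frame (.forTo i e p) s s' → s'.var i = o + k ∧ e.eval s' = o + N)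
    (hstep : ∀ k s', k < N → I k s' → Frame (.forTo i e p) s s' → s'.var i = o + k →
      Runs (f k) p s' (fun s'' => s''.var i = o + k ∧ I (k + 1) (s''.setVar i (o + k + 1))))
    (h0 : I 0 s) :
    Runs ((∑ k ∈ Finset.range N, f k) + 1) (.forTo i e p) s (I N) := by
  have hsum : ∀ k < N, (∑ j ∈ Finset.Ico (k + 1) N, f j) + f k = ∑ j ∈ Finset.Ico k N, f j := by
    intro k hk
    rw [Finset.sum_eq_sum_Ico_succ_bot hk]
    omega
  rw [Finset.range_eq_Ico]
  -- The remaining time is the total budget of the rounds from `k` on.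
  refine Runs.whileLt (I := fun φ s' => ∃ k ≤ N, φ = ∑ j ∈ Finset.Ico k N, f j ∧ I k s') ?_ ?_
    ⟨0, Nat.zero_le _, rfl, h0⟩
  · rintro φ s' ⟨k, hk, rfl, hs⟩ hfr hlt
    obtain ⟨h1, h2⟩ := hI k s' hk hs hfr
    have hkN : k < N := by
      simp only [Expr.eval, h1, h2] at hlt
      omega
    refine ⟨f k, hf k hkN, (hstep k s' hkN hs hfr h1).seq fun s'' h3 _ =>
      Runs.of_loopFree (hf k hkN) trivial ⟨_, (hsum k hkN).le, k + 1, hkN, rfl, ?_⟩⟩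
    simpa [Program.run, Expr.eval, h3.1] using h3.2
  · rintro φ s' ⟨k, hk, rfl, hs⟩ hfr hlt
    obtain ⟨h1, h2⟩ := hI k s' hk hs hfr
    simp only [Expr.eval, h1, h2] at hlt
    obtain rfl : k = N := by omega
    exact hs

/-- Counting loops whose body is loop-free. -/
theorem Runs.forTo_loopFree {i : ℕ} {e : Expr} {p : Program} {s : Memory} {o N : ℕ}
    {I : ℕ → Memory → Prop} (hp : p.LoopFree)
    (hI : ∀ k s', k ≤ N → I k s' → Frame (.forTo i e p) s s' → s'.var i = o + k ∧ e.eval s' = o + N)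
    (hstep : ∀ k s', k < N → I k s' → Frame (.forTo i e p) s s' → s'.var i = o + k →
      (p.run s').var i = o + k ∧ I (k + 1) ((p.run s').setVar i (o + k + 1)))
    (h0 : I 0 s) : Runs (N + 1) (.forTo i e p) s (I N) := by
  have := Runs.forTo (f := fun _ => 1) (fun _ _ => le_rfl) hI
    (fun k s' hk hs hfr hv => Runs.of_loopFree le_rfl hp (hstep k s' hk hs hfr hv)) h0
  simpa using this

end Framework

open Program (forTo)

infixr:65 " ;; " => Program.seq

attribute [simp] Expr.eval Program.run Program.LoopFree Program.WritesVar Program.WritesArr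

@[simp] theorem Program.writesVar_forTo {i : ℕ} {e : Expr} {p : Program} {j : ℕ} :
    (Program.forTo i e p).WritesVar j ↔ p.WritesVar j ∨ j = i := by
  simp [Program.forTo]

@[simp] theorem Program.writesArr_forTo {i : ℕ} {e : Expr} {p : Program} {a : ℕ} :
    (Program.forTo i e p).WritesArr a ↔ p.WritesArr a := by
  simp [Program.forTo]

/-! ### Ranks for counting sort. -/

section CountingSort

variable {n : ℕ}

/-- The position of `v` when the vertices are sorted by the key `d`, ties broken by index. -/
def sortRank (d : Fin n → ℕ) (v : Fin n) : ℕ :=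
  (Finset.univ.filter fun w => d w < d v).card +
    (Finset.univ.filter fun w => w < v ∧ d w = d v).card

/-- As a number of lexicographic predecessors, the rank is visibly increasing. The definition keeps
two separate counts because the program obtains them separately, from prefix sums and from the
vertices already placed. -/
theorem sortRank_eq (d : Fin n → ℕ) (v : Fin n) :
    sortRank d v = (Finset.univ.filter fun w => d w < d v ∨ (d w = d v ∧ w < v)).card := by
  rw [sortRank, Finset.filter_or, Finset.card_union_of_disjoint]
  · congr 2
    ext w
    simp [and_comm]
  · rw [Finset.disjoint_filter]
    intro w _ h1 h2
    omega

theorem sortRank_lt {d : Fin n → ℕ} {v w : Fin n} (h : d v < d w ∨ (d v = d w ∧ v < w)) :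
    sortRank d v < sortRank d w := by
  rw [sortRank_eq, sortRank_eq]
  apply Finset.card_lt_card
  rw [Finset.ssubset_iff_of_subset]
  · exact ⟨v, by simpa using h, by simp⟩
  · intro u
    simp only [Finset.mem_filter, Finset.mem_univ, true_and]
    omega

theorem sortRank_lt_card (d : Fin n → ℕ) (v : Fin n) : sortRank d v < n := by
  rw [sortRank_eq]
  calc _ < (Finset.univ : Finset (Fin n)).card := by
        apply Finset.card_lt_card
        rw [Finset.filter_ssubset]
        exact ⟨v, Finset.mem_univ _, by simp⟩
    _ = n := by simp

theorem sortRank_injective (d : Fin n → ℕ) : Function.Injective (sortRank d) := by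
  intro v w h
  by_contra hne
  have h1 := mt (sortRank_lt (d := d) (v := v) (w := w)) (by omega)
  have h2 := mt (sortRank_lt (d := d) (v := w) (w := v)) (by omega)
  have : (v : ℕ) ≠ w := fun e => hne (Fin.ext e)
  simp only [Fin.lt_def] at h1 h2
  omega

/-- The vertices can be listed by increasing key. -/
theorem exists_sorted (d : Fin n → ℕ) : ∃ l : List (Fin n), l.Nodup ∧ (∀ v, v ∈ l) ∧
    l.Pairwise (fun v w => d v ≤ d w) ∧ l.length = n ∧ ∀ v, l[sortRank d v]? = some v := by
  let e : Fin n ≃ Fin n := Equiv.ofBijective (fun v => ⟨sortRank d v, sortRank_lt_card d v⟩)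
    (Finite.injective_iff_bijective.1 fun v w h => sortRank_injective d (by simpa using h))
  have he : ∀ i : Fin n, sortRank d (e.symm i) = i := by
    intro i
    have : e (e.symm i) = i := e.apply_symm_apply i
    exact congrArg Fin.val this
  refine ⟨List.ofFn e.symm, ?_, ?_, ?_, by simp, ?_⟩
  · rw [List.nodup_ofFn]
    exact e.symm.injective
  · intro v
    rw [List.mem_ofFn]
    exact ⟨e v, by simp⟩
  · rw [List.pairwise_ofFn]
    intro i j hij
    by_contra hlt
    push Not at hlt
    have := sortRank_lt (Or.inl hlt)
    rw [he, he] at this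
    exact absurd hij (by simp only [Fin.lt_def]; omega)
  · intro v
    rw [List.getElem?_ofFn]
    have : (⟨sortRank d v, sortRank_lt_card d v⟩ : Fin n) = e v := rfl
    simp [sortRank_lt_card d v, this]

end CountingSort

/-- The memory `s` holds the adjacency lists `L`. -/
structure HasGraph {n : ℕ} (L : Fin n → List (Fin n)) (s : Memory) : Prop where
  size : s.var 0 = n
  zero : s.arr 0 0 = 0
  offset : ∀ v : Fin n, s.arr 0 (v + 1) = s.arr 0 v + (L v).length
  stores : ∀ v : Fin n, s.Stores 1 (s.arr 0 v) (L v)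

theorem HasGraph.congr {n : ℕ} {L : Fin n → List (Fin n)} {s s' : Memory} (h : HasGraph L s)
    (h0 : s'.var 0 = s.var 0) (h1 : s'.arr 0 = s.arr 0) (h2 : s'.arr 1 = s.arr 1) :
    HasGraph L s' := by
  refine ⟨h0.trans h.size, by rw [h1, h.zero], by rw [h1]; exact h.offset, fun v i hi => ?_⟩
  rw [h1, h2]
  exact h.stores v i hi

theorem HasGraph.frame {n : ℕ} {L : Fin n → List (Fin n)} {s s' : Memory} {p : Program}
    (h : HasGraph L s) (hf : Frame p s s') (h0 : ¬ p.WritesVar 0) (h1 : ¬ p.WritesArr 0)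
    (h2 : ¬ p.WritesArr 1) : HasGraph L s' :=
  h.congr (hf.var 0 h0) (hf.arr 0 h1) (hf.arr 1 h2)

/-! ### Sorting the vertices by degree in linear time. -/

section SortProgram

variable {n : ℕ} {L : Fin n → List (Fin n)}

/-- The degree of a vertex. -/
def degE (x : Expr) : Expr := .sub (.get 0 (.add x (.lit 1))) (.get 0 x)

theorem HasGraph.eval_degE {s : Memory} (h : HasGraph L s) {x : Expr} {v : Fin n}
    (hx : x.eval s = v) : (degE x).eval s = (L v).length := by
  simp [degE, hx, h.offset]

/-- Degrees are smaller than `n`, so the first `n` cells of array `4` suffice for the counters. -/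
def countProg : Program :=
  .assign 3 (.lit 0) ;; forTo 3 (.var 0) (.put 4 (.var 3) (.lit 0)) ;;
  .assign 3 (.lit 0) ;;
  forTo 3 (.var 0) (.put 4 (degE (.var 3)) (.add (.get 4 (degE (.var 3))) (.lit 1)))

/-- The counter of each degree becomes the first place reserved for that degree. Register `7`
accumulates the counts, and register `6` saves the one being overwritten. -/
def prefixProg : Program :=
  .assign 7 (.lit 0) ;; .assign 3 (.lit 0) ;;
  forTo 3 (.var 0) (.assign 6 (.get 4 (.var 3)) ;; .put 4 (.var 3) (.var 7) ;;
    .assign 7 (.add (.var 7) (.var 6)))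

/-- Array `4` now points to the next free place for each degree. -/
def placeProg : Program :=
  .assign 3 (.lit 0) ;;
  forTo 3 (.var 0) (.put 5 (.get 4 (degE (.var 3))) (.var 3) ;;
    .put 4 (degE (.var 3)) (.add (.get 4 (degE (.var 3))) (.lit 1)))

theorem card_filter_succ {P : Fin n → Prop} [DecidablePred P] {k : ℕ} (hk : k < n) :
    (Finset.univ.filter fun v : Fin n => (v : ℕ) < k + 1 ∧ P v).card =
      (Finset.univ.filter fun v : Fin n => (v : ℕ) < k ∧ P v).card +
        if P ⟨k, hk⟩ then 1 else 0 := by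
  split_ifs with h
  · rw [← Finset.card_insert_of_notMem (a := (⟨k, hk⟩ : Fin n)) (by simp)]
    congr 1
    ext v
    simp only [Finset.mem_filter, Finset.mem_univ, true_and, Finset.mem_insert, Fin.ext_iff]
    constructor
    · rintro ⟨h1, h2⟩
      rcases Nat.lt_succ_iff_lt_or_eq.1 h1 with h3 | h3
      · exact Or.inr ⟨h3, h2⟩
      · exact Or.inl h3
    · rintro (h3 | h3)
      · have : v = ⟨k, hk⟩ := Fin.ext h3
        subst this
        exact ⟨by simp, h⟩
      · exact ⟨by omega, h3.2⟩
  · rw [add_zero]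
    congr 1
    ext v
    simp only [Finset.mem_filter, Finset.mem_univ, true_and]
    constructor
    · rintro ⟨h1, h2⟩
      refine ⟨?_, h2⟩
      rcases Nat.lt_succ_iff_lt_or_eq.1 h1 with h3 | h3
      · exact h3
      · have : v = ⟨k, hk⟩ := Fin.ext h3
        subst this
        exact absurd h2 h
    · rintro ⟨h1, h2⟩
      exact ⟨by omega, h2⟩

theorem runs_countProg {s : Memory} (h : HasGraph L s) (hL : ∀ v, (L v).length < n) :
    Runs (n + 1) countProg s (fun s' => ∀ d < n,
      s'.arr 4 d = (Finset.univ.filter fun v : Fin n => (L v).length = d).card) := by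
  have hn : 1 ≤ n + 1 := by omega
  refine Runs.seq (Q := fun s' => s'.var 3 = 0) (Runs.of_loopFree hn trivial (by simp)) ?_
  intro s1 hs1 hf1
  refine Runs.seq (Q := fun s' => ∀ d < n, s'.arr 4 d = 0) ?_ ?_
  · refine (Runs.forTo_loopFree (o := 0) (N := n)
      (I := fun k s' => s'.var 3 = k ∧ ∀ d < k, s'.arr 4 d = 0) (by simp) ?_ ?_
      (by simpa using hs1)).mono le_rfl (fun s' hs' => hs'.2)
    · rintro k s' - hI hf
      refine ⟨by simpa using hI.1, ?_⟩
      rw [zero_add, ← h.size]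
      exact (hf.var 0 (by simp)).trans (hf1.var 0 (by simp))
    · rintro k s' hk ⟨h1, h2⟩ hf -
      simp [h1]
      intro d hd
      by_cases hdk : d = k <;> simp [hdk]
      exact h2 d (by omega)
  intro s2 hs2 hf2
  refine Runs.seq (Q := fun s' => s'.var 3 = 0) (Runs.of_loopFree hn trivial (by simp)) ?_
  intro s3 hs3 hf3
  have hg3 : HasGraph L s3 := ((h.frame hf1 (by simp) (by simp) (by simp)).frame hf2 (by simp)
    (by simp) (by simp)).frame hf3 (by simp) (by simp) (by simp)
  refine (Runs.forTo_loopFree (o := 0) (N := n)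
      (I := fun k s' => s'.var 3 = k ∧ ∀ d < n, s'.arr 4 d =
        (Finset.univ.filter fun v : Fin n => (v : ℕ) < k ∧ (L v).length = d).card)
      (by simp) ?_ ?_ ?_).mono le_rfl (fun s' hs' d hd => ?_)
  · rintro k s' - hI hf
    refine ⟨by simpa using hI.1, ?_⟩
    rw [zero_add, ← hg3.size]
    exact hf.var 0 (by simp)
  · rintro k s' hk ⟨h1, h2⟩ hf -
    have hg : HasGraph L s' := hg3.frame hf (by simp) (by simp) (by simp)
    have hd := hg.eval_degE (x := .var 3) (v := ⟨k, hk⟩) (by simpa using h1)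
    simp only [Program.run, Expr.eval, hd, h1, Memory.setArr_var, zero_add, Memory.setVar_var,
      if_true, Memory.setVar_arr, Memory.setArr_arr, true_and]
    intro d hdn
    rw [card_filter_succ hk, h2 _ (hL _)]
    by_cases hdk : d = (L ⟨k, hk⟩).length
    · simp [hdk]
    · simp [hdk, Ne.symm hdk, h2 d hdn]
  · refine ⟨hs3, fun d hd => ?_⟩
    rw [show s3.arr 4 = s2.arr 4 from hf3.arr 4 (by simp), hs2 d hd]
    simp
  · simpa using hs'.2 d hd

theorem card_filter_lt_succ (d : Fin n → ℕ) (k : ℕ) :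
    (Finset.univ.filter fun v => d v < k + 1).card =
      (Finset.univ.filter fun v => d v < k).card + (Finset.univ.filter fun v => d v = k).card := by
  rw [← Finset.card_union_of_disjoint]
  · rw [← Finset.filter_or]
    congr 1
    ext v
    simp only [Finset.mem_filter, Finset.mem_univ, true_and]
    omega
  · rw [Finset.disjoint_filter]
    intro v _ h1 h2
    omega

theorem runs_prefixProg {s : Memory} {d : Fin n → ℕ} (hsize : s.var 0 = n)
    (h : ∀ k < n, s.arr 4 k = (Finset.univ.filter fun v : Fin n => d v = k).card) :
    Runs (n + 1) prefixProg s (fun s' => ∀ k < n,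
      s'.arr 4 k = (Finset.univ.filter fun v : Fin n => d v < k).card) := by
  have hn : 1 ≤ n + 1 := by omega
  refine Runs.seq (Q := fun s' => s'.var 7 = 0) (Runs.of_loopFree hn trivial (by simp)) ?_
  intro s1 hs1 hf1
  refine Runs.seq (Q := fun s' => s'.var 3 = 0) (Runs.of_loopFree hn trivial (by simp)) ?_
  intro s2 hs2 hf2
  refine (Runs.forTo_loopFree (o := 0) (N := n)
      (I := fun k s' => s'.var 3 = k ∧
        s'.var 7 = (Finset.univ.filter fun v : Fin n => d v < k).card ∧
        ∀ j < n, s'.arr 4 j = if j < k then (Finset.univ.filter fun v : Fin n => d v < j).card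
          else (Finset.univ.filter fun v : Fin n => d v = j).card)
      (by simp) ?_ ?_ ?_).mono le_rfl (fun s' hs' k hk => ?_)
  · rintro k s' - hI hf
    refine ⟨by simpa using hI.1, ?_⟩
    rw [zero_add, ← hsize]
    exact (hf.var 0 (by simp)).trans ((hf2.var 0 (by simp)).trans (hf1.var 0 (by simp)))
  · rintro k s' hk ⟨h1, h2, h3⟩ hf -
    have h4 := h3 k hk
    simp only [lt_irrefl, if_false] at h4
    rw [card_filter_lt_succ]
    simp [h1, h2, h4]
    intro j hj
    by_cases hjk : j = k
    · simp [hjk]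
    · have : j ≤ k ↔ j < k := by omega
      simp [hjk, h3 j hj, this]
  · refine ⟨hs2, ?_, fun j hj => ?_⟩
    · rw [hf2.var 7 (by simp), hs1]; simp
    · rw [hf2.arr 4 (by simp), hf1.arr 4 (by simp), h j hj]; simp
  · simpa [hk] using hs'.2.2 k hk

theorem runs_placeProg {s : Memory} (h : HasGraph L s) (hL : ∀ v, (L v).length < n)
    (hs : ∀ k < n, s.arr 4 k = (Finset.univ.filter fun v : Fin n => (L v).length < k).card) :
    Runs (n + 1) placeProg s (fun s' => ∀ v : Fin n,
      s'.arr 5 (sortRank (fun v => (L v).length) v) = v) := by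
  have hn : 1 ≤ n + 1 := by omega
  refine Runs.seq (Q := fun s' => s'.var 3 = 0) (Runs.of_loopFree hn trivial (by simp)) ?_
  intro s1 hs1 hf1
  have hg1 : HasGraph L s1 := h.frame hf1 (by simp) (by simp) (by simp)
  refine (Runs.forTo_loopFree (o := 0) (N := n)
      (I := fun k s' => s'.var 3 = k ∧
        (∀ v : Fin n, (v : ℕ) < k → s'.arr 5 (sortRank (fun v => (L v).length) v) = v) ∧
        ∀ j < n, s'.arr 4 j = (Finset.univ.filter fun v : Fin n => (L v).length < j).card +
          (Finset.univ.filter fun v : Fin n => (v : ℕ) < k ∧ (L v).length = j).card)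
      (by simp) ?_ ?_ ?_).mono le_rfl (fun s' hs' v => ?_)
  · rintro k s' - hI hf
    refine ⟨by simpa using hI.1, ?_⟩
    rw [zero_add, ← hg1.size]
    exact hf.var 0 (by simp)
  · rintro k s' hk ⟨h1, h2, h3⟩ hf -
    have hg : HasGraph L s' := hg1.frame hf (by simp) (by simp) (by simp)
    have hd := hg.eval_degE (x := .var 3) (v := ⟨k, hk⟩) (by simpa using h1)
    have hd' := fun j x => (hg.congr (s' := s'.setArr 5 j x) rfl
      (Memory.setArr_arr_of_ne _ _ _ (by simp)) (Memory.setArr_arr_of_ne _ _ _ (by simp))).eval_degE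
      (x := .var 3) (v := ⟨k, hk⟩) (by simpa using h1)
    have hrk : s'.arr 4 (L ⟨k, hk⟩).length = sortRank (fun v => (L v).length) ⟨k, hk⟩ := by
      rw [h3 _ (hL _), sortRank]
      rfl
    simp only [Program.run, Expr.eval, hd, hd', h1, Memory.setArr_var, zero_add, Memory.setVar_var,
      if_true, Memory.setVar_arr, Memory.setArr_arr, true_and, hrk]
    refine ⟨fun v hv => ?_, fun j hj => ?_⟩
    · by_cases hvk : v = ⟨k, hk⟩
      · simp [hvk]
      · have h4 : sortRank (fun v => (L v).length) v ≠ sortRank (fun v => (L v).length) ⟨k, hk⟩ :=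
          fun e => hvk (sortRank_injective _ e)
        have h5 : (v : ℕ) ≠ k := fun e => hvk (Fin.ext e)
        simpa [h4] using h2 v (by omega)
    · rw [card_filter_succ hk]
      by_cases hjk : j = (L ⟨k, hk⟩).length
      · have := h3 _ (hL ⟨k, hk⟩)
        rw [hrk] at this
        simp [hjk, this, add_assoc]
      · simp [hjk, Ne.symm hjk, h3 j hj]
  · refine ⟨hs1, by simp, fun j hj => ?_⟩
    rw [hf1.arr 4 (by simp), hs j hj]
    simp
  · exact hs'.2.1 v v.2

def sortProg : Program := countProg ;; prefixProg ;; placeProg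

theorem runs_sortProg {s : Memory} (h : HasGraph L s) (hL : ∀ v, (L v).length < n) :
    ∃ l : List (Fin n), l.Nodup ∧ (∀ v, v ∈ l) ∧
      l.Pairwise (fun v w => (L v).length ≤ (L w).length) ∧ l.length = n ∧
      Runs (n + 1) sortProg s (fun s' => s'.Stores 5 0 l) := by
  obtain ⟨l, h1, h2, h3, h4, h5⟩ := exists_sorted (fun v => (L v).length)
  refine ⟨l, h1, h2, h3, h4, ?_⟩
  refine Runs.seq (runs_countProg h hL) fun s1 hs1 hf1 => ?_
  have hg1 := h.frame hf1 (by simp [countProg]) (by simp [countProg]) (by simp [countProg])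
  refine Runs.seq (runs_prefixProg hg1.size hs1) fun s2 hs2 hf2 => ?_
  have hg2 := hg1.frame hf2 (by simp [prefixProg]) (by simp [prefixProg]) (by simp [prefixProg])
  refine (runs_placeProg hg2 hL hs2).mono le_rfl fun s' hs' i hi => ?_
  have h6 := h5 l[i]
  obtain ⟨h7, h8⟩ := List.getElem?_eq_some_iff.1 h6
  have h9 : sortRank (fun v => (L v).length) l[i] = i := (h1.getElem_inj_iff).1 h8
  rw [zero_add]
  have := hs' l[i]
  rwa [h9] at this

end SortProgram

/-! ### Stored lists and summed costs. -/

section Stores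

variable {n : ℕ}

theorem Memory.stores_iff {s : Memory} {a j : ℕ} {l : List (Fin n)} :
    s.Stores a j l ↔ ∀ (i : ℕ) (v : Fin n), l[i]? = some v → s.arr a (j + i) = v := by
  constructor
  · intro h i v hi
    obtain ⟨h1, rfl⟩ := List.getElem?_eq_some_iff.1 hi
    exact h i h1
  · intro h i hi
    exact h i _ (List.getElem?_eq_getElem hi)

theorem Memory.Stores.congr {s s' : Memory} {a j : ℕ} {l : List (Fin n)} (h : s.Stores a j l)
    (ha : ∀ i < l.length, s'.arr a (j + i) = s.arr a (j + i)) : s'.Stores a j l :=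
  fun i hi => (ha i hi).trans (h i hi)

theorem Memory.Stores.concat {s : Memory} {a j : ℕ} {l : List (Fin n)} {v : Fin n}
    (h : s.Stores a j l) (hv : s.arr a (j + l.length) = v) : s.Stores a j (l ++ [v]) := by
  intro i hi
  rcases Nat.lt_or_ge i l.length with hlt | hge
  · rw [List.getElem_append_left hlt]
    exact h i hlt
  · simp only [List.length_append, List.length_singleton] at hi
    obtain rfl : i = l.length := by omega
    simpa using hv

theorem take_succ_eq {α : Type*} {l : List α} {k : ℕ} (hk : k < l.length) :
    l.take (k + 1) = l.take k ++ [l[k]] := by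
  rw [List.take_add_one, List.getElem?_eq_getElem hk]
  rfl

theorem getElem_notMem_take {α : Type*} {l : List α} (hl : l.Nodup) {k : ℕ} (hk : k < l.length) :
    l[k] ∉ l.take k := by
  intro hm
  obtain ⟨j, hj, he⟩ := List.mem_take_iff_getElem.1 hm
  have := (hl.getElem_inj_iff).1 he
  omega

theorem sum_range_getElem? {α : Type*} (l : List α) (g : α → ℕ) :
    ∑ k ∈ Finset.range l.length, (l[k]?).elim 1 g = (l.map g).sum := by
  induction l with
  | nil => simp
  | cons a l ih =>
    rw [List.length_cons, Finset.sum_range_succ']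
    simp [ih, add_comm]

/-- The number of vertices plus the number of arcs. -/
def weight (L : Fin n → List (Fin n)) : ℕ := ∑ v, ((L v).length + 1)

/-- This bounds every loop that treats each vertex at most once at a cost of its degree plus one. -/
theorem sum_map_le_weight (L : Fin n → List (Fin n)) {l : List (Fin n)} (hl : l.Nodup) :
    (l.map fun v => (L v).length + 1).sum ≤ weight L := by
  rw [← List.sum_toFinset _ hl, weight]
  exact Finset.sum_le_sum_of_subset (Finset.subset_univ _)

theorem le_weight (L : Fin n → List (Fin n)) : n ≤ weight L := by
  calc n = ∑ _v : Fin n, 1 := by simp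
    _ ≤ weight L := Finset.sum_le_sum fun v _ => by omega

theorem length_succ_le_weight (L : Fin n → List (Fin n)) (v : Fin n) :
    (L v).length + 1 ≤ weight L :=
  Finset.single_le_sum (f := fun v => (L v).length + 1) (fun _ _ => Nat.zero_le _)
    (Finset.mem_univ v)

end Stores

/-! ### Sorting all adjacency lists simultaneously. -/

section SortAdjacency

variable {n : ℕ} {L : Fin n → List (Fin n)}

theorem HasGraph.offset_le {s : Memory} (h : HasGraph L s) {v w : Fin n} (hvw : v < w) :
    s.arr 0 v + (L v).length ≤ s.arr 0 w := by
  obtain ⟨w, hw⟩ := w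
  obtain ⟨v, hv⟩ := v
  simp only [Fin.mk_lt_mk] at hvw
  induction w, hvw using Nat.le_induction with
  | base => exact (h.offset ⟨v, hv⟩).ge
  | succ w hvw ih =>
    have h1 := h.offset ⟨w, by omega⟩
    have h2 := ih (by omega)
    simp only at *
    omega

theorem HasGraph.cell_ne {s : Memory} (h : HasGraph L s) {v w : Fin n} {i j : ℕ}
    (hi : i < (L v).length) (hj : j < (L w).length) (hvw : v ≠ w) :
    s.arr 0 v + i ≠ s.arr 0 w + j := by
  rcases lt_or_gt_of_ne hvw with h1 | h1
  · have := h.offset_le h1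
    omega
  · have := h.offset_le h1
    omega

/-- The lists `B` are being built in array `6`, their lengths are in array `7`. -/
def HasBuckets (B : Fin n → List (Fin n)) (s : Memory) : Prop :=
  ∀ w : Fin n, s.arr 7 w = (B w).length ∧ s.Stores 6 (s.arr 0 w) (B w)

theorem HasBuckets.push {s : Memory} (h : HasGraph L s) {B : Fin n → List (Fin n)}
    (hB : HasBuckets B s) (hlen : ∀ w, (B w).length ≤ (L w).length) {w v : Fin n}
    (hlt : (B w).length < (L w).length) {s' : Memory} (h0 : s'.arr 0 = s.arr 0)
    (h6 : ∀ j, s'.arr 6 j = if j = s.arr 0 w + s.arr 7 w then (v : ℕ) else s.arr 6 j)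
    (h7 : ∀ j, s'.arr 7 j = if j = w then s.arr 7 w + 1 else s.arr 7 j) :
    HasBuckets (Function.update B w (B w ++ [v])) s' := by
  intro u
  obtain ⟨hw1, hw2⟩ := hB w
  obtain ⟨hu1, hu2⟩ := hB u
  by_cases huw : u = w
  · subst huw
    rw [Function.update_self, h0]
    refine ⟨by simp [h7, hw1], Memory.Stores.concat (hu2.congr fun i hi => ?_) ?_⟩
    · rw [h6, if_neg (by omega)]
    · rw [h6, if_pos (by omega)]
  · rw [Function.update_of_ne huw, h0]
    have : (u : ℕ) ≠ w := fun e => huw (Fin.ext e)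
    refine ⟨by simp [h7, this, hu1], hu2.congr fun i hi => ?_⟩
    rw [h6, if_neg]
    rw [hw1]
    exact h.cell_ne (hi.trans_le (hlen u)) hlt huw

/-- With the vertices taken by increasing degree, appending each one to the lists of all its
neighbours produces sorted lists in linear total time. The new lists have the old lengths, so the
offsets in array `0` serve for both. -/
def sortAdjBody : Program :=
  .assign 6 (.get 1 (.var 4)) ;;
  .put 6 (.add (.get 0 (.var 6)) (.get 7 (.var 6))) (.var 5) ;;
  .put 7 (.var 6) (.add (.get 7 (.var 6)) (.lit 1))

def sortAdjInner : Program :=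
  .assign 5 (.get 5 (.var 3)) ;; .assign 4 (.get 0 (.var 5)) ;;
  forTo 4 (.get 0 (.add (.var 5) (.lit 1))) sortAdjBody

def sortAdjProg : Program :=
  .assign 3 (.lit 0) ;; forTo 3 (.var 0) (.put 7 (.var 3) (.lit 0)) ;;
  .assign 3 (.lit 0) ;; forTo 3 (.var 0) sortAdjInner

theorem runs_sortAdjInner {s : Memory} (h : HasGraph L s) {B : Fin n → List (Fin n)}
    (hB : HasBuckets B s) {u : Fin n} (hu : s.arr 5 (s.var 3) = u) (hnd : (L u).Nodup)
    (hlen : ∀ w, (B w).length ≤ (L w).length) (hlt : ∀ w ∈ L u, (B w).length < (L w).length) :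
    Runs ((L u).length + 1) sortAdjInner s
      (HasBuckets (fun w => if w ∈ L u then B w ++ [u] else B w)) := by
  have hX : 1 ≤ (L u).length + 1 := by omega
  refine Runs.seq (Q := fun s' => s'.var 5 = u) (Runs.of_loopFree hX trivial (by simpa using hu)) ?_
  intro s1 hs1 hf1
  refine Runs.seq (Q := fun s' => s'.var 4 = s.arr 0 u) (Runs.of_loopFree hX trivial
    (by
      have := hf1.arr 0 (by simp)
      simp [hs1, this])) ?_
  intro s2 hs2 hf2
  have h52 : s2.var 5 = u := by rw [hf2.var 5 (by simp), hs1]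
  have h02 : s2.arr 0 = s.arr 0 := by rw [hf2.arr 0 (by simp), hf1.arr 0 (by simp)]
  have hg2 : HasGraph L s2 := (h.frame hf1 (by simp) (by simp) (by simp)).frame hf2 (by simp)
    (by simp) (by simp)
  refine (Runs.forTo_loopFree (o := s.arr 0 u) (N := (L u).length)
    (I := fun k s' => s'.var 4 = s.arr 0 u + k ∧
      HasBuckets (fun w => if w ∈ (L u).take k then B w ++ [u] else B w) s')
    (by simp [sortAdjBody]) ?_ ?_ ?_).mono le_rfl (fun s' hs' => by simpa using hs'.2)
  · rintro k s' - hI hf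
    refine ⟨hI.1, ?_⟩
    have h5 : s'.var 5 = u := by rw [hf.var 5 (by simp [sortAdjBody]), h52]
    simp only [Expr.eval, h5]
    rw [hf.arr 0 (by simp [sortAdjBody]), hg2.offset, h02]
  · rintro k s' hk ⟨h1, h2⟩ hf -
    have hg : HasGraph L s' := hg2.frame hf (by simp [sortAdjBody]) (by simp [sortAdjBody])
      (by simp [sortAdjBody])
    have h5 : s'.var 5 = u := by rw [hf.var 5 (by simp [sortAdjBody]), h52]
    have h0 : s'.arr 0 = s.arr 0 := by rw [hf.arr 0 (by simp [sortAdjBody]), h02]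
    have hw : s'.arr 1 (s.arr 0 u + k) = (L u)[k] := by
      rw [← h0]; exact hg.stores u k hk
    have hnot := getElem_notMem_take hnd hk
    refine ⟨by simp [sortAdjBody, h1], by simp [add_assoc], ?_⟩
    have hpush := h2.push hg (w := (L u)[k]) (v := u) (s' := (sortAdjBody.run s').setVar 4
      (s.arr 0 u + k + 1)) (fun w => ?_) ?_ ?_ ?_ ?_
    · convert hpush using 1
      funext w
      by_cases hwk : w = (L u)[k]
      · subst hwk
        rw [Function.update_self, if_neg hnot, if_pos]
        rw [List.mem_take_iff_getElem]
        exact ⟨k, by omega, rfl⟩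
      · rw [Function.update_of_ne hwk]
        have : w ∈ (L u).take (k + 1) ↔ w ∈ (L u).take k := by
          rw [take_succ_eq hk, List.mem_append, List.mem_singleton]
          simp only [hwk, or_false]
        simp only [this]
    · split_ifs with hm
      · have := hlt w (List.mem_of_mem_take hm)
        simp; omega
      · exact hlen w
    · simp only [if_neg hnot]
      exact hlt _ (List.getElem_mem hk)
    · funext j; simp [sortAdjBody]
    · intro j
      simp [sortAdjBody, h1, h5, hw]
    · intro j
      simp [sortAdjBody, h1, hw]
  · refine ⟨by simp [hs2], fun w => ?_⟩
    obtain ⟨h1, h2⟩ := hB w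
    have h7 : s2.arr 7 = s.arr 7 := by rw [hf2.arr 7 (by simp), hf1.arr 7 (by simp)]
    have h6 : s2.arr 6 = s.arr 6 := by rw [hf2.arr 6 (by simp), hf1.arr 6 (by simp)]
    refine ⟨by simpa [h7] using h1, ?_⟩
    rw [h02]
    simpa using h2.congr fun i _ => by rw [h6]

theorem runs_sortAdjProg {s : Memory} (h : HasGraph L s) (hnd : ∀ v, (L v).Nodup)
    (hsymm : ∀ v w, w ∈ L v ↔ v ∈ L w) {l : List (Fin n)} (hl : l.Nodup) (hln : l.length = n)
    (hs : s.Stores 5 0 l) :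
    Runs (weight L + 1) sortAdjProg s
      (fun s' => ∀ w : Fin n, s'.Stores 6 (s.arr 0 w) (l.filter (fun v => decide (w ∈ L v)))) := by
  have hn : 1 ≤ weight L + 1 := by omega
  refine Runs.seq (Q := fun s' => s'.var 3 = 0) (Runs.of_loopFree hn trivial (by simp)) ?_
  intro s1 hs1 hf1
  refine Runs.seq (Q := fun s' => ∀ d < n, s'.arr 7 d = 0) ?_ ?_
  · refine (Runs.forTo_loopFree (o := 0) (N := n)
      (I := fun k s' => s'.var 3 = k ∧ ∀ d < k, s'.arr 7 d = 0) (by simp) ?_ ?_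
      (by simpa using hs1)).mono (by have := le_weight L; omega) (fun s' hs' => hs'.2)
    · rintro k s' - hI hf
      refine ⟨by simpa using hI.1, ?_⟩
      rw [zero_add, ← h.size]
      exact (hf.var 0 (by simp)).trans (hf1.var 0 (by simp))
    · rintro k s' hk ⟨h1, h2⟩ hf -
      simp [h1]
      intro d hd
      by_cases hdk : d = k <;> simp [hdk]
      exact h2 d (by omega)
  intro s2 hs2 hf2
  refine Runs.seq (Q := fun s' => s'.var 3 = 0) (Runs.of_loopFree hn trivial (by simp)) ?_
  intro s3 hs3 hf3
  have hg3 : HasGraph L s3 := ((h.frame hf1 (by simp) (by simp) (by simp)).frame hf2 (by simp)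
    (by simp) (by simp)).frame hf3 (by simp) (by simp) (by simp)
  have h03 : s3.arr 0 = s.arr 0 := by
    rw [hf3.arr 0 (by simp), hf2.arr 0 (by simp), hf1.arr 0 (by simp)]
  have h53 : s3.arr 5 = s.arr 5 := by
    rw [hf3.arr 5 (by simp), hf2.arr 5 (by simp), hf1.arr 5 (by simp)]
  -- The entries collected for `w` are distinct neighbours of `w`, so its block never overflows.
  have hfilter : ∀ i w, ((l.take i).filter (fun v => decide (w ∈ L v))).length ≤ (L w).length := by
    intro i w
    refine List.Subperm.length_le (List.subperm_of_subset ?_ ?_)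
    · exact (hl.sublist (List.take_sublist _ _)).filter _
    · intro v hv
      have := (List.mem_filter.1 hv).2
      exact (hsymm v w).1 (by simpa using this)
  have hsum := sum_range_getElem? l (fun v => (L v).length + 1)
  rw [hln] at hsum
  refine (Runs.forTo (o := 0) (N := n) (f := fun k => (l[k]?).elim 1 (fun v => (L v).length + 1))
      (I := fun k s' => s'.var 3 = k ∧
        HasBuckets (fun w => (l.take k).filter (fun v => decide (w ∈ L v))) s')
      ?_ ?_ ?_ ?_).frame.mono ?_ (fun s' hs' w => ?_)
  · intro k hk
    rw [List.getElem?_eq_getElem (by omega)]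
    simp
  · rintro k s' - hI hf
    refine ⟨by simpa using hI.1, ?_⟩
    rw [zero_add, ← hg3.size]
    exact hf.var 0 (by simp [sortAdjInner, sortAdjBody])
  · rintro k s' hk ⟨h1, h2⟩ hf -
    have hg : HasGraph L s' := hg3.frame hf (by simp [sortAdjInner, sortAdjBody])
      (by simp [sortAdjInner, sortAdjBody]) (by simp [sortAdjInner, sortAdjBody])
    have hkl : k < l.length := by omega
    have hu : s'.arr 5 (s'.var 3) = l[k] := by
      rw [hf.arr 5 (by simp [sortAdjInner, sortAdjBody]), h53, h1]
      simpa using hs k hkl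
    have htake := take_succ_eq hkl
    rw [List.getElem?_eq_getElem hkl]
    refine ((runs_sortAdjInner hg h2 hu (hnd _) (hfilter k) fun w hw => ?_).frame).mono le_rfl
      fun s'' hs'' => ⟨?_, by simp, ?_⟩
    · have := hfilter (k + 1) w
      have hw' : decide (w ∈ L l[k]) = true := by simpa using hw
      rw [htake, List.filter_append, List.length_append, List.filter_singleton, hw'] at this
      exact this
    · rw [hs''.2.var 3 (by simp [sortAdjInner, sortAdjBody]), h1, zero_add]
    · intro w
      have := hs''.1 w
      simp only [htake, List.filter_append, List.filter_singleton]
      by_cases hw : w ∈ L l[k]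
      · simp only [hw, if_true, decide_true, cond_true] at this ⊢
        exact this
      · simp only [hw, if_false, decide_false, cond_false, List.append_nil] at this ⊢
        exact this
  · refine ⟨hs3, fun w => ⟨?_, ?_⟩⟩
    · rw [hf3.arr 7 (by simp), hs2 w w.2]; simp
    · intro i hi; simp at hi
  · rw [hsum]
    have := sum_map_le_weight L hl
    omega
  · have := (hs'.1.2 w).2
    rw [hs'.2.arr 0 (by simp [sortAdjInner, sortAdjBody]), h03] at this
    simpa [← hln] using this

end SortAdjacency

/-! ### The breadth-first search program. -/

section BFSProgram

theorem Program.run_frame {p : Program} (h : p.LoopFree) (s : Memory) : Frame p s (p.run s) := by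
  obtain ⟨t, -, h⟩ := h.exec s
  exact h.frame

variable {n : ℕ}

/-- The arrays `q`, `par`, `mark` are distinct and do not hold the graph. -/
structure AreScratch (q par mark : ℕ) : Prop where
  qp : q ≠ par
  qm : q ≠ mark
  pm : par ≠ mark
  q0 : q ≠ 0
  q1 : q ≠ 1
  q6 : q ≠ 6
  p0 : par ≠ 0
  p1 : par ≠ 1
  p6 : par ≠ 6
  m0 : mark ≠ 0
  m1 : mark ≠ 1
  m6 : mark ≠ 6

/-- A nonzero mark means queued or forbidden. Marking a set `F` beforehand thus confines the search
to `avoid G F`. -/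
def bfsBody (q par mark : ℕ) (cell : Expr) : Program :=
  .assign 6 cell ;;
  .ifLt (.get mark (.var 6)) (.lit 1)
    (.put mark (.var 6) (.lit 1) ;; .put par (.var 6) (.var 5) ;; .put q (.var 9) (.var 6) ;;
      .assign 9 (.add (.var 9) (.lit 1)))
    .skip

def bfsVisit (q par mark : ℕ) (cell : Expr) : Program :=
  .assign 5 (.get q (.var 8)) ;; .assign 8 (.add (.var 8) (.lit 1)) ;;
  .assign 4 (.get 0 (.var 5)) ;;
  forTo 4 (.get 0 (.add (.var 5) (.lit 1))) (bfsBody q par mark cell)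

/-- Registers `8` and `9` are the head and tail of the queue. Nothing is removed from its array,
which at the end holds the visiting order. -/
def bfsStart (q par mark : ℕ) : Program :=
  .put q (.lit 0) (.var 10) ;; .put mark (.var 10) (.lit 1) ;; .put par (.var 10) (.var 10) ;;
  .assign 8 (.lit 0) ;; .assign 9 (.lit 1)

/-- Breadth-first search from the vertex in register `10`, with the queue in the array `q`, the
parents in `par`, and the marks in `mark`; `cell` reads the adjacency lists. -/
def bfsProg (q par mark : ℕ) (cell : Expr) : Program :=
  bfsStart q par mark ;; .whileLt (.var 8) (.var 9) (bfsVisit q par mark cell)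

/-- The queue holds `A`, and exactly the vertices of `A` and `F` are marked. -/
structure IsQueue (q mark : ℕ) (F : Set (Fin n)) (A : List (Fin n)) (s : Memory) : Prop where
  stores : s.Stores q 0 A
  tail : s.var 9 = A.length
  mark : ∀ v : Fin n, s.arr mark v = 0 ↔ v ∉ F ∧ v ∉ A

/-- The expression `cell` reads the lists `M`, where register `5` holds the vertex and register `4`
the running index. -/
def ReadsLists (cell : Expr) (M : Fin n → List (Fin n)) (s : Memory) : Prop :=
  ∀ s' : Memory, s'.arr 0 = s.arr 0 → s'.arr 1 = s.arr 1 → s'.arr 6 = s.arr 6 →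
    ∀ (u : Fin n) (k : ℕ) (hk : k < (M u).length), s'.var 5 = u → s'.var 4 = s.arr 0 u + k →
      cell.eval s' = ((M u)[k] : ℕ)

theorem ReadsLists.congr {cell : Expr} {M : Fin n → List (Fin n)} {s s' : Memory}
    (h : ReadsLists cell M s) (h0 : s'.arr 0 = s.arr 0) (h1 : s'.arr 1 = s.arr 1)
    (h6 : s'.arr 6 = s.arr 6) : ReadsLists cell M s' := by
  intro s'' h0' h1' h6' u k hk h5 h4
  exact h s'' (h0'.trans h0) (h1'.trans h1) (h6'.trans h6) u k hk h5 (by rw [h4, h0])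

variable {q par mark : ℕ} {cell : Expr}

theorem bfsBody_run_fresh (hd : AreScratch q par mark) {F : Set (Fin n)} {A : List (Fin n)}
    {s : Memory} (hA : IsQueue q mark F A s) {w u : Fin n} (hw : cell.eval s = w)
    (hu : s.var 5 = u) (hwF : w ∉ F) (hwA : w ∉ A) :
    IsQueue q mark F (A ++ [w]) ((bfsBody q par mark cell).run s) ∧
      ∀ v : Fin n, ((bfsBody q par mark cell).run s).arr par v = if v = w then (u : ℕ)
        else s.arr par v := by
  have hm : s.arr mark w = 0 := (hA.mark w).2 ⟨hwF, hwA⟩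
  refine ⟨⟨Memory.Stores.concat (hA.stores.congr fun i hi => ?_) ?_, ?_, ?_⟩, ?_⟩
  · have := hA.tail
    simp [bfsBody, hw, hm, hd.qp, hd.qm]
    intro h; omega
  · simp [bfsBody, hw, hm, hA.tail]
  · simp [bfsBody, hw, hm, hA.tail]
  · intro v
    have := hA.mark v
    by_cases hv : v = w
    · simp [bfsBody, hw, hm, hd.qm.symm, hd.pm.symm, hv]
    · have hv' : (v : ℕ) ≠ w := fun e => hv (Fin.ext e)
      simp [bfsBody, hw, hm, hd.qm.symm, hd.pm.symm, hv, hv', this]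
  · intro v
    by_cases hv : v = w
    · simp [bfsBody, hw, hm, hd.qp.symm, hv, hu]
    · have hv' : (v : ℕ) ≠ w := fun e => hv (Fin.ext e)
      simp [bfsBody, hw, hm, hd.qp.symm, hd.pm, hv, hv']

theorem bfsBody_run_marked {F : Set (Fin n)} {A : List (Fin n)}
    {s : Memory} (hA : IsQueue q mark F A s) {w : Fin n} (hw : cell.eval s = w)
    (hwA : ¬ (w ∉ F ∧ w ∉ A)) : (bfsBody q par mark cell).run s = s.setVar 6 w := by
  have hm : s.arr mark w ≠ 0 := fun h => hwA ((hA.mark w).1 h)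
  simp [bfsBody, hw, hm]

theorem runs_bfsVisit (hd : AreScratch q par mark) {L M : Fin n → List (Fin n)} {s : Memory}
    (h : HasGraph L s) (hM : ReadsLists cell M s) (hlen : ∀ v, (M v).length = (L v).length)
    (hnd : ∀ v, (M v).Nodup) {F : Set (Fin n)} {d qu : List (Fin n)} {u : Fin n}
    (hA : IsQueue q mark F (d ++ u :: qu) s) (h8 : s.var 8 = d.length) :
    Runs ((L u).length + 1) (bfsVisit q par mark cell) s (fun s' => ∃ l : List (Fin n), l.Nodup ∧
      l.Sublist (M u) ∧ (∀ w, w ∈ l ↔ w ∈ M u ∧ w ∉ F ∧ w ∉ d ++ u :: qu) ∧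
      IsQueue q mark F (d ++ u :: qu ++ l) s' ∧ s'.var 8 = d.length + 1 ∧
      (∀ v ∈ d ++ u :: qu, s'.arr par v = s.arr par v) ∧ ∀ v ∈ l, s'.arr par v = u) := by
  classical
  have hX : 1 ≤ (L u).length + 1 := by omega
  have hu : s.arr q d.length = u := by
    have := Memory.stores_iff.1 hA.stores d.length u (by simp)
    simpa using this
  refine Runs.seq (Q := fun s' => s'.var 5 = u ∧ s'.var 8 = d.length ∧ s'.var 9 = s.var 9 ∧
    s'.arr = s.arr) (Runs.of_loopFree hX trivial (by simp [h8, hu])) ?_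
  rintro s1 ⟨h15, h18, h19, h1a⟩ hf1
  refine Runs.seq (Q := fun s' => s'.var 5 = u ∧ s'.var 8 = d.length + 1 ∧ s'.var 9 = s.var 9 ∧
    s'.arr = s.arr) (Runs.of_loopFree hX trivial (by simp [h18, h15, h19, h1a])) ?_
  rintro s2 ⟨h25, h28, h29, h2a⟩ hf2
  refine Runs.seq (Q := fun s' => s'.var 4 = s.arr 0 u ∧ s'.var 5 = u ∧ s'.var 8 = d.length + 1 ∧
    s'.var 9 = s.var 9 ∧ s'.arr = s.arr) (Runs.of_loopFree hX trivial
    (by simp [h28, h25, h29, h2a])) ?_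
  rintro s3 ⟨h34, h35, h38, h39, h3a⟩ hf3
  have hg3 : HasGraph L s3 := ((h.frame hf1 (by simp) (by simp) (by simp)).frame hf2 (by simp)
    (by simp) (by simp)).frame hf3 (by simp) (by simp) (by simp)
  set A := d ++ u :: qu with hAdef
  -- Freshness refers to the marks before the visit. Marks made during the visit are harmless
  -- because the list has no repetitions.
  set fresh : Fin n → Bool := fun w => decide (w ∉ F ∧ w ∉ A) with hfresh
  refine (Runs.forTo_loopFree (o := s.arr 0 u) (N := (L u).length)
    (I := fun k s' => s'.var 4 = s.arr 0 u + k ∧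
      IsQueue q mark F (A ++ ((M u).take k).filter fresh) s' ∧ (∀ v ∈ A, s'.arr par v = s.arr par v) ∧ ∀ v ∈ ((M u).take k).filter fresh,
        s'.arr par v = u) (by simp [bfsBody]) ?_ ?_ ?_).frame.mono le_rfl ?_
  · rintro k s' - hI hf
    refine ⟨hI.1, ?_⟩
    have h5 : s'.var 5 = u := by rw [hf.var 5 (by simp [bfsBody]), h35]
    simp only [Expr.eval, h5]
    rw [hf.arr 0 (by simp [bfsBody, hd.q0.symm, hd.p0.symm, hd.m0.symm]), hg3.offset, h3a]
  · rintro k s' hk ⟨h1, h2, h3, h4⟩ hf -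
    have h0 : s'.arr 0 = s.arr 0 := by
      rw [hf.arr 0 (by simp [bfsBody, hd.q0.symm, hd.p0.symm, hd.m0.symm]), h3a]
    have h0' : s'.arr 1 = s.arr 1 := by
      rw [hf.arr 1 (by simp [bfsBody, hd.q1.symm, hd.p1.symm, hd.m1.symm]), h3a]
    have h6 : s'.arr 6 = s.arr 6 := by
      rw [hf.arr 6 (by simp [bfsBody, hd.q6.symm, hd.p6.symm, hd.m6.symm]), h3a]
    have h5 : s'.var 5 = u := by rw [hf.var 5 (by simp [bfsBody]), h35]
    have hkM : k < (M u).length := by rw [hlen]; exact hk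
    have hw := hM s' h0 h0' h6 u k hkM h5 h1
    have hnot := getElem_notMem_take (hnd u) hkM
    set w := (M u)[k]
    rw [take_succ_eq hkM, List.filter_append, List.filter_singleton]
    by_cases hfr : w ∉ F ∧ w ∉ A
    · have hdec : fresh w = true := by simpa [hfresh] using hfr
      have hwA : w ∉ A ++ ((M u).take k).filter fresh := by
        rw [List.mem_append, not_or]
        exact ⟨hfr.2, fun hm => hnot (List.mem_of_mem_filter hm)⟩
      obtain ⟨r1, r2⟩ := bfsBody_run_fresh hd h2 hw h5 hfr.1 hwA
      rw [hdec, cond_true, ← List.append_assoc]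
      refine ⟨?_, by simp [add_assoc], ⟨r1.stores, by simpa using r1.tail, r1.mark⟩, ?_, ?_⟩
      · rw [← h1]
        exact (Program.run_frame (by simp [bfsBody]) s').var 4 (by simp [bfsBody])
      · intro v hv
        have hvw : v ≠ w := fun e => hfr.2 (e ▸ hv)
        have := r2 v
        rw [if_neg hvw] at this
        exact this.trans (h3 v hv)
      · intro v hv
        have := r2 v
        rcases List.mem_append.1 hv with hv | hv
        · by_cases hvw : v = w
          · rw [if_pos hvw] at this; exact this
          · rw [if_neg hvw] at this
            exact this.trans (h4 v hv)
        · rw [if_pos (List.mem_singleton.1 hv)] at this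
          exact this
    · have hdec : fresh w = false := by simpa [hfresh] using hfr
      have hrun := bfsBody_run_marked (par := par) h2 hw (fun hc => hfr ⟨hc.1, fun hm =>
        hc.2 (List.mem_append_left _ hm)⟩)
      rw [hrun, hdec, cond_false, List.append_nil]
      exact ⟨by simpa using h1, by simp [add_assoc], ⟨h2.stores, by simpa using h2.tail, h2.mark⟩,
        h3, h4⟩
  · refine ⟨by simp [h34], ?_, fun v _ => by rw [h3a], by simp⟩
    refine ⟨?_, by simpa [h39] using hA.tail, fun v => by simpa [h3a] using hA.mark v⟩
    simpa using hA.stores.congr fun i _ => by rw [h3a]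
  · rintro s' ⟨⟨h1, h2, h3, h4⟩, hf⟩
    rw [← hlen u, List.take_length] at h2 h4
    refine ⟨(M u).filter fresh, (hnd u).filter _, List.filter_sublist, fun w => ?_, h2, ?_, h3, h4⟩
    · simp [hfresh]
    · rw [hf.var 8 (by simp [bfsBody]), h38]

/-- A sublist of a sorted list is sorted, so each round is a legal search step. The remaining time
is `weight L` minus the cost of the visited vertices, which are distinct. -/
theorem runs_bfsProg (hd : AreScratch q par mark) {L M : Fin n → List (Fin n)} {s : Memory}
    (h : HasGraph L s) (hM : ReadsLists cell M s) (hlen : ∀ v, (M v).length = (L v).length)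
    (hnd : ∀ v, (M v).Nodup) {G : SimpleGraph (Fin n)} (hG : ∀ v w, w ∈ M v ↔ G.Adj v w)
    {le : Fin n → Fin n → Prop} (hle : ∀ v, (M v).Pairwise le) {F : Set (Fin n)} {x : Fin n}
    (hx : s.var 10 = x) (hxF : x ∉ F) (hmark : ∀ v, v ≠ x → (s.arr mark v = 0 ↔ v ∉ F)) :
    Runs (weight L + 1) (bfsProg q par mark cell) s (fun s' => ∃ (σ : List (Fin n))
      (P : Fin n → Fin n), IsBFSOrdering (avoid G F) le x σ ∧ s'.Stores q 0 σ ∧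
      (∀ v : Fin n, s'.arr mark v = 0 ↔ v ∉ F ∧ v ∉ σ) ∧ P x = x ∧
      (∀ v ∈ σ, v ≠ x → σ[firstNbr (avoid G F) σ v]? = some (P v)) ∧
      ∀ v ∈ σ, s'.arr par v = P v) := by
  classical
  refine Runs.seq (Q := fun s' => IsQueue q mark F [x] s' ∧ s'.var 8 = 0 ∧ s'.arr par x = x)
    (Runs.of_loopFree (by omega) (by simp [bfsStart]) ⟨⟨?_, ?_, ?_⟩, ?_, ?_⟩) ?_
  · intro i hi
    simp only [List.length_singleton, Nat.lt_one_iff] at hi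
    subst hi
    simp [bfsStart, hx, hd.qp, hd.qm]
  · simp [bfsStart]
  · intro v
    by_cases hv : v = x
    · simp [bfsStart, hx, hv, hd.pm.symm]
    · have hv' : (v : ℕ) ≠ x := fun e => hv (Fin.ext e)
      simp [bfsStart, hx, hv, hv', hd.pm.symm, hd.qm.symm, hmark v hv]
  · simp [bfsStart]
  · simp [bfsStart, hx]
  rintro s1 ⟨hq1, h18, h1p⟩ hf1
  have hgw : ∀ {p : Program} {s s' : Memory}, Frame p s s' → (∀ i, p.WritesVar i → i ≠ 0) →
      (∀ a, p.WritesArr a → a = q ∨ a = par ∨ a = mark) →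
      s'.var 0 = s.var 0 ∧ s'.arr 0 = s.arr 0 ∧ s'.arr 1 = s.arr 1 ∧ s'.arr 6 = s.arr 6 := by
    intro p s s' hf h1 h2
    refine ⟨hf.var 0 fun h => h1 0 h rfl, hf.arr 0 fun h => ?_, hf.arr 1 fun h => ?_,
      hf.arr 6 fun h => ?_⟩
    · rcases h2 _ h with h | h | h
      exacts [hd.q0 h.symm, hd.p0 h.symm, hd.m0 h.symm]
    · rcases h2 _ h with h | h | h
      exacts [hd.q1 h.symm, hd.p1 h.symm, hd.m1 h.symm]
    · rcases h2 _ h with h | h | h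
      exacts [hd.q6 h.symm, hd.p6 h.symm, hd.m6 h.symm]
  obtain ⟨hf10, hf1a, hf1b, hf1c⟩ := hgw hf1 (by simp [bfsStart]) (by simp [bfsStart])
  have hg1 : HasGraph L s1 := h.congr hf10 hf1a hf1b
  have hM1 : ReadsLists cell M s1 := hM.congr hf1a hf1b hf1c
  let g : Fin n → ℕ := fun v => (L v).length + 1
  refine Runs.whileLt (φ := weight L - (([] : List (Fin n)).map g).sum)
    (I := fun φ s' => ∃ d qu, φ = weight L - (d.map g).sum ∧
      Relation.ReflTransGen (BFSStep (avoid G F) le) ([], [x]) (d, qu) ∧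
      IsQueue q mark F (d ++ qu) s' ∧ s'.var 8 = d.length ∧ (∀ v ∈ d ++ qu, v ∉ F) ∧
      s'.arr par x = x ∧ ∀ v ∈ d ++ qu, v ≠ x → ∃ p : Fin n,
        d[firstNbr (avoid G F) d v]? = some p ∧ s'.arr par v = p) ?_ ?_
    ⟨[], [x], rfl, .refl, by simpa using hq1, by simpa using h18, by simpa using hxF, h1p,
      by simp⟩
  · rintro φ s' ⟨d, qu, rfl, hsteps, hq, h8, hF, hpx, hp⟩ hf hlt
    obtain ⟨hw0, hwa, hwb, hwc⟩ := hgw hf (fun i hi => by simp [bfsVisit, bfsBody] at hi; omega)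
      (fun a ha => by simp [bfsVisit, bfsBody] at ha; tauto)
    have hg : HasGraph L s' := hg1.congr hw0 hwa hwb
    have hM' : ReadsLists cell M s' := hM1.congr hwa hwb hwc
    simp only [Expr.eval, h8, hq.tail, List.length_append] at hlt
    obtain ⟨u, qu, rfl⟩ := List.exists_cons_of_length_pos (l := qu) (by omega)
    have hinv := BFSInv.of_steps hsteps
    refine ⟨g u, Nat.le_add_left 1 _, (runs_bfsVisit hd hg hM' hlen hnd hq h8).mono le_rfl ?_⟩
    rintro s'' ⟨l, hl1, hl2, hl3, hq', h8', hold, hnew⟩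
    have huF : u ∉ F := hF u (by simp)
    have hstep : BFSStep (avoid G F) le (d, u :: qu) (d ++ [u], qu ++ l) := by
      refine BFSStep.visit d u qu l hl1 (fun w => ?_) ((hle u).sublist hl2)
      rw [hl3, hG, List.mem_append, avoid_adj]
      tauto
    have hinv' := hinv.step hstep
    have hsum : ((d ++ [u]).map g).sum ≤ weight L :=
      sum_map_le_weight L (by simpa using (List.nodup_append.1 hinv'.nodup).1)
    have hall : d ++ [u] ++ (qu ++ l) = d ++ u :: qu ++ l := by simp
    refine ⟨_, ?_, d ++ [u], qu ++ l, rfl, hsteps.tail hstep, by rwa [hall], by simpa using h8',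
      ?_, ?_, ?_⟩
    · simp only [List.map_append, List.sum_append, List.map_cons, List.map_nil, List.sum_cons,
        List.sum_nil] at hsum ⊢
      omega
    · intro v hv
      rw [hall] at hv
      rcases List.mem_append.1 hv with hv | hv
      · exact hF v hv
      · exact ((hl3 v).1 hv).2.1
    · rw [hold x (List.mem_of_getElem? hinv.head), hpx]
    · intro v hv hvx
      rw [hall] at hv
      rcases List.mem_append.1 hv with hv | hv
      · obtain ⟨p, hp1, hp2⟩ := hp v hv hvx
        have hlt := hinv.first_lt v hv hvx
        refine ⟨p, ?_, by rw [hold v hv, hp2]⟩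
        rw [firstNbr_append_of_lt hlt, List.getElem?_append_left hlt]
        exact hp1
      · refine ⟨u, ?_, hnew v hv⟩
        have hv' := (hl3 v).1 hv
        rw [firstNbr_concat (fun w hw hadj => hv'.2.2 (hinv.closed w hw v hadj))
          (by rw [avoid_adj]; exact ⟨(hG u v).1 hv'.1, huF, hv'.2.1⟩)]
        simp
  · rintro φ s' ⟨d, qu, -, hsteps, hq, h8, hF, hpx, hp⟩ hf hlt
    simp only [Expr.eval, h8, hq.tail, List.length_append] at hlt
    obtain rfl : qu = [] := List.length_eq_zero_iff.1 (by omega)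
    rw [List.append_nil] at *
    refine ⟨d, fun v => if v = x then x else (d[firstNbr (avoid G F) d v]?).getD x, hsteps,
      hq.stores, hq.mark, by simp, fun v hv hvx => ?_, fun v hv => ?_⟩
    · obtain ⟨p, hp1, -⟩ := hp v hv hvx
      simp [hvx, hp1]
    · by_cases hvx : v = x
      · simp [hvx, hpx]
      · obtain ⟨p, hp1, hp2⟩ := hp v hv hvx
        simp [hvx, hp1, hp2]

end BFSProgram

/-! ### The two searches. -/

section SearchProgram

variable {n : ℕ}

@[simp] theorem avoid_empty {V : Type*} (G : SimpleGraph V) : avoid G ∅ = G := by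
  ext u v
  simp

/-- Set the cells of array `a` to zero. -/
def clearProg (a : ℕ) : Program :=
  .assign 3 (.lit 0) ;; forTo 3 (.var 0) (.put a (.var 3) (.lit 0))

theorem runs_clearProg {s : Memory} (hn : s.var 0 = n) (a : ℕ) :
    Runs (n + 1) (clearProg a) s (fun s' => ∀ v : Fin n, s'.arr a v = 0) := by
  refine Runs.seq (Q := fun s' => s'.var 3 = 0) (Runs.of_loopFree (by omega) trivial (by simp)) ?_
  intro s1 hs1 hf1
  refine (Runs.forTo_loopFree (o := 0) (N := n)
    (I := fun k s' => s'.var 3 = k ∧ ∀ d < k, s'.arr a d = 0) (by simp) ?_ ?_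
    (by simpa using hs1)).mono le_rfl (fun s' hs' v => hs'.2 v v.2)
  · rintro k s' - hI hf
    refine ⟨by simpa using hI.1, ?_⟩
    rw [zero_add, ← hn]
    exact (hf.var 0 (by simp)).trans (hf1.var 0 (by simp))
  · rintro k s' hk ⟨h1, h2⟩ hf -
    simp [h1]
    intro d hd
    by_cases hdk : d = k <;> simp [hdk]
    exact h2 d (by omega)

def forwardCell : Expr := .get 6 (.var 4)

/-- While register `4` runs upwards through a block, start + end - (index + 1) runs downwards. The
lists sorted by increasing degree thus serve the maxBFS too. -/
def backwardCell : Expr :=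
  .get 6 (.sub (.add (.get 0 (.var 5)) (.get 0 (.add (.var 5) (.lit 1)))) (.add (.var 4) (.lit 1)))

def plainCell : Expr := .get 1 (.var 4)

theorem readsLists_forward {M : Fin n → List (Fin n)} {s : Memory}
    (h : ∀ w : Fin n, s.Stores 6 (s.arr 0 w) (M w)) : ReadsLists forwardCell M s := by
  intro s' h0 h1 h6 u k hk h5 h4
  simp [forwardCell, h4, h6, h u k hk]

theorem readsLists_plain {L : Fin n → List (Fin n)} {s : Memory} (h : HasGraph L s) :
    ReadsLists plainCell L s := by
  intro s' h0 h1 h6 u k hk h5 h4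
  simp [plainCell, h4, h1, h.stores u k hk]

theorem readsLists_backward {L M : Fin n → List (Fin n)} {s : Memory} (hg : HasGraph L s)
    (hlen : ∀ v, (M v).length = (L v).length)
    (h : ∀ w : Fin n, s.Stores 6 (s.arr 0 w) (M w)) :
    ReadsLists backwardCell (fun v => (M v).reverse) s := by
  intro s' h0 h1 h6 u k hk h5 h4
  rw [List.length_reverse] at hk
  simp only [backwardCell, Expr.eval, h5, h0, h4, h6, hg.offset, List.getElem_reverse]
  rw [← h u (((M u).length) - 1 - k) (by omega), ← hlen]
  congr 1
  omega

/-- The two searches: the orderings are left in the arrays `8` and `2`, the parents in the arrays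
`9` and `11`, and the root of the second search in register `10`. -/
def searchProg : Program :=
  sortProg ;; sortAdjProg ;;
  .assign 10 (.get 5 (.sub (.var 0) (.lit 1))) ;; clearProg 10 ;; bfsProg 8 9 10 backwardCell ;;
  .assign 10 (.get 8 (.sub (.var 0) (.lit 1))) ;; clearProg 12 ;; bfsProg 2 11 12 forwardCell

/-- The outcome of the two searches. -/
structure SearchResult (G : SimpleGraph (Fin n)) [DecidableRel G.Adj] (s : Memory) (x r : Fin n)
    (τ σ : List (Fin n)) (P par : Fin n → Fin n) : Prop where
  degree_le : ∀ y, G.degree y ≤ G.degree x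
  output : IsTwoPassOutput G x σ
  last : ∀ v, v ≠ r → τ.idxOf v < τ.idxOf r
  layout₁ : BFSLayout G (fun u v => G.degree v ≤ G.degree u) x (fun v => τ.idxOf v) P
  layout₂ : BFSLayout G (fun u v => G.degree u ≤ G.degree v) r (fun v => σ.idxOf v) par
  nodup : σ.Nodup
  mem : ∀ v, v ∈ σ
  stores : s.Stores 2 0 σ
  root : s.var 10 = r
  parents₁ : ∀ v : Fin n, s.arr 9 v = P v
  parents₂ : ∀ v : Fin n, s.arr 11 v = par v

theorem length_of_nodup {l : List (Fin n)} (hl : l.Nodup) (h : ∀ v, v ∈ l) : l.length = n := by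
  have h1 := List.toFinset_card_of_nodup hl
  have h2 : l.toFinset = Finset.univ := by ext v; simp [h v]
  rw [h2] at h1
  simpa using h1.symm

theorem runs_searchProg {L : Fin n → List (Fin n)} {s : Memory} {G : SimpleGraph (Fin n)}
    [DecidableRel G.Adj] (hG : G.Connected) (h : HasGraph L s) (hnd : ∀ v, (L v).Nodup)
    (hL : ∀ v w, w ∈ L v ↔ G.Adj v w) :
    Runs (weight L + 1) searchProg s
      (fun s' => ∃ x r τ σ P par, SearchResult G s' x r τ σ P par) := by
  have hdeg : ∀ v, (L v).length = G.degree v := by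
    intro v
    rw [← List.toFinset_card_of_nodup (hnd v), ← G.card_neighborFinset_eq_degree]
    congr 1
    ext w
    simp [hL]
  have hn : 0 < n := Fin.pos_iff_nonempty.2 hG.nonempty
  have hlt : ∀ v, (L v).length < n := by
    intro v
    rw [hdeg]
    simpa using G.degree_lt_card_verts v
  have hnw := le_weight L
  obtain ⟨l, l1, l2, l3, l4, hrun⟩ := runs_sortProg h hlt
  refine Runs.seq (hrun.mono (by omega) fun _ h => h) fun s1 hs1 hf1 => ?_
  have hg1 := h.frame hf1 (by simp [sortProg, countProg, prefixProg, placeProg])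
    (by simp [sortProg, countProg, prefixProg, placeProg])
    (by simp [sortProg, countProg, prefixProg, placeProg])
  refine Runs.seq (runs_sortAdjProg hg1 hnd (fun v w => by rw [hL, hL, G.adj_comm]) l1 l4 hs1)
    fun s2 hs2 hf2 => ?_
  have hg2 := hg1.frame hf2 (by simp [sortAdjProg, sortAdjInner, sortAdjBody])
    (by simp [sortAdjProg, sortAdjInner, sortAdjBody])
    (by simp [sortAdjProg, sortAdjInner, sortAdjBody])
  have h02 : s2.arr 0 = s1.arr 0 := hf2.arr 0 (by simp [sortAdjProg, sortAdjInner, sortAdjBody])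
  have h52 : s2.arr 5 = s1.arr 5 := hf2.arr 5 (by simp [sortAdjProg, sortAdjInner, sortAdjBody])
  rw [← h02] at hs2
  set M : Fin n → List (Fin n) := fun w => l.filter (fun v => decide (w ∈ L v)) with hMdef
  have hM : ∀ v w, w ∈ M v ↔ G.Adj v w := by
    intro v w
    simp [hMdef, l2, hL, G.adj_comm]
  have hMnd : ∀ v, (M v).Nodup := fun v => l1.filter _
  have hMlen : ∀ v, (M v).length = (L v).length := fun v =>
    ((List.perm_ext_iff_of_nodup (hMnd v) (hnd v)).2 fun w => by rw [hM, hL]).length_eq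
  have hMs : ∀ v, (M v).Pairwise (fun u v => G.degree u ≤ G.degree v) := fun v =>
    (l3.filter _).imp (fun {a b} hab => by rwa [hdeg, hdeg] at hab)
  have hne : l ≠ [] := by rintro rfl; simp at l4; omega
  -- The last vertex in the order by degree has maximum degree; the first search starts there.
  have hgetx : s2.arr 5 (n - 1) = l.getLast hne := by
    rw [h52]
    have := hs1 (n - 1) (by omega)
    rw [zero_add] at this
    rw [this, List.getLast_eq_getElem]
    congr 2
    omega
  set x := l.getLast hne with hx
  have hxmax : ∀ y, G.degree y ≤ G.degree x := by
    intro y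
    rw [← hdeg, ← hdeg]
    rcases eq_or_ne y x with rfl | hyx
    · exact le_rfl
    · have := List.dropLast_append_getLast hne
      rw [← this, List.pairwise_append] at l3
      refine l3.2.2 y ?_ x (by simp [hx])
      have hy := l2 y
      rw [← this, List.mem_append] at hy
      exact hy.resolve_right (by simpa [← hx] using hyx)
  refine Runs.seq (Q := fun s' => s'.var 10 = x ∧ s'.arr = s2.arr) (Runs.of_loopFree (by omega)
    trivial (by simp [hg2.size, hgetx])) ?_
  rintro s3 ⟨h3x, h3a⟩ hf3
  have hg3 := hg2.frame hf3 (by simp) (by simp) (by simp)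
  refine Runs.seq ((runs_clearProg hg3.size 10).mono (by omega) fun _ h => h) fun s4 hs4 hf4 => ?_
  have hg4 := hg3.frame hf4 (by simp [clearProg]) (by simp [clearProg]) (by simp [clearProg])
  have h4a : s4.arr 0 = s2.arr 0 ∧ s4.arr 6 = s2.arr 6 := by
    constructor
    · rw [hf4.arr 0 (by simp [clearProg]), h3a]
    · rw [hf4.arr 6 (by simp [clearProg]), h3a]
  have hs4' : ∀ w : Fin n, s4.Stores 6 (s4.arr 0 w) (M w) := fun w => by
    rw [h4a.1]
    exact (hs2 w).congr fun i _ => by rw [h4a.2]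
  refine Runs.seq (runs_bfsProg (le := fun u v => G.degree v ≤ G.degree u) (F := ∅) (x := x)
    (by constructor <;> simp) hg4 (readsLists_backward hg4 hMlen hs4') (by simpa using hMlen)
    (by simpa using hMnd) (G := G) (by simpa using hM)
    (fun v => by rw [List.pairwise_reverse]; exact hMs v)
    (by rw [hf4.var 10 (by simp [clearProg]), h3x]) (by simp) (by simp [hs4])) ?_
  rintro s5 ⟨τ, P, b1, b2, -, b4, b5, b6⟩ hf5
  rw [avoid_empty] at b1 b5
  have hg5 := hg4.frame hf5 (by simp [bfsProg, bfsStart, bfsVisit, bfsBody])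
    (by simp [bfsProg, bfsStart, bfsVisit, bfsBody])
    (by simp [bfsProg, bfsStart, bfsVisit, bfsBody])
  have hτmem := b1.inv.mem_of_connected hG
  have hτnd : τ.Nodup := by simpa using b1.inv.nodup
  have hτlen := length_of_nodup hτnd hτmem
  have hτne : τ ≠ [] := by rintro rfl; simp at hτlen; omega
  have hgetr : s5.arr 8 (n - 1) = τ.getLast hτne := by
    have := b2 (n - 1) (by omega)
    rw [zero_add] at this
    rw [this, List.getLast_eq_getElem]
    congr 2
    omega
  set r := τ.getLast hτne with hr
  refine Runs.seq (Q := fun s' => s'.var 10 = r ∧ s'.arr = s5.arr) (Runs.of_loopFree (by omega)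
    trivial (by simp [hg5.size, hgetr])) ?_
  rintro s6 ⟨h6x, h6a⟩ hf6
  have hg6 := hg5.frame hf6 (by simp) (by simp) (by simp)
  refine Runs.seq ((runs_clearProg hg6.size 12).mono (by omega) fun _ h => h) fun s7 hs7 hf7 => ?_
  have hg7 := hg6.frame hf7 (by simp [clearProg]) (by simp [clearProg]) (by simp [clearProg])
  have h7a : s7.arr 0 = s4.arr 0 ∧ s7.arr 6 = s4.arr 6 ∧ s7.arr 9 = s5.arr 9 := by
    refine ⟨?_, ?_, ?_⟩
    · rw [hf7.arr 0 (by simp [clearProg]), h6a,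
        hf5.arr 0 (by simp [bfsProg, bfsStart, bfsVisit, bfsBody])]
    · rw [hf7.arr 6 (by simp [clearProg]), h6a,
        hf5.arr 6 (by simp [bfsProg, bfsStart, bfsVisit, bfsBody])]
    · rw [hf7.arr 9 (by simp [clearProg]), h6a]
  have hs7' : ∀ w : Fin n, s7.Stores 6 (s7.arr 0 w) (M w) := fun w => by
    rw [h7a.1]
    exact (hs4' w).congr fun i _ => by rw [h7a.2.1]
  have h710 : s7.var 10 = r := by rw [hf7.var 10 (by simp [clearProg]), h6x]
  refine (runs_bfsProg (le := fun u v => G.degree u ≤ G.degree v) (F := ∅) (x := r)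
    (by constructor <;> simp) hg7 (readsLists_forward hs7') hMlen hMnd (G := G) hM hMs
    h710 (by simp) (by simp [hs7])).frame.mono le_rfl ?_
  rintro s8 ⟨⟨σ, par, c1, c2, -, c4, c5, c6⟩, hf8⟩
  rw [avoid_empty] at c1 c5
  have hσmem := c1.inv.mem_of_connected hG
  have hσnd : σ.Nodup := by simpa using c1.inv.nodup
  have hτr : τ.dropLast ++ [r] = τ := List.dropLast_append_getLast hτne
  refine ⟨x, r, τ, σ, P, par, hxmax, ⟨τ.dropLast, r, ?_, c1⟩, fun v hv => ?_,
    b1.inv.layout hτmem b4 fun v hv => b5 v (hτmem v) hv,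
    c1.inv.layout hσmem c4 fun v hv => c5 v (hσmem v) hv, hσnd, hσmem, c2, ?_, fun v => ?_,
    fun v => c6 v (hσmem v)⟩
  · rw [hτr]; exact b1
  · have h1 : τ.idxOf r = n - 1 := by
      rw [hr, List.getLast_eq_getElem, hτnd.idxOf_getElem, hτlen]
    have h2 := List.idxOf_lt_length_iff.2 (hτmem v)
    have h3 : τ.idxOf v ≠ τ.idxOf r := fun e => hv ((List.idxOf_inj (hτmem v)).1 e)
    omega
  · rw [hf8.var 10 (by simp [bfsProg, bfsStart, bfsVisit, bfsBody]), h710]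
  · rw [hf8.arr 9 (by simp [bfsProg, bfsStart, bfsVisit, bfsBody]), h7a.2.2]
    exact b6 v (hτmem v)

end SearchProgram

/-! ### Finding the first violation in linear time. -/

section Check

variable {n : ℕ}

/-- Store the positions of the vertices in the ordering in array `13`. -/
def posProg : Program :=
  .assign 3 (.lit 0) ;; forTo 3 (.var 0) (.put 13 (.get 2 (.var 3)) (.var 3))

theorem runs_posProg {s : Memory} (hn : s.var 0 = n) {σ : List (Fin n)} (hσ : σ.Nodup)
    (hmem : ∀ v, v ∈ σ) (hs : s.Stores 2 0 σ) :
    Runs (n + 1) posProg s (fun s' => ∀ v : Fin n, s'.arr 13 v = σ.idxOf v) := by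
  have hlen := length_of_nodup hσ hmem
  refine Runs.seq (Q := fun s' => s'.var 3 = 0) (Runs.of_loopFree (by omega) trivial (by simp)) ?_
  intro s1 hs1 hf1
  refine (Runs.forTo_loopFree (o := 0) (N := n)
    (I := fun k s' => s'.var 3 = k ∧ ∀ v : Fin n, σ.idxOf v < k → s'.arr 13 v = σ.idxOf v)
    (by simp) ?_ ?_ (by simpa using hs1)).mono le_rfl
    (fun s' hs' v => hs'.2 v (lt_of_lt_of_eq (List.idxOf_lt_length_iff.2 (hmem v)) hlen))
  · rintro k s' - hI hf
    refine ⟨by simpa using hI.1, ?_⟩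
    rw [zero_add, ← hn]
    exact (hf.var 0 (by simp)).trans (hf1.var 0 (by simp))
  · rintro k s' hk ⟨h1, h2⟩ hf -
    have hσk : s'.arr 2 k = σ[k] := by
      rw [hf.arr 2 (by simp), hf1.arr 2 (by simp)]
      simpa using hs k (by omega)
    simp only [Program.run, Expr.eval, h1, hσk, Memory.setArr_var, zero_add, Memory.setVar_var,
      if_true, Memory.setVar_arr, Memory.setArr_arr, true_and]
    intro v hv
    by_cases hvk : v = σ[k]
    · rw [if_pos (by rw [hvk]), hvk, hσ.idxOf_getElem]
    · rw [if_neg (fun e => hvk (Fin.ext e))]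
      refine h2 v ?_
      have : σ.idxOf v ≠ k := by
        intro e
        apply hvk
        subst e
        simp
      omega

/-- Some vertex between the parent of `c` and `c` is not adjacent to `c`. -/
def IsViolation (G : SimpleGraph (Fin n)) (pos : Fin n → ℕ) (par : Fin n → Fin n) (c : Fin n) :
    Prop :=
  ∃ b, pos (par c) < pos b ∧ pos b < pos c ∧ ¬ G.Adj b c

/-- The parent is the first neighbour, so all neighbours of `c` before `c` lie in the stretch from
the parent to `c`. There is no violation exactly when they fill it, so a comparison of cardinalities
suffices. -/
theorem isViolation_iff {G : SimpleGraph (Fin n)} {le : Fin n → Fin n → Prop} {r : Fin n}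
    {σ : List (Fin n)} {par : Fin n → Fin n} (B : BFSLayout G le r (fun v => σ.idxOf v) par)
    (hσ : σ.Nodup) (hmem : ∀ v, v ∈ σ) {l : List (Fin n)} (hl : l.Nodup) {c : Fin n}
    (hlc : ∀ w, w ∈ l ↔ G.Adj c w) :
    IsViolation G (fun v => σ.idxOf v) par c ↔
      (l.filter fun w => decide (σ.idxOf w < σ.idxOf c)).length <
        σ.idxOf c - σ.idxOf (par c) := by
  classical
  have hlen := length_of_nodup hσ hmem
  let A : Finset (Fin n) := Finset.univ.filter fun w => σ.idxOf (par c) ≤ σ.idxOf w ∧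
    σ.idxOf w < σ.idxOf c
  have hA : A.card = σ.idxOf c - σ.idxOf (par c) := by
    rw [← Finset.card_image_of_injective A B.inj]
    have : A.image (fun v => σ.idxOf v) = Finset.Ico (σ.idxOf (par c)) (σ.idxOf c) := by
      ext j
      simp only [A, Finset.mem_image, Finset.mem_filter, Finset.mem_univ, true_and, Finset.mem_Ico]
      constructor
      · rintro ⟨w, hw, rfl⟩
        exact hw
      · intro hj
        have hlt : j < σ.length := by
          have := List.idxOf_lt_length_iff.2 (hmem c)
          omega
        refine ⟨σ[j], ?_, hσ.idxOf_getElem j hlt⟩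
        rwa [hσ.idxOf_getElem j hlt]
    rw [this, Nat.card_Ico]
  have hF : (l.filter fun w => decide (σ.idxOf w < σ.idxOf c)).length =
      (A.filter fun w => G.Adj c w).card := by
    rw [← List.toFinset_card_of_nodup (hl.filter _)]
    congr 1
    ext w
    simp only [A, List.mem_toFinset, List.mem_filter, hlc, Finset.mem_filter, Finset.mem_univ,
      true_and, decide_eq_true_eq]
    constructor
    · rintro ⟨h1, h2⟩
      exact ⟨⟨B.par_le w c h1.symm, h2⟩, h1⟩
    · rintro ⟨⟨-, h1⟩, h2⟩
      exact ⟨h2, h1⟩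
  rw [hF, ← hA]
  constructor
  · rintro ⟨b, h1, h2, h3⟩
    apply Finset.card_lt_card
    rw [Finset.filter_ssubset]
    exact ⟨b, by simpa [A] using ⟨h1.le, h2⟩, fun h => h3 h.symm⟩
  · intro h
    by_contra hcon
    refine h.ne (congrArg Finset.card (Finset.filter_true_of_mem fun w hw => ?_))
    simp only [A, Finset.mem_filter, Finset.mem_univ, true_and] at hw
    rcases hw.1.eq_or_lt with h1 | h1
    · rw [← B.inj h1]
      exact (B.par_adj c (B.ne_root hw.2)).symm
    · by_contra hadj
      exact hcon ⟨w, h1, hw.2, fun h => hadj h.symm⟩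

def countBackBody : Program :=
  .assign 6 (.get 1 (.var 4)) ;;
  .ifLt (.get 13 (.var 6)) (.var 3) (.assign 7 (.add (.var 7) (.lit 1))) .skip

def countBack : Program :=
  .assign 5 (.get 2 (.var 3)) ;; .assign 7 (.lit 0) ;; .assign 4 (.get 0 (.var 5)) ;;
  forTo 4 (.get 0 (.add (.var 5) (.lit 1))) countBackBody

/-- Register `11`, once set, blocks later records. Thus register `12` keeps the earliest violation,
as `isLocated_of_violation` requires. -/
def recordViolation : Program :=
  .ifLt (.var 11) (.lit 1)
    (.ifLt (.var 7) (.sub (.var 3) (.get 13 (.get 11 (.var 5))))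
      (.assign 12 (.var 5) ;; .assign 11 (.lit 1)) .skip) .skip

/-- Find the first violation: register `11` tells whether there is one, register `12` where. -/
def checkProg : Program :=
  .assign 11 (.lit 0) ;; .assign 3 (.lit 0) ;; forTo 3 (.var 0) (countBack ;; recordViolation)

theorem runs_countBack {L : Fin n → List (Fin n)} {s : Memory} (h : HasGraph L s) {c : Fin n}
    {i : ℕ} (h3 : s.var 3 = i) (hc : s.arr 2 i = c) {pos : Fin n → ℕ}
    (hpos : ∀ v : Fin n, s.arr 13 v = pos v) :
    Runs ((L c).length + 1) countBack s (fun s' => s'.var 5 = c ∧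
      s'.var 7 = ((L c).filter fun w => decide (pos w < i)).length) := by
  have hX : 1 ≤ (L c).length + 1 := by omega
  refine Runs.seq (Q := fun s' => s'.var 5 = c) (Runs.of_loopFree hX trivial
    (by simp [h3, hc])) ?_
  rintro s1 h15 hf1
  refine Runs.seq (Q := fun s' => s'.var 7 = 0) (Runs.of_loopFree hX trivial (by simp)) ?_
  rintro s2 h27 hf2
  have h25 : s2.var 5 = c := by rw [hf2.var 5 (by simp), h15]
  refine Runs.seq (Q := fun s' => s'.var 4 = s2.arr 0 c) (Runs.of_loopFree hX trivial
    (by simp [h25])) ?_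
  rintro s3 h34 hf3
  have h35 : s3.var 5 = c := by rw [hf3.var 5 (by simp), h25]
  have h37 : s3.var 7 = 0 := by rw [hf3.var 7 (by simp), h27]
  have h33 : s3.var 3 = i := by
    rw [hf3.var 3 (by simp), hf2.var 3 (by simp), hf1.var 3 (by simp), h3]
  have h313 : s3.arr 13 = s.arr 13 := by
    rw [hf3.arr 13 (by simp), hf2.arr 13 (by simp), hf1.arr 13 (by simp)]
  have hg3 : HasGraph L s3 := ((h.frame hf1 (by simp) (by simp) (by simp)).frame hf2 (by simp)
    (by simp) (by simp)).frame hf3 (by simp) (by simp) (by simp)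
  rw [← hf3.arr 0 (by simp)] at h34
  refine (Runs.forTo_loopFree (o := s3.arr 0 c) (N := (L c).length)
    (I := fun k s' => s'.var 4 = s3.arr 0 c + k ∧
      s'.var 7 = (((L c).take k).filter fun w => decide (pos w < i)).length)
    (by simp [countBackBody]) ?_ ?_ (by simp [h34, h37])).frame.mono le_rfl
    (fun s' hs' => ⟨by rw [hs'.2.var 5 (by simp [countBackBody]), h35], by simpa using hs'.1.2⟩)
  · rintro k s' - hI hf
    refine ⟨hI.1, ?_⟩
    simp only [Expr.eval, hf.var 5 (by simp [countBackBody]), h35]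
    rw [hf.arr 0 (by simp [countBackBody]), hg3.offset]
  · rintro k s' hk ⟨h1, h2⟩ hf -
    have hw : s'.arr 1 (s3.arr 0 c + k) = (L c)[k] := by
      rw [hf.arr 1 (by simp [countBackBody])]; exact hg3.stores c k hk
    have hp : s'.arr 13 ((L c)[k] : ℕ) = pos (L c)[k] := by
      rw [hf.arr 13 (by simp [countBackBody]), h313]; exact hpos _
    have h3' : s'.var 3 = i := by rw [hf.var 3 (by simp [countBackBody]), h33]
    rw [take_succ_eq hk, List.filter_append, List.length_append, List.filter_singleton]
    by_cases hlt : pos (L c)[k] < i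
    · simp [countBackBody, h1, hw, hp, h3', hlt, h2, add_assoc]
    · simp [countBackBody, h1, hw, hp, h3', hlt, h2, add_assoc]

theorem runs_checkProg {L : Fin n → List (Fin n)} {s : Memory} {G : SimpleGraph (Fin n)}
    [DecidableRel G.Adj] (h : HasGraph L s) (hnd : ∀ v, (L v).Nodup)
    (hL : ∀ v w, w ∈ L v ↔ G.Adj v w) {x r : Fin n} {τ σ : List (Fin n)} {P par : Fin n → Fin n}
    (hR : SearchResult G s x r τ σ P par) (hpos : ∀ v : Fin n, s.arr 13 v = σ.idxOf v) :
    Runs (weight L + 1) checkProg s (fun s' =>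
      (s'.var 11 = 0 ∧ ∀ c, ¬ IsViolation G (fun v => σ.idxOf v) par c) ∨
      (s'.var 11 = 1 ∧ ∃ c : Fin n, s'.var 12 = c ∧ IsViolation G (fun v => σ.idxOf v) par c ∧
        ∀ c', σ.idxOf c' < σ.idxOf c → ¬ IsViolation G (fun v => σ.idxOf v) par c')) := by
  have hn : 1 ≤ weight L + 1 := by omega
  have hlen := length_of_nodup hR.nodup hR.mem
  set V := IsViolation G (fun v => σ.idxOf v) par with hV
  refine Runs.seq (Q := fun s' => s'.var 11 = 0) (Runs.of_loopFree hn trivial (by simp)) ?_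
  intro s1 hs1 hf1
  refine Runs.seq (Q := fun s' => s'.var 3 = 0) (Runs.of_loopFree hn trivial (by simp)) ?_
  intro s2 hs2 hf2
  have hg2 : HasGraph L s2 := (h.frame hf1 (by simp) (by simp) (by simp)).frame hf2 (by simp)
    (by simp) (by simp)
  have hsum := sum_range_getElem? σ (fun v => (L v).length + 1)
  rw [hlen] at hsum
  refine (Runs.forTo (o := 0) (N := n) (f := fun k => (σ[k]?).elim 1 (fun v => (L v).length + 1))
      (I := fun k s' => s'.var 3 = k ∧ ((s'.var 11 = 0 ∧ ∀ c, σ.idxOf c < k → ¬ V c) ∨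
        (s'.var 11 = 1 ∧ ∃ c : Fin n, s'.var 12 = c ∧ V c ∧
          ∀ c', σ.idxOf c' < σ.idxOf c → ¬ V c')))
      ?_ ?_ ?_ ?_).mono ?_ ?_
  · intro k hk
    rw [List.getElem?_eq_getElem (by omega)]
    simp
  · rintro k s' - hI hf
    refine ⟨by simpa using hI.1, ?_⟩
    rw [zero_add, ← hg2.size]
    exact hf.var 0 (by simp [countBack, countBackBody, recordViolation])
  · rintro k s' hk ⟨h1, h2⟩ hf -
    have hg : HasGraph L s' := hg2.frame hf (by simp [countBack, countBackBody, recordViolation])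
      (by simp [countBack, countBackBody, recordViolation])
      (by simp [countBack, countBackBody, recordViolation])
    have hkσ : k < σ.length := by omega
    have harr : ∀ a, s'.arr a = s.arr a := by
      intro a
      rw [hf.arr a (by simp [countBack, countBackBody, recordViolation]), hf2.arr a (by simp),
        hf1.arr a (by simp)]
    have hσk : s'.arr 2 k = σ[k] := by
      rw [harr]
      simpa using hR.stores k hkσ
    have hidx : σ.idxOf σ[k] = k := hR.nodup.idxOf_getElem k hkσ
    rw [List.getElem?_eq_getElem hkσ]
    refine Runs.seq (runs_countBack hg h1 hσk (pos := fun v => σ.idxOf v)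
      (by rw [harr]; exact hpos)) ?_
    rintro s'' ⟨h5, h7⟩ hf''
    have h3'' : s''.var 3 = k := by rw [hf''.var 3 (by simp [countBack, countBackBody]), h1]
    have h11'' : s''.var 11 = s'.var 11 := hf''.var 11 (by simp [countBack, countBackBody])
    have h12'' : s''.var 12 = s'.var 12 := hf''.var 12 (by simp [countBack, countBackBody])
    have harr'' : ∀ a, s''.arr a = s.arr a := by
      intro a
      rw [hf''.arr a (by simp [countBack, countBackBody]), harr]
    have hpar : s''.arr 13 (s''.arr 11 (σ[k] : ℕ)) = σ.idxOf (par σ[k]) := by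
      rw [harr'', harr'', hR.parents₂, hpos]
    have hviol := isViolation_iff hR.layout₂ hR.nodup hR.mem (hnd σ[k]) (hL σ[k])
    rw [← hV, hidx, ← h7] at hviol
    refine Runs.of_loopFree (by simp) (by simp [recordViolation]) ⟨?_, by simp, ?_⟩
    · rw [zero_add]
      exact (Program.run_frame (by simp [recordViolation]) s'').var 3 (by simp [recordViolation])
        |>.trans h3''
    · rcases h2 with ⟨h11, h2⟩ | ⟨h11, c, h12, h2⟩
      · by_cases hVk : V σ[k]
        · right
          have := hviol.1 hVk
          refine ⟨?_, σ[k], ?_, hVk, fun c' hc' => h2 c' (by rwa [hidx] at hc')⟩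
          · simp [recordViolation, h11'', h11, h3'', h5, hpar, this]
          · simp [recordViolation, h11'', h11, h3'', h5, hpar, this]
        · left
          have := mt hviol.2 hVk
          refine ⟨?_, fun c hc => ?_⟩
          · simp [recordViolation, h11'', h11, h3'', h5, hpar, this]
          · rcases Nat.lt_succ_iff_lt_or_eq.1 hc with hc | hc
            · exact h2 c hc
            · have : c = σ[k] := by
                subst hc
                simp
              rwa [this]
      · right
        refine ⟨?_, c, ?_, h2⟩
        · simp [recordViolation, h11'', h11]
        · simp [recordViolation, h11'', h11, h12'', h12]
  · refine ⟨hs2, Or.inl ⟨?_, by simp⟩⟩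
    rw [hf2.var 11 (by simp), hs1]
  · rw [hsum]
    have := sum_map_le_weight L hR.nodup
    omega
  · rintro s' ⟨-, h1⟩
    refine h1.imp_left fun h2 => ⟨h2.1, fun c => h2.2 c ?_⟩
    exact lt_of_lt_of_eq (List.idxOf_lt_length_iff.2 (hR.mem c)) hlen

end Check

/-! ### Slots: vertices whose adjacencies can be tested in constant time. -/

section Slots

variable {n : ℕ}

/-- Slot `i` holds the vertex `v`: register `20 + i` contains `v`, and array `20 + i` contains the
characteristic function of its neighbourhood. -/
def SlotHolds (L : Fin n → List (Fin n)) (i : ℕ) (v : Fin n) (s : Memory) : Prop :=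
  s.var (20 + i) = v ∧ ∀ w : Fin n, s.arr (20 + i) w = if w ∈ L v then 1 else 0

/-- The slots hold the vertices in the list `vs`. -/
def SlotsHold (L : Fin n → List (Fin n)) (vs : List (Fin n)) (s : Memory) : Prop :=
  ∀ (i : ℕ) (v : Fin n), vs[i]? = some v → SlotHolds L i v s

theorem SlotsHold.frame {L : Fin n → List (Fin n)} {vs : List (Fin n)} {s s' : Memory} {p : Program}
    (h : SlotsHold L vs s) (hf : Frame p s s')
    (hv : ∀ i, p.WritesVar i → i < 20 ∨ 20 + vs.length ≤ i)
    (ha : ∀ a, p.WritesArr a → a < 20 ∨ 20 + vs.length ≤ a) : SlotsHold L vs s' := by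
  intro i v hi
  obtain ⟨h1, h2⟩ := h i v hi
  have hlt := (List.getElem?_eq_some_iff.1 hi).1
  refine ⟨?_, fun w => ?_⟩
  · rw [hf.var _ fun h => by have := hv _ h; omega, h1]
  · rw [hf.arr _ fun h => by have := ha _ h; omega, h2]

/-- Put the vertex `e` into slot `i`. -/
def setSlot (i : ℕ) (e : Expr) : Program :=
  .assign (20 + i) e ;; clearProg (20 + i) ;; .assign 4 (.get 0 (.var (20 + i))) ;;
  forTo 4 (.get 0 (.add (.var (20 + i)) (.lit 1))) (.put (20 + i) (.get 1 (.var 4)) (.lit 1))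

theorem runs_setSlot {L : Fin n → List (Fin n)} {s : Memory} (h : HasGraph L s)
    {vs : List (Fin n)} (hvs : SlotsHold L vs s) {e : Expr} {v : Fin n} (he : e.eval s = v) :
    Runs (weight L + 1) (setSlot vs.length e) s (SlotsHold L (vs ++ [v])) := by
  set i := vs.length with hi
  have hX : 1 ≤ weight L + 1 := by omega
  have hnw := le_weight L
  suffices hmain : Runs (weight L + 1) (setSlot i e) s (SlotHolds L i v) by
    refine hmain.frame.mono le_rfl ?_
    rintro s' ⟨h1, hf⟩ j w hj
    rcases Nat.lt_or_ge j vs.length with hlt | hge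
    · rw [List.getElem?_append_left hlt] at hj
      refine hvs.frame hf ?_ ?_ j w hj
      · intro k hk
        simp [setSlot, clearProg] at hk
        omega
      · intro k hk
        simp [setSlot, clearProg] at hk
        omega
    · have hlt := (List.getElem?_eq_some_iff.1 hj).1
      simp only [List.length_append, List.length_singleton] at hlt
      obtain rfl : j = vs.length := by omega
      simp only [List.getElem?_concat_length, Option.some.injEq] at hj
      subst hj
      exact h1
  refine Runs.seq (Q := fun s' => s'.var (20 + i) = v) (Runs.of_loopFree hX trivial
    (by simp [he])) ?_
  intro s1 h1 hf1
  have hg1 := h.frame hf1 (by simp; omega) (by simp) (by simp)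
  refine Runs.seq ((runs_clearProg hg1.size (20 + i)).mono (by omega) fun _ h => h) ?_
  intro s2 h2 hf2
  have hg2 := hg1.frame hf2 (by simp [clearProg]) (by simp [clearProg]; omega)
    (by simp [clearProg]; omega)
  have h2v : s2.var (20 + i) = v := by rw [hf2.var _ (by simp [clearProg]; omega), h1]
  refine Runs.seq (Q := fun s' => s'.var 4 = s2.arr 0 v) (Runs.of_loopFree hX trivial
    (by simp [h2v])) ?_
  intro s3 h3 hf3
  have hg3 := hg2.frame hf3 (by simp) (by simp) (by simp)
  have h3v : s3.var (20 + i) = v := by rw [hf3.var _ (by simp; omega), h2v]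
  have h3a : s3.arr = s2.arr := by
    funext a
    exact hf3.arr a (by simp)
  rw [← h3a] at h3
  refine (Runs.forTo_loopFree (o := s3.arr 0 v) (N := (L v).length)
    (I := fun k s' => s'.var 4 = s3.arr 0 v + k ∧ ∀ w : Fin n, s'.arr (20 + i) w =
      if w ∈ (L v).take k then 1 else 0) (by simp) ?_ ?_ (by simpa [h3, h3a] using h2)).frame.mono
      (by have := length_succ_le_weight L v; omega) ?_
  · rintro k s' - hI hf
    refine ⟨hI.1, ?_⟩
    simp only [Expr.eval, hf.var (20 + i) (by simp; omega), h3v]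
    rw [hf.arr 0 (by simp; omega), hg3.offset]
  · rintro k s' hk ⟨h4, h5⟩ hf -
    have hw : s'.arr 1 (s3.arr 0 v + k) = (L v)[k] := by
      rw [hf.arr 1 (by simp; omega)]
      exact hg3.stores v k hk
    refine ⟨by simpa using h4, by simp [add_assoc], fun w => ?_⟩
    rw [take_succ_eq hk]
    have hvw : ((w : ℕ) = (L v)[k]) ↔ w = (L v)[k] := Fin.ext_iff.symm
    simp only [Program.run, Expr.eval, h4, hw, Memory.setVar_arr, Memory.setArr_arr, true_and,
      List.mem_append, List.mem_singleton, hvw, h5]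
    by_cases hwk : w = (L v)[k]
    · rw [if_pos hwk, if_pos (Or.inr hwk)]
    · simp only [hwk, if_false, or_false]
  · rintro s' ⟨⟨-, h5⟩, hf⟩
    exact ⟨by rw [hf.var _ (by simp; omega), h3v], by simpa using h5⟩

/-- Find a vertex between the parent of `c` and `c` that is not adjacent to `c`, where slot `0`
holds `c` and slot `1` its parent. -/
def findNonneighbour : Program :=
  .assign 7 (.var 20) ;; .assign 3 (.add (.get 13 (.var 21)) (.lit 1)) ;;
  forTo 3 (.get 13 (.var 20))
    (.assign 6 (.get 2 (.var 3)) ;;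
      .ifLt (.get 20 (.var 6)) (.lit 1) (.assign 7 (.var 6)) .skip)

theorem runs_findNonneighbour {L : Fin n → List (Fin n)} {s : Memory} {G : SimpleGraph (Fin n)}
    (hL : ∀ v w, w ∈ L v ↔ G.Adj v w) {σ : List (Fin n)} (hσ : σ.Nodup) (hmem : ∀ v, v ∈ σ)
    (hs : s.Stores 2 0 σ) (hpos : ∀ v : Fin n, s.arr 13 v = σ.idxOf v) {a c : Fin n}
    (h0 : SlotHolds L 0 c s) (h1 : s.var 21 = a)
    (h : ∃ b, σ.idxOf a < σ.idxOf b ∧ σ.idxOf b < σ.idxOf c ∧ ¬ G.Adj b c) :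
    Runs (n + 1) findNonneighbour s (fun s' => ∃ b : Fin n, s'.var 7 = b ∧
      σ.idxOf a < σ.idxOf b ∧ σ.idxOf b < σ.idxOf c ∧ ¬ G.Adj b c) := by
  classical
  have hX : 1 ≤ n + 1 := by omega
  obtain ⟨b₀, hb₀⟩ := h
  have hlen := length_of_nodup hσ hmem
  have hcn : σ.idxOf c < n := lt_of_lt_of_eq (List.idxOf_lt_length_iff.2 (hmem c)) hlen
  refine Runs.seq (Q := fun s' => s'.var 7 = c) (Runs.of_loopFree hX trivial
    (by simpa using h0.1)) ?_
  intro s1 hs1 hf1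
  refine Runs.seq (Q := fun s' => s'.var 3 = σ.idxOf a + 1) (Runs.of_loopFree hX trivial ?_) ?_
  · have := hf1.var 21 (by simp)
    have h13 := hf1.arr 13 (by simp)
    simp [this, h1, h13, hpos]
  intro s2 hs2 hf2
  have h2a : ∀ i, s2.arr i = s.arr i := fun i => by rw [hf2.arr i (by simp), hf1.arr i (by simp)]
  have h27 : s2.var 7 = c := by rw [hf2.var 7 (by simp), hs1]
  have h220 : s2.var 20 = c := by rw [hf2.var 20 (by simp), hf1.var 20 (by simp)]; exact h0.1
  refine (Runs.forTo_loopFree (o := σ.idxOf a + 1) (N := σ.idxOf c - σ.idxOf a - 1)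
    (I := fun k s' => s'.var 3 = σ.idxOf a + 1 + k ∧
      ((∃ b : Fin n, s'.var 7 = b ∧
        σ.idxOf a < σ.idxOf b ∧ σ.idxOf b < σ.idxOf c ∧ ¬ G.Adj b c) ∨
      ∀ b, σ.idxOf a < σ.idxOf b → σ.idxOf b < σ.idxOf a + 1 + k → G.Adj b c))
    (by simp) ?_ ?_ ⟨hs2, Or.inr fun b _ _ => by omega⟩).mono (by omega) ?_
  · rintro k s' - hI hf
    refine ⟨hI.1, ?_⟩
    simp only [Expr.eval, hf.var 20 (by simp), h220, hf.arr 13 (by simp), h2a, hpos]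
    omega
  · rintro k s' hk ⟨h3, h4⟩ hf -
    have hkσ : σ.idxOf a + 1 + k < σ.length := by omega
    have h2 : s'.arr 2 (σ.idxOf a + 1 + k) = σ[σ.idxOf a + 1 + k] := by
      rw [hf.arr 2 (by simp), h2a]
      simpa using hs _ hkσ
    have hidx := hσ.idxOf_getElem _ hkσ
    set w := σ[σ.idxOf a + 1 + k] with hw
    have h20 : s'.arr 20 w = if w ∈ L c then 1 else 0 := by
      rw [hf.arr 20 (by simp), h2a]
      exact h0.2 w
    simp only [hL, G.adj_comm c] at h20
    by_cases hadj : G.Adj w c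
    · rw [if_pos hadj] at h20
      refine ⟨by simp [h3, h2, h20], by simp [add_assoc], ?_⟩
      rcases h4 with ⟨b, hb1, hb2⟩ | h4
      · exact Or.inl ⟨b, by simp [h3, h2, h20, hb1], hb2⟩
      · refine Or.inr fun b hb1 hb2 => ?_
        rcases Nat.lt_succ_iff_lt_or_eq.1 (show σ.idxOf b < σ.idxOf a + 1 + k + 1 by omega)
          with h5 | h5
        · exact h4 b hb1 h5
        · rw [← hidx] at h5
          rwa [(List.idxOf_inj (hmem b)).1 h5]
    · rw [if_neg hadj] at h20
      exact ⟨by simp [h3, h2, h20], by simp [add_assoc], Or.inl ⟨w, by simp [h3, h2, h20], by omega,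
        by omega, hadj⟩⟩
  · rintro s' ⟨-, h4⟩
    rcases h4 with h4 | h4
    · exact h4
    · exact absurd (h4 b₀ hb₀.1 (by omega)) hb₀.2.2

/-- Find a neighbour of the vertex in slot `i` that is neither equal nor adjacent to the vertex in
slot `j`. -/
def findPrivate (i j : ℕ) : Program :=
  .assign 5 (.var (20 + i)) ;; .assign 7 (.var 5) ;; .assign 4 (.get 0 (.var 5)) ;;
  forTo 4 (.get 0 (.add (.var 5) (.lit 1)))
    (.assign 6 (.get 1 (.var 4)) ;;
      .ifLt (.get (20 + j) (.var 6)) (.lit 1)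
        -- Inequality is tested as positivity of the sum of both truncated differences.
        (.ifLt (.lit 0) (.add (.sub (.var 6) (.var (20 + j))) (.sub (.var (20 + j)) (.var 6)))
          (.assign 7 (.var 6)) .skip) .skip)

theorem runs_findPrivate {L : Fin n → List (Fin n)} {s : Memory} (h : HasGraph L s)
    {G : SimpleGraph (Fin n)} (hL : ∀ v w, w ∈ L v ↔ G.Adj v w) {i j : ℕ} {u v : Fin n}
    (hu : SlotHolds L i u s) (hv : SlotHolds L j v s) :
    Runs (weight L + 1) (findPrivate i j) s (fun s' => ∃ z : Fin n, s'.var 7 = z ∧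
      ((∃ w, G.Adj u w ∧ w ≠ v ∧ ¬ G.Adj v w) → G.Adj u z ∧ z ≠ v ∧ ¬ G.Adj v z)) := by
  classical
  have hX : 1 ≤ weight L + 1 := by omega
  refine Runs.seq (Q := fun s' => s'.var 5 = u) (Runs.of_loopFree hX trivial
    (by simpa using hu.1)) ?_
  intro s1 hs1 hf1
  -- Starting from `u` makes the output a vertex even if no suitable neighbour exists.
  refine Runs.seq (Q := fun s' => s'.var 7 = u) (Runs.of_loopFree hX trivial
    (by simpa using hs1)) ?_
  intro s2 hs2 hf2
  have h25 : s2.var 5 = u := by rw [hf2.var 5 (by simp), hs1]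
  refine Runs.seq (Q := fun s' => s'.var 4 = s2.arr 0 u) (Runs.of_loopFree hX trivial
    (by simp [h25])) ?_
  intro s3 hs3 hf3
  have h3a : ∀ a, s3.arr a = s.arr a := fun a => by
    rw [hf3.arr a (by simp), hf2.arr a (by simp), hf1.arr a (by simp)]
  have h35 : s3.var 5 = u := by rw [hf3.var 5 (by simp), h25]
  have h37 : s3.var 7 = u := by rw [hf3.var 7 (by simp), hs2]
  have h3j : s3.var (20 + j) = v := by
    rw [hf3.var _ (by simp; omega), hf2.var _ (by simp; omega), hf1.var _ (by simp; omega), hv.1]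
  have hg3 : HasGraph L s3 := ((h.frame hf1 (by simp) (by simp) (by simp)).frame hf2 (by simp)
    (by simp) (by simp)).frame hf3 (by simp) (by simp) (by simp)
  rw [← hf3.arr 0 (by simp)] at hs3
  refine (Runs.forTo_loopFree (o := s3.arr 0 u) (N := (L u).length)
    (I := fun k s' => s'.var 4 = s3.arr 0 u + k ∧ ∃ z : Fin n, s'.var 7 = z ∧
      ((∃ w ∈ (L u).take k, w ≠ v ∧ ¬ G.Adj v w) → G.Adj u z ∧ z ≠ v ∧ ¬ G.Adj v z))
    (by simp) ?_ ?_ ⟨by simpa using hs3, u, h37, by simp⟩).mono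
    (by have := length_succ_le_weight L u; omega) ?_
  · rintro k s' - hI hf
    refine ⟨hI.1, ?_⟩
    simp only [Expr.eval, hf.var 5 (by simp), h35]
    rw [hf.arr 0 (by simp), hg3.offset]
  · rintro k s' hk ⟨h4, z, h7, hz⟩ hf -
    have h1 : s'.arr 1 (s3.arr 0 u + k) = (L u)[k] := by
      rw [hf.arr 1 (by simp)]
      exact hg3.stores u k hk
    have huw : G.Adj u (L u)[k] := (hL _ _).1 (List.getElem_mem hk)
    set w := (L u)[k] with hw
    have hj : s'.var (20 + j) = v := by rw [hf.var _ (by simp; omega), h3j]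
    have hmark : s'.arr (20 + j) w = if G.Adj v w then 1 else 0 := by
      rw [hf.arr _ (by simp), h3a, hv.2]
      simp only [hL]
    have htake : ∀ x, x ∈ (L u).take (k + 1) ↔ x ∈ (L u).take k ∨ x = w := by
      intro x
      rw [take_succ_eq hk, List.mem_append, List.mem_singleton]
    by_cases hok : w ≠ v ∧ ¬ G.Adj v w
    · rw [if_neg hok.2] at hmark
      have hne : v ≠ w := Ne.symm hok.1
      have hj6 : 20 + j ≠ 6 := by omega
      exact ⟨by simp [h4, h1, hmark, hj, hne, hj6], by simp [add_assoc], w,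
        by simp [h1, h4, hmark, hj, hne, hj6], fun _ => ⟨huw, hok⟩⟩
    · have hj6 : 20 + j ≠ 6 := by omega
      refine ⟨?_, by simp [add_assoc], z, ?_, ?_⟩
      · by_cases hadj : G.Adj v w
        · simp [h4, h1, hmark, hadj]
        · have hwv : w = v := by tauto
          simp [h4, h1, hj6, hj, hwv]
      · by_cases hadj : G.Adj v w
        · simp [h4, h1, hmark, hadj, h7]
        · have hwv : w = v := by tauto
          simp [h4, h1, hj6, hj, hwv, h7]
      · rintro ⟨x, hx, hx'⟩
        rcases (htake x).1 hx with hx | rfl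
        · exact hz ⟨x, hx, hx'⟩
        · exact absurd hx' hok
  · rintro s' ⟨-, z, h7, hz⟩
    refine ⟨z, h7, ?_⟩
    rintro ⟨w, hw, hw'⟩
    exact hz ⟨w, by rw [List.take_length]; exact (hL _ _).2 hw, hw'⟩

end Slots

/-! ### Collecting the twelve candidate vertices. -/

section Gather

variable {n : ℕ}

/-- What is known while the slots are being filled: the graph, the outcome of the searches and the
positions are still in place, and the slots hold `vs`. -/
structure IsGathering (L : Fin n → List (Fin n)) (r : Fin n) (σ : List (Fin n))
    (P par : Fin n → Fin n) (vs : List (Fin n)) (s : Memory) : Prop where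
  graph : HasGraph L s
  stores : s.Stores 2 0 σ
  root : s.var 10 = r
  parents₁ : ∀ v : Fin n, s.arr 9 v = P v
  parents₂ : ∀ v : Fin n, s.arr 11 v = par v
  position : ∀ v : Fin n, s.arr 13 v = σ.idxOf v
  slots : SlotsHold L vs s

variable {L : Fin n → List (Fin n)} {r : Fin n} {σ : List (Fin n)} {P par : Fin n → Fin n}
  {vs : List (Fin n)} {s : Memory}

theorem IsGathering.frame {s' : Memory} {p : Program} {vs' : List (Fin n)}
    (h : IsGathering L r σ P par vs s) (hf : Frame p s s') (h0 : ¬ p.WritesVar 0)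
    (h10 : ¬ p.WritesVar 10) (ha : ∀ a < 20, ¬ p.WritesArr a) (hs : SlotsHold L vs' s') :
    IsGathering L r σ P par vs' s' where
  graph := h.graph.frame hf h0 (ha 0 (by omega)) (ha 1 (by omega))
  stores := h.stores.congr fun i _ => by rw [hf.arr 2 (ha 2 (by omega))]
  root := by rw [hf.var 10 h10, h.root]
  parents₁ v := by rw [hf.arr 9 (ha 9 (by omega)), h.parents₁]
  parents₂ v := by rw [hf.arr 11 (ha 11 (by omega)), h.parents₂]
  position v := by rw [hf.arr 13 (ha 13 (by omega)), h.position]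
  slots := hs

theorem IsGathering.setSlot (h : IsGathering L r σ P par vs s) {e : Expr} {v : Fin n}
    (he : e.eval s = v) :
    Runs (weight L + 1) (setSlot vs.length e) s (IsGathering L r σ P par (vs ++ [v])) := by
  refine (runs_setSlot h.graph h.slots he).frame.mono le_rfl ?_
  rintro s' ⟨h1, hf⟩
  refine h.frame hf (by simp [IUG.setSlot, clearProg]; omega)
    (by simp [IUG.setSlot, clearProg]; omega)
    (fun a ha => by simp [IUG.setSlot, clearProg]; omega) h1

theorem IsGathering.eval_slot (h : IsGathering L r σ P par vs s) (i : ℕ) {v : Fin n}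
    (hi : vs[i]? = some v) : s.var (20 + i) = v :=
  (h.slots i v hi).1

/-- Collect the vertices among which an obstruction will be found. -/
def gatherProg : Program :=
  setSlot 0 (.var 12) ;; setSlot 1 (.get 11 (.var 20)) ;;
  findNonneighbour ;; setSlot 2 (.var 7) ;;
  findPrivate 2 1 ;; setSlot 3 (.var 7) ;;
  findPrivate 0 1 ;; setSlot 4 (.var 7) ;;
  setSlot 5 (.get 11 (.var 21)) ;; setSlot 6 (.get 11 (.var 25)) ;;
  setSlot 7 (.var 10) ;; setSlot 8 (.get 9 (.var 27)) ;; setSlot 9 (.get 9 (.var 28)) ;;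
  setSlot 10 (.get 9 (.var 23)) ;; setSlot 11 (.get 9 (.var 20))

/-- The slots are filled with the list appearing in `isLocated_of_violation`, in the same order up
to the last two entries included, each in linear time. -/
theorem runs_gatherProg {G : SimpleGraph (Fin n)} (hL : ∀ v w, w ∈ L v ↔ G.Adj v w)
    (h : IsGathering L r σ P par [] s) (hσ : σ.Nodup) (hmem : ∀ v, v ∈ σ) {c : Fin n}
    (hc : s.var 12 = c) (hV : IsViolation G (fun v => σ.idxOf v) par c) :
    Runs (weight L + 1) gatherProg s (fun s' => ∃ b z y : Fin n,
      (σ.idxOf (par c) < σ.idxOf b ∧ σ.idxOf b < σ.idxOf c ∧ ¬ G.Adj b c) ∧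
      ((∃ w, G.Adj b w ∧ w ≠ par c ∧ ¬ G.Adj (par c) w) →
        G.Adj b z ∧ z ≠ par c ∧ ¬ G.Adj (par c) z) ∧
      ((∃ w, G.Adj c w ∧ w ≠ par c ∧ ¬ G.Adj (par c) w) →
        G.Adj c y ∧ y ≠ par c ∧ ¬ G.Adj (par c) y) ∧
      IsGathering L r σ P par [c, par c, b, z, y, par (par c), par (par (par c)), r, P r, P (P r),
        P z, P c] s') := by
  have hnw := le_weight L
  refine Runs.seq (h.setSlot (v := c) (by simpa using hc)) fun s h _ => ?_
  refine Runs.seq (h.setSlot (v := par c) ?_) fun s h _ => ?_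
  · have := h.eval_slot 0 (v := c) rfl
    simp [this, h.parents₂]
  refine Runs.seq ((runs_findNonneighbour hL hσ hmem h.stores h.position (h.slots 0 c rfl)
    (h.eval_slot 1 (v := par c) rfl) hV).mono (by omega) fun _ h => h) ?_
  rintro s1 ⟨b, h7, hb⟩ hf
  replace h := h.frame hf (by simp [findNonneighbour]) (by simp [findNonneighbour])
    (by simp [findNonneighbour]) (h.slots.frame hf (fun i hi => by
      simp [findNonneighbour] at hi; omega) (fun i hi => by simp [findNonneighbour] at hi))
  refine Runs.seq (h.setSlot (v := b) (by simpa using h7)) fun s h _ => ?_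
  refine Runs.seq (runs_findPrivate h.graph hL (h.slots 2 b rfl) (h.slots 1 _ rfl)) ?_
  rintro s2 ⟨z, h7, hz⟩ hf
  replace h := h.frame hf (by simp [findPrivate]) (by simp [findPrivate])
    (by simp [findPrivate]) (h.slots.frame hf (fun i hi => by
      simp [findPrivate] at hi; omega) (fun i hi => by simp [findPrivate] at hi))
  refine Runs.seq (h.setSlot (v := z) (by simpa using h7)) fun s h _ => ?_
  refine Runs.seq (runs_findPrivate h.graph hL (h.slots 0 c rfl) (h.slots 1 _ rfl)) ?_
  rintro s3 ⟨y, h7, hy⟩ hf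
  replace h := h.frame hf (by simp [findPrivate]) (by simp [findPrivate])
    (by simp [findPrivate]) (h.slots.frame hf (fun i hi => by
      simp [findPrivate] at hi; omega) (fun i hi => by simp [findPrivate] at hi))
  refine Runs.seq (h.setSlot (v := y) (by simpa using h7)) fun s h _ => ?_
  refine Runs.seq (h.setSlot (v := par (par c)) ?_) fun s h _ => ?_
  · have := h.eval_slot 1 (v := par c) rfl
    simp [this, h.parents₂]
  refine Runs.seq (h.setSlot (v := par (par (par c))) ?_) fun s h _ => ?_
  · have := h.eval_slot 5 (v := par (par c)) rfl
    simp [this, h.parents₂]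
  refine Runs.seq (h.setSlot (v := r) h.root) fun s h _ => ?_
  refine Runs.seq (h.setSlot (v := P r) ?_) fun s h _ => ?_
  · have := h.eval_slot 7 (v := r) rfl
    simp [this, h.parents₁]
  refine Runs.seq (h.setSlot (v := P (P r)) ?_) fun s h _ => ?_
  · have := h.eval_slot 8 (v := P r) rfl
    simp [this, h.parents₁]
  refine Runs.seq (h.setSlot (v := P z) ?_) fun s h _ => ?_
  · have := h.eval_slot 3 (v := z) rfl
    simp [this, h.parents₁]
  refine (h.setSlot (v := P c) ?_).mono le_rfl fun s h => ⟨b, z, y, hb, hz, hy, h⟩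
  have := h.eval_slot 0 (v := c) rfl
  simp [this, h.parents₁]

end Gather

/-! ### Testing slots for an induced copy of a fixed graph. -/

section Tests

variable {n m : ℕ}

/-- An obstruction has been written into array `3`, its size into register `2`. -/
def HasObstruction (G : SimpleGraph (Fin n)) (s : Memory) : Prop :=
  ∃ w : List (Fin n), s.var 2 = w.length ∧ s.Stores 3 0 w ∧ IsObstruction G w

/-- What is left unchanged during the search for an obstruction: the graph, the ordering `σ`, and
the vertices `x` in the slots. -/
structure IsTesting (L : Fin n → List (Fin n)) (σ : List (Fin n)) (x : Fin m → Fin n)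
    (s : Memory) : Prop where
  graph : HasGraph L s
  stores : s.Stores 2 0 σ
  slots : ∀ i : Fin m, SlotHolds L i (x i) s

/-- Register `13` tells whether an obstruction has been found. -/
def IsFlagged (G : SimpleGraph (Fin n)) (s : Memory) : Prop :=
  s.var 13 = 0 ∨ (s.var 13 = 1 ∧ HasObstruction G s)

/-- The program `p` looks for an obstruction, and finds one if `C` holds. -/
def Tests (G : SimpleGraph (Fin n)) (L : Fin n → List (Fin n)) (σ : List (Fin n))
    (x : Fin m → Fin n) (p : Program) (C : Prop) : Prop :=
  ∀ s, IsTesting L σ x s → IsFlagged G s →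
    Runs (weight L + 1) p s (fun s' => (IsTesting L σ x s' ∧ IsFlagged G s') ∧
      (s.var 13 = 1 → s'.var 13 = 1) ∧ (C → s'.var 13 = 1))

variable {G : SimpleGraph (Fin n)} {L : Fin n → List (Fin n)} {σ : List (Fin n)}
  {x : Fin m → Fin n} {s s' : Memory} {p q : Program} {C D : Prop}

/-- The program does not overwrite the graph, the array `2`, and the slots. -/
structure Program.SparesSlots (p : Program) : Prop where
  var : ∀ i, p.WritesVar i → i ≠ 0 ∧ i < 20
  arr : ∀ a, p.WritesArr a → 2 < a ∧ a < 20

theorem IsTesting.frame (h : IsTesting L σ x s) (hf : Frame p s s') (hp : p.SparesSlots) :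
    IsTesting L σ x s' where
  graph := h.graph.frame hf (fun h => (hp.var _ h).1 rfl) (fun h => by have := hp.arr _ h; omega)
    (fun h => by have := hp.arr _ h; omega)
  stores := h.stores.congr fun i _ => by rw [hf.arr 2 fun h => by have := hp.arr _ h; omega]
  slots i := by
    obtain ⟨h1, h2⟩ := h.slots i
    refine ⟨?_, fun w => ?_⟩
    · rw [hf.var _ fun h => by have := hp.var _ h; omega, h1]
    · rw [hf.arr _ fun h => by have := hp.arr _ h; omega, h2]

/-- The flag is never lowered, so success conditions combine by disjunction. -/
theorem Tests.seq (hp : Tests G L σ x p C) (hq : Tests G L σ x q D) :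
    Tests G L σ x (p ;; q) (C ∨ D) := by
  intro s h hs
  refine Runs.seq (hp s h hs) ?_
  rintro s1 ⟨⟨h1, h2⟩, h3, h4⟩ -
  refine (hq s1 h1 h2).mono le_rfl ?_
  rintro s2 ⟨h5, h6, h7⟩
  exact ⟨h5, fun h => h6 (h3 h), fun h => h.elim (fun h => h6 (h4 h)) h7⟩

theorem Tests.imp (h : Tests G L σ x p C) (hDC : D → C) : Tests G L σ x p D :=
  fun s hs hf => (h s hs hf).mono le_rfl fun _ h' => ⟨h'.1, h'.2.1, fun hD => h'.2.2 (hDC hD)⟩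

/-- Run the programs in a list one after the other. -/
def seqAll : List Program → Program
  | [] => .skip
  | p :: ps => p ;; seqAll ps

theorem Tests.seqAll {ι : Type*} {f : ι → Program} {C : ι → Prop} (l : List ι)
    (h : ∀ i ∈ l, Tests G L σ x (f i) (C i)) :
    Tests G L σ x (seqAll (l.map f)) (∃ i ∈ l, C i) := by
  induction l with
  | nil =>
    intro s h hs
    exact Runs.of_loopFree (by omega) trivial ⟨⟨h, hs⟩, fun h => h, by simp⟩
  | cons i l ih =>
    have := (h i (by simp)).seq (ih fun j hj => h j (by simp [hj]))
    simpa [IUG.seqAll] using this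

/-- Run `p` if all the tests `c.1 < c.2` for `c` in the list are positive. -/
def whenAll : List (Expr × Expr) → Program → Program
  | [], p => p
  | c :: cs, p => .ifLt c.1 c.2 (whenAll cs p) .skip

theorem runs_whenAll {X : ℕ} (hX : 1 ≤ X) {Q : Memory → Prop} (cs : List (Expr × Expr))
    (hp : (∀ c ∈ cs, c.1.eval s < c.2.eval s) → Runs X p s Q)
    (hs : ¬ (∀ c ∈ cs, c.1.eval s < c.2.eval s) → Q s) : Runs X (whenAll cs p) s Q := by
  induction cs with
  | nil => exact hp (by simp)
  | cons c cs ih =>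
    refine Runs.ite hX (fun h => ih (fun h' => hp ?_) fun h' => hs ?_) fun h =>
      Runs.of_loopFree hX trivial (hs ?_)
    · simpa using ⟨h, by simpa using h'⟩
    · exact fun h'' => h' fun c hc => h'' c (by simp [hc])
    · exact fun h'' => h (h'' c (by simp))

/-- Unless an obstruction is already known, run `p` if all the tests in the list are positive. -/
def guarded (cs : List (Expr × Expr)) (p : Program) : Program :=
  .ifLt (.var 13) (.lit 1) (whenAll cs p) .skip

/-- After a success all further searches are skipped, so the recorded obstruction cannot be
overwritten. -/
theorem Tests.guarded {cs : List (Expr × Expr)} (hp : p.SparesSlots)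
    (hcs : C → ∀ s, IsTesting L σ x s → ∀ c ∈ cs, c.1.eval s < c.2.eval s)
    (h : ∀ s, IsTesting L σ x s → s.var 13 = 0 → (∀ c ∈ cs, c.1.eval s < c.2.eval s) →
      Runs (weight L + 1) p s (fun s' => IsFlagged G s' ∧ (C → s'.var 13 = 1))) :
    Tests G L σ x (guarded cs p) C := by
  intro s hs hflag
  refine Runs.ite (by omega) (fun h13 => ?_) fun h13 => Runs.of_loopFree (by omega) trivial ?_
  · have h0 : s.var 13 = 0 := by simpa using h13
    refine runs_whenAll (by omega) cs (fun hall => ?_) fun hall => ?_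
    · refine (h s hs h0 hall).frame.mono le_rfl ?_
      rintro s' ⟨⟨h1, h2⟩, hf⟩
      exact ⟨⟨hs.frame hf hp, h1⟩, fun h => by omega, h2⟩
    · exact ⟨⟨hs, hflag⟩, fun h => h, fun hC => absurd (hcs hC s hs) hall⟩
  · have h1 : s.var 13 = 1 := by
      rcases hflag with h | h
      · simp [h] at h13
      · exact h.1
    exact ⟨⟨hs, hflag⟩, fun h => h, fun _ => h1⟩

/-- The characteristic function of adjacency between the vertices in the slots `i` and `j`. -/
def adjE (i j : ℕ) : Expr := .get (20 + i) (.var (20 + j))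

/-- The distance of the vertices in the slots `i` and `j`, as numbers. -/
def distE (i j : ℕ) : Expr :=
  .add (.sub (.var (20 + i)) (.var (20 + j))) (.sub (.var (20 + j)) (.var (20 + i)))

/-- The test whether `i` and `j` are adjacent, or whether they are not. -/
def adjTest (b : Bool) (i j : ℕ) : Expr × Expr :=
  if b then (.lit 0, adjE i j) else (adjE i j, .lit 1)

theorem IsTesting.eval_adjTest (h : IsTesting L σ x s) (hL : ∀ v w, w ∈ L v ↔ G.Adj v w) (b : Bool)
    (i j : Fin m) : (adjTest b i j).1.eval s < (adjTest b i j).2.eval s ↔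
      (G.Adj (x i) (x j) ↔ b = true) := by
  have h1 : (adjE i j).eval s = if x j ∈ L (x i) then 1 else 0 := by
    simp only [adjE, Expr.eval, (h.slots j).1, (h.slots i).2]
  rw [← hL]
  by_cases hm : x j ∈ L (x i) <;> cases b <;> simp [adjTest, h1, hm]

theorem IsTesting.eval_distE (h : IsTesting L σ x s) (i j : Fin m) :
    (Expr.lit 0).eval s < (distE i j).eval s ↔ x i ≠ x j := by
  have h1 := (h.slots i).1
  have h2 := (h.slots j).1
  simp only [distE, Expr.eval, h1, h2, ne_eq, Fin.ext_iff]
  omega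

/-- Write the vertices in the slots `is` into array `3`, from cell `j` on, and the index of the next
free cell into register `2`. -/
def writeSlots (j : ℕ) : List ℕ → Program
  | [] => .assign 2 (.lit j)
  | i :: is => .put 3 (.lit j) (.var (20 + i)) ;; writeSlots (j + 1) is

theorem loopFree_writeSlots (j : ℕ) (is : List ℕ) : (writeSlots j is).LoopFree := by
  induction is generalizing j with
  | nil => trivial
  | cons i is ih => exact ⟨trivial, ih _⟩

theorem writesVar_writeSlots {j i : ℕ} {is : List ℕ} (h : (writeSlots j is).WritesVar i) :
    i = 2 := by
  induction is generalizing j with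
  | nil => exact h
  | cons k is ih => exact h.elim False.elim ih

theorem writesArr_writeSlots {j a : ℕ} {is : List ℕ} (h : (writeSlots j is).WritesArr a) :
    a = 3 := by
  induction is generalizing j with
  | nil => exact h.elim
  | cons k is ih => exact h.elim id ih

theorem run_writeSlots (j : ℕ) (is : List ℕ) (s : Memory) :
    ((writeSlots j is).run s).var 2 = j + is.length ∧
      (∀ k < j, ((writeSlots j is).run s).arr 3 k = s.arr 3 k) ∧
      ∀ (k : ℕ) (hk : k < is.length),
        ((writeSlots j is).run s).arr 3 (j + k) = s.var (20 + is[k]) := by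
  induction is generalizing j s with
  | nil => simp [writeSlots]
  | cons i is ih =>
    obtain ⟨h1, h2, h3⟩ := ih (j + 1) (s.setArr 3 j (s.var (20 + i)))
    simp only [writeSlots, Program.run, Expr.eval]
    refine ⟨by rw [h1, List.length_cons]; omega, fun k hk => ?_, fun k hk => ?_⟩
    · rw [h2 k (by omega)]
      simp
      omega
    · rcases k with _ | k
      · rw [add_zero, h2 j (by omega)]
        simp
      · have := h3 k (by simpa using hk)
        rw [show j + (k + 1) = j + 1 + k by omega, this]
        simp

/-- The tests whether the slots `w` hold an induced copy of `H`. -/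
noncomputable def copyTests {k : ℕ} (H : SimpleGraph (Fin k)) (w : Fin k → Fin m) :
    List (Expr × Expr) :=
  -- Choices are made only in writing down the program, which depends on the fixed graph `H` and on
  -- `w`; nothing is decided classically at run time.
  open Classical in
  (Finset.univ : Finset (Fin k × Fin k)).toList.flatMap fun ij =>
    if ij.1 < ij.2 then
      [(.lit 0, distE (w ij.1) (w ij.2)), adjTest (decide (H.Adj ij.1 ij.2)) (w ij.1) (w ij.2)]
    else []

theorem copyTests_iff (hL : ∀ v w, w ∈ L v ↔ G.Adj v w) {k : ℕ} {H : SimpleGraph (Fin k)}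
    {w : Fin k → Fin m} (h : IsTesting L σ x s) :
    (∀ c ∈ copyTests H w, c.1.eval s < c.2.eval s) ↔ ∃ e : H ↪g G, ∀ i, e i = x (w i) := by
  classical
  have key : (∀ c ∈ copyTests H w, c.1.eval s < c.2.eval s) ↔ ∀ i j, i < j →
      x (w i) ≠ x (w j) ∧ (G.Adj (x (w i)) (x (w j)) ↔ H.Adj i j) := by
    constructor
    · intro hall i j hij
      have h1 := hall (.lit 0, distE (w i) (w j))
        (List.mem_flatMap.2 ⟨(i, j), by simp, by simp [hij]⟩)
      have h2 := hall (adjTest (decide (H.Adj i j)) (w i) (w j))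
        (List.mem_flatMap.2 ⟨(i, j), by simp, by simp [hij]⟩)
      rw [h.eval_adjTest hL, decide_eq_true_iff] at h2
      exact ⟨(h.eval_distE _ _).1 h1, h2⟩
    · intro hall c hc
      obtain ⟨⟨i, j⟩, -, hc⟩ := List.mem_flatMap.1 hc
      by_cases hij : i < j
      · obtain ⟨h1, h2⟩ := hall i j hij
        simp only [hij, if_true, List.mem_cons, List.not_mem_nil, or_false] at hc
        rcases hc with rfl | rfl
        · exact (h.eval_distE _ _).2 h1
        · rw [h.eval_adjTest hL, decide_eq_true_iff]
          exact h2
      · simp [hij] at hc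
  rw [key]
  constructor
  · intro hall
    refine exists_embedding (fun i j hij => ?_) fun i j hij => (hall i j hij).2
    by_contra hne
    rcases lt_or_gt_of_ne hne with h1 | h1
    · exact (hall i j h1).1 hij
    · exact (hall j i h1).1 hij.symm
  · rintro ⟨e, he⟩ i j hij
    rw [← he, ← he]
    exact ⟨fun h => hij.ne (e.injective h), e.map_adj_iff⟩

/-- Look for an induced copy of `H` in the slots `w`. -/
noncomputable def copyProg {k : ℕ} (H : SimpleGraph (Fin k)) (w : Fin k → Fin m) : Program :=
  guarded (copyTests H w) (writeSlots 0 (List.ofFn fun i => (w i : ℕ)) ;; .assign 13 (.lit 1))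

theorem tests_copyProg (hL : ∀ v w, w ∈ L v ↔ G.Adj v w) {k : ℕ} {H : SimpleGraph (Fin k)}
    (hH : ∀ w, InducesCopy G H w → IsObstruction G w) (w : Fin k → Fin m) :
    Tests G L σ x (copyProg H w) (∃ e : H ↪g G, ∀ i, e i = x (w i)) := by
  refine Tests.guarded ⟨fun i hi => ?_, fun a ha => ?_⟩
    (fun hC s hs => (copyTests_iff hL hs).2 hC) fun s hs h0 hall => ?_
  · rcases hi with hi | hi
    · rw [writesVar_writeSlots hi]; omega
    · have : i = 13 := hi
      omega
  · rcases ha with ha | ha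
    · rw [writesArr_writeSlots ha]; omega
    · exact ha.elim
  · obtain ⟨e, he⟩ := (copyTests_iff hL hs).1 hall
    refine Runs.of_loopFree (by omega) ⟨loopFree_writeSlots _ _, trivial⟩
      ⟨Or.inr ⟨by simp, List.ofFn e, ?_, ?_, hH _ ⟨e, rfl⟩⟩, by simp⟩
    · have := (run_writeSlots 0 (List.ofFn fun i => (w i : ℕ)) s).1
      simpa using this
    · intro i hi
      have := (run_writeSlots 0 (List.ofFn fun i => (w i : ℕ)) s).2.2 i (by simpa using hi)
      simp only [Program.run, Memory.setVar_arr, this, List.getElem_ofFn, he]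
      exact (hs.slots _).1

end Tests

/-! ### Searching for an induced cycle through three given vertices. -/

section HoleTest

variable {n m : ℕ} {G : SimpleGraph (Fin n)} {L : Fin n → List (Fin n)} {σ : List (Fin n)}
  {x : Fin m → Fin n} {s s' : Memory}

/-- Follow the parents in array `15` from the vertex in slot `j` to the one in register `10`, and
write the path into array `3`, preceded by the vertex in slot `i`. -/
def traceProg (i j : ℕ) : Program :=
  .put 3 (.lit 0) (.var (20 + i)) ;; .assign 4 (.lit 1) ;; .assign 5 (.var (20 + j)) ;;
  .whileLt (.lit 0) (.add (.sub (.var 5) (.var 10)) (.sub (.var 10) (.var 5)))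
    (.put 3 (.var 4) (.var 5) ;; .assign 4 (.add (.var 4) (.lit 1)) ;;
      .assign 5 (.get 15 (.var 5))) ;;
  .put 3 (.var 4) (.var 5) ;; .assign 2 (.add (.var 4) (.lit 1)) ;; .assign 13 (.lit 1)

/-- The loop writes the `k` vertices before `a`; `a` is added afterwards. With `c` in front, this
makes `k + 2` vertices. -/
theorem runs_traceProg {i j : ℕ} {a b c : Fin n} (hc : s.var (20 + i) = c)
    (hb : s.var (20 + j) = b) (ha : s.var 10 = a) {par : Fin n → Fin n} {k : ℕ}
    (hk : par^[k] b = a) (hk' : ∀ i < k, par^[i] b ≠ a)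
    (hpar : ∀ i < k, s.arr 15 (par^[i] b) = par (par^[i] b)) :
    Runs (k + 1) (traceProg i j) s (fun s' => s'.var 13 = 1 ∧ s'.var 2 = k + 2 ∧
      s'.Stores 3 0 (c :: (List.range (k + 1)).map fun i => par^[i] b)) := by
  have hX : 1 ≤ k + 1 := by omega
  refine Runs.seq (Q := fun s' => s'.arr 3 0 = c ∧ s'.arr 15 = s.arr 15)
    (Runs.of_loopFree hX trivial (by simp [hc, Memory.setArr_arr_of_ne])) ?_
  rintro s1 ⟨h1, h1p⟩ hf1
  refine Runs.seq (Q := fun s' => s'.var 4 = 1) (Runs.of_loopFree hX trivial (by simp)) ?_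
  intro s2 h2 hf2
  refine Runs.seq (Q := fun s' => s'.var 5 = b) (Runs.of_loopFree hX trivial ?_) ?_
  · have := hf2.var (20 + j) (by simp; omega)
    rw [hf1.var (20 + j) (by simp)] at this
    simpa [this] using hb
  intro s3 h3 hf3
  have h3a : ∀ e, s3.arr e = s1.arr e := fun e => by rw [hf3.arr e (by simp), hf2.arr e (by simp)]
  have h34 : s3.var 4 = 1 := by rw [hf3.var 4 (by simp), h2]
  have h310 : s3.var 10 = a := by
    rw [hf3.var 10 (by simp), hf2.var 10 (by simp), hf1.var 10 (by simp), ha]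
  refine Runs.seq (Q := fun s' => s'.var 4 = k + 1 ∧ s'.var 5 = a ∧ s'.arr 3 0 = c ∧
    ∀ i < k, s'.arr 3 (i + 1) = par^[i] b) (Runs.whileLt (φ := k) (I := fun φ s' => ∃ i ≤ k,
      φ + i = k ∧ s'.var 4 = i + 1 ∧ s'.var 5 = par^[i] b ∧ s'.arr 3 0 = c ∧
      ∀ l < i, s'.arr 3 (l + 1) = par^[l] b) ?_ ?_ ⟨0, by omega, by omega, by simp [h34],
        by simp [h3], by rw [h3a, h1], by simp⟩) ?_
  · rintro φ s' ⟨i, hi, hφ, h4, h5, h6, h7⟩ hf hlt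
    have h10 : s'.var 10 = a := by rw [hf.var 10 (by simp), h310]
    have hik : i ≠ k := by
      rintro rfl
      simp [h5, h10, hk] at hlt
    have h15 : s'.arr 15 (par^[i] b) = par^[i + 1] b := by
      rw [hf.arr 15 (by simp), h3a, h1p, hpar i (by omega), Function.iterate_succ_apply']
    refine ⟨1, le_rfl, Runs.of_loopFree le_rfl (by simp) ⟨φ - 1, by omega, i + 1, by omega,
      by omega, by simp [h4], by simp [h5, h15], by simp [h4, h6], fun l hl => ?_⟩⟩
    by_cases hli : l = i
    · simp [h4, h5, hli]
    · simp [h4, hli, h7 l (by omega)]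
  · rintro φ s' ⟨i, hi, hφ, h4, h5, h6, h7⟩ hf hlt
    have h10 : s'.var 10 = a := by rw [hf.var 10 (by simp), h310]
    have hia : par^[i] b = a := by
      by_contra hne
      have : (par^[i] b : ℕ) ≠ a := fun e => hne (Fin.ext e)
      simp only [Expr.eval, h5, h10] at hlt
      omega
    obtain rfl : i = k := by
      by_contra hne
      exact hk' i (by omega) hia
    exact ⟨h4, by rw [h5, hia], h6, h7⟩
  · rintro s4 ⟨h4, h5, h6, h7⟩ -
    refine Runs.of_loopFree hX (by simp) ⟨by simp, by simp [h4], ?_⟩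
    intro i hi
    simp only [List.length_cons, List.length_map, List.length_range] at hi
    rcases i with _ | i
    · simpa [h4] using h6
    · rw [List.getElem_cons_succ, List.getElem_map, List.getElem_range]
      by_cases hik : i = k
      · simp [h4, h5, hik, hk]
      · simp [h4, hik, h7 i (by omega)]

/-- Mark in array `16` the closed neighbourhood of the vertex in slot `i` without the vertices in
the slots `j` and `k`. -/
def rimProg (i j k : ℕ) : Program :=
  .assign 3 (.lit 0) ;; forTo 3 (.var 0) (.put 16 (.var 3) (.get (20 + i) (.var 3))) ;;
  .put 16 (.var (20 + i)) (.lit 1) ;; .put 16 (.var (20 + j)) (.lit 0) ;;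
  .put 16 (.var (20 + k)) (.lit 0)

theorem runs_rimProg (hL : ∀ v w, w ∈ L v ↔ G.Adj v w) (h : IsTesting L σ x s) (i j k : Fin m) :
    Runs (n + 1) (rimProg i j k) s (fun s' =>
      ∀ v : Fin n, s'.arr 16 v = 0 ↔ v ∉ rim G (x i) (x j) (x k)) := by
  classical
  have hX : 1 ≤ n + 1 := by omega
  have hi := h.slots i
  refine Runs.seq (Q := fun s' => s'.var 3 = 0) (Runs.of_loopFree hX trivial (by simp)) ?_
  intro s1 h1 hf1
  refine Runs.seq (Q := fun s' => ∀ v : Fin n, s'.arr 16 v = if v ∈ L (x i) then 1 else 0) ?_ ?_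
  · refine (Runs.forTo_loopFree (o := 0) (N := n)
      (I := fun d s' => s'.var 3 = d ∧ ∀ v : Fin n, (v : ℕ) < d →
        s'.arr 16 v = if v ∈ L (x i) then 1 else 0) (by simp) ?_ ?_
      (by simpa using h1)).mono le_rfl (fun s' hs' v => hs'.2 v v.2)
    · rintro d s' - hI hf
      refine ⟨by simpa using hI.1, ?_⟩
      rw [zero_add, ← h.graph.size]
      exact (hf.var 0 (by simp)).trans (hf1.var 0 (by simp))
    · rintro d s' hd ⟨h3, h4⟩ hf -
      have hmark : s'.arr (20 + i) d = if (⟨d, hd⟩ : Fin n) ∈ L (x i) then 1 else 0 := by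
        rw [hf.arr _ (by simp; omega), hf1.arr _ (by simp)]
        exact hi.2 ⟨d, hd⟩
      refine ⟨by simpa using h3, by simp, fun v hv => ?_⟩
      simp only [Program.run, Expr.eval, h3, hmark, Memory.setVar_arr, Memory.setArr_arr, true_and]
      by_cases hvd : (v : ℕ) = d
      · obtain rfl : v = ⟨d, hd⟩ := Fin.ext hvd
        simp
      · rw [if_neg hvd]
        exact h4 v (by omega)
  intro s2 h2 hf2
  have hv : ∀ l : Fin m, s2.var (20 + l) = x l := fun l => by
    rw [hf2.var _ (by simp; omega), hf1.var _ (by simp; omega)]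
    exact (h.slots l).1
  refine Runs.of_loopFree hX (by simp) fun v => ?_
  simp only [Program.run, Expr.eval, hv, Memory.setArr_var, Memory.setArr_arr, true_and,
    ← Fin.ext_iff, h2, hL, rim, Set.mem_ofPred_eq]
  split_ifs <;> simp_all

/-- Look for a cycle through the slots `j`, `i`, `k`, in this order, that has no further vertex
adjacent to the vertex in slot `i`. -/
def holeProg (i j k : ℕ) : Program :=
  guarded [adjTest true i j, adjTest true i k, adjTest false j k, (.lit 0, distE j k)]
    (rimProg i j k ;; .assign 10 (.var (20 + j)) ;; bfsProg 14 15 16 plainCell ;;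
      .ifLt (.lit 0) (.get 16 (.var (20 + k))) (traceProg i k) .skip)

/-- For a hole triple, the search outside the rim reaches the third vertex. Whenever it does, the
parent path is induced and closes up to a cycle. The order of the neighbours is irrelevant here, so
the priority is trivial and the unsorted lists are used. -/
theorem tests_holeProg (hL : ∀ v w, w ∈ L v ↔ G.Adj v w) (hnd : ∀ v, (L v).Nodup)
    (i j k : Fin m) :
    Tests G L σ x (holeProg i j k) (IsHoleTriple G (x i) (x j) (x k)) := by
  have hnw := le_weight L
  refine Tests.guarded ⟨fun e he => ?_, fun e he => ?_⟩ ?_ ?_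
  · simp [rimProg, bfsProg, bfsStart, bfsVisit, bfsBody, traceProg] at he
    omega
  · simp [rimProg, bfsProg, bfsStart, bfsVisit, bfsBody, traceProg] at he
    omega
  · intro hC s hs
    simp only [List.forall_mem_cons, hs.eval_adjTest hL, hs.eval_distE]
    simp [hC.adj_left, hC.adj_right, hC.not_adj, hC.ne]
  intro s hs h0 hall
  simp only [List.forall_mem_cons, hs.eval_adjTest hL, hs.eval_distE] at hall
  obtain ⟨hij, hik, hjk, hne, -⟩ := hall
  simp only [iff_true, Bool.false_eq_true, iff_false] at hij hik hjk
  refine Runs.seq ((runs_rimProg hL hs i j k).mono (by omega) fun _ h => h) fun s1 h1 hf1 => ?_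
  replace hs := hs.frame hf1 ⟨fun e he => by simp [rimProg] at he; omega,
    fun e he => by simp [rimProg] at he; omega⟩
  have h113 : s1.var 13 = 0 := by rw [hf1.var 13 (by simp [rimProg]), h0]
  refine Runs.seq (Q := fun s' => s'.var 10 = x j ∧ s'.arr 16 = s1.arr 16) (Runs.of_loopFree
    (by omega) trivial (by simpa using (hs.slots j).1)) ?_
  rintro s2 ⟨h2, h2a⟩ hf2
  replace hs := hs.frame hf2 ⟨fun e he => by simp at he; omega, fun e he => by simp at he⟩
  have h213 : s2.var 13 = 0 := by rw [hf2.var 13 (by simp), h113]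
  refine Runs.seq (runs_bfsProg (le := fun _ _ => True) (by constructor <;> simp) hs.graph
    (readsLists_plain hs.graph) (fun _ => rfl) hnd hL (fun v => List.pairwise_of_forall (by simp))
    h2 (F := rim G (x i) (x j) (x k)) (by simp [rim]) (fun v _ => by rw [h2a]; exact h1 v)) ?_
  rintro s3 ⟨τ, P, b1, -, b3, -, b5, b6⟩ hf3
  replace hs := hs.frame hf3
    ⟨fun e he => by simp [bfsProg, bfsStart, bfsVisit, bfsBody] at he; omega,
    fun e he => by simp [bfsProg, bfsStart, bfsVisit, bfsBody] at he; omega⟩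
  have h313 : s3.var 13 = 0 := by
    rw [hf3.var 13 (by simp [bfsProg, bfsStart, bfsVisit, bfsBody]), h213]
  have h310 : s3.var 10 = x j := by
    rw [hf3.var 10 (by simp [bfsProg, bfsStart, bfsVisit, bfsBody]), h2]
  have hinv := b1.inv
  have hτ : τ.Nodup := by simpa using hinv.nodup
  have hτn : τ.length ≤ n := by simpa using hτ.length_le_card
  have hmark : 0 < s3.arr 16 (x k) ↔ x k ∈ τ := by
    rw [Nat.pos_iff_ne_zero, ne_eq, b3]
    simp [rim]
  have hxk : s3.var (20 + k) = x k := (hs.slots k).1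
  refine Runs.ite (by omega) (fun hlt => ?_) fun hlt => Runs.of_loopFree (by omega) trivial
    ⟨Or.inl h313, fun hC => ?_⟩
  · simp only [Expr.eval, hxk, hmark] at hlt
    obtain ⟨l, hl, hl1, hl2, hl3⟩ := isObstruction_of_parents hij hik hjk hinv hlt hne b5
    have hmem : ∀ e ≤ l, P^[e] (x k) ∈ τ := by
      intro e he
      induction e with
      | zero => exact hlt
      | succ e ih =>
        rw [Function.iterate_succ_apply']
        exact List.mem_of_getElem? (b5 _ (ih (by omega)) (hl2 e (by omega)))
    refine (runs_traceProg (hs.slots i).1 hxk h310 hl1 hl2 fun e he => b6 _ (hmem e he.le)).mono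
      (by omega) ?_
    rintro s' ⟨c1, c2, c3⟩
    exact ⟨Or.inr ⟨c1, _, by simpa using c2, c3, hl3⟩, fun _ => c1⟩
  · simp only [Expr.eval, hxk, hmark] at hlt
    exact absurd (hinv.mem_of_reachable (by simpa using List.mem_of_getElem? hinv.head)
      hC.reachable) hlt

end HoleTest

/-! ### The recognition algorithm. -/

section Recognition

variable {n : ℕ} {G : SimpleGraph (Fin n)} {L : Fin n → List (Fin n)} {σ : List (Fin n)}

/-- Look for an obstruction among all the vertices in `m` slots. -/
noncomputable def obstructionProg (m : ℕ) : Program :=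
  -- The number of tuples depends on `m` alone, which will be twelve, so the program has a fixed
  -- length.
  seqAll ((Finset.univ : Finset (Fin 4 → Fin m)).toList.map (copyProg claw)) ;;
  seqAll ((Finset.univ : Finset (Fin 6 → Fin m)).toList.map (copyProg net)) ;;
  seqAll ((Finset.univ : Finset (Fin 6 → Fin m)).toList.map (copyProg sun)) ;;
  seqAll ((Finset.univ : Finset (Fin m × Fin m × Fin m)).toList.map fun t =>
    holeProg t.1 t.2.1 t.2.2)

theorem tests_obstructionProg {m : ℕ} {x : Fin m → Fin n} (hL : ∀ v w, w ∈ L v ↔ G.Adj v w)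
    (hnd : ∀ v, (L v).Nodup) :
    Tests G L σ x (obstructionProg m) (IsLocated G (Set.range x)) := by
  have hcopy : ∀ {k : ℕ} {H : SimpleGraph (Fin k)}, (∀ w, InducesCopy G H w → IsObstruction G w) →
      Tests G L σ x (seqAll ((Finset.univ : Finset (Fin k → Fin m)).toList.map (copyProg H)))
        (∃ e : H ↪g G, ∀ i, e i ∈ Set.range x) := by
    intro k H hH
    refine (Tests.seqAll _ fun w _ => tests_copyProg hL hH w).imp ?_
    rintro ⟨e, he⟩
    choose w hw using he
    exact ⟨w, by simp, e, fun i => (hw i).symm⟩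
  refine (hcopy fun _ => Or.inl).seq ((hcopy fun _ h => Or.inr (Or.inl h)).seq
    ((hcopy fun _ h => Or.inr (Or.inr (Or.inl h))).seq
    ((Tests.seqAll _ fun t _ => tests_holeProg hL hnd t.1 t.2.1 t.2.2).imp ?_)))
  rintro ⟨_, ⟨i, rfl⟩, _, ⟨j, rfl⟩, _, ⟨k, rfl⟩, h⟩
  exact ⟨(i, j, k), by simp, h⟩

/-- The recognition algorithm. -/
noncomputable def recognitionProg : Program :=
  searchProg ;; posProg ;; checkProg ;;
  .ifLt (.var 11) (.lit 1) (.assign 1 (.lit 1))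
    (gatherProg ;; .assign 13 (.lit 0) ;; obstructionProg 12 ;; .assign 1 (.lit 0))

theorem SearchResult.frame [DecidableRel G.Adj] {s s' : Memory} {p : Program} {x r : Fin n}
    {τ : List (Fin n)} {P par : Fin n → Fin n} (h : SearchResult G s x r τ σ P par)
    (hf : Frame p s s') (h10 : ¬ p.WritesVar 10) (h2 : ¬ p.WritesArr 2) (h9 : ¬ p.WritesArr 9)
    (h11 : ¬ p.WritesArr 11) : SearchResult G s' x r τ σ P par :=
  { h with
    stores := h.stores.congr fun i _ => by rw [hf.arr 2 h2]
    root := by rw [hf.var 10 h10, h.root]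
    parents₁ := fun v => by rw [hf.arr 9 h9, h.parents₁]
    parents₂ := fun v => by rw [hf.arr 11 h11, h.parents₂] }

theorem Memory.Encodes.exists_hasGraph {s : Memory} (h : s.Encodes G) :
    ∃ L : Fin n → List (Fin n), HasGraph L s ∧ (∀ v, (L v).Nodup) ∧
      ∀ v w, w ∈ L v ↔ G.Adj v w := by
  obtain ⟨h0, h1, h2⟩ := h
  choose L hL using h2
  exact ⟨L, ⟨h0, h1, fun v => (hL v).2.2.1, fun v => (hL v).2.2.2⟩, fun v => (hL v).1,
    fun v => (hL v).2.1⟩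

theorem weight_eq [DecidableRel G.Adj] (hnd : ∀ v, (L v).Nodup)
    (hL : ∀ v w, w ∈ L v ↔ G.Adj v w) : weight L = n + 2 * G.edgeFinset.card := by
  have hdeg : ∀ v, (L v).length = G.degree v := by
    intro v
    rw [← List.toFinset_card_of_nodup (hnd v), ← G.card_neighborFinset_eq_degree]
    congr 1
    ext w
    simp [hL]
  rw [weight, Finset.sum_add_distrib, ← G.sum_degrees_eq_twice_card_edges]
  simp [hdeg, add_comm]

/-- Without a violation the ordering is Left-Right and yields a unit model. Otherwise the first
violation puts an obstruction within reach of the slots, the tests find one, and it excludes any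
model. -/
theorem runs_recognitionProg [DecidableRel G.Adj] (hG : G.Connected) {s : Memory}
    (h : HasGraph L s) (hnd : ∀ v, (L v).Nodup) (hL : ∀ v w, w ∈ L v ↔ G.Adj v w) :
    Runs (weight L + 1) recognitionProg s (fun s' => ∃ σ : List (Fin n), s'.Stores 2 0 σ ∧
      (∃ x, (∀ y, G.degree y ≤ G.degree x) ∧ IsTwoPassOutput G x σ) ∧
      ((s'.var 1 = 1 ∧ IsUnitIntervalGraph G ∧ IsLeftRightOrdering G σ) ∨
        (s'.var 1 = 0 ∧ ¬ IsUnitIntervalGraph G ∧ HasObstruction G s'))) := by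
  have hnw := le_weight L
  have hX : 1 ≤ weight L + 1 := by omega
  refine Runs.seq (runs_searchProg hG h hnd hL) ?_
  rintro s1 ⟨x, r, τ, σ, P, par, hR⟩ hf1
  have hg1 : HasGraph L s1 := h.frame hf1
    (by simp [searchProg, sortProg, countProg, prefixProg, placeProg, sortAdjProg, sortAdjInner,
      sortAdjBody, clearProg, bfsProg, bfsStart, bfsVisit, bfsBody])
    (by simp [searchProg, sortProg, countProg, prefixProg, placeProg, sortAdjProg, sortAdjInner,
      sortAdjBody, clearProg, bfsProg, bfsStart, bfsVisit, bfsBody])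
    (by simp [searchProg, sortProg, countProg, prefixProg, placeProg, sortAdjProg, sortAdjInner,
      sortAdjBody, clearProg, bfsProg, bfsStart, bfsVisit, bfsBody])
  refine Runs.seq ((runs_posProg hg1.size hR.nodup hR.mem hR.stores).mono (by omega)
    fun _ h => h) fun s2 hpos hf2 => ?_
  have hg2 := hg1.frame hf2 (by simp [posProg]) (by simp [posProg]) (by simp [posProg])
  replace hR := hR.frame hf2 (by simp [posProg]) (by simp [posProg]) (by simp [posProg])
    (by simp [posProg])
  refine Runs.seq (runs_checkProg hg2 hnd hL hR hpos) fun s3 hcheck hf3 => ?_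
  have hg3 := hg2.frame hf3 (by simp [checkProg, countBack, countBackBody, recordViolation])
    (by simp [checkProg, countBack, countBackBody, recordViolation])
    (by simp [checkProg, countBack, countBackBody, recordViolation])
  replace hR := hR.frame hf3 (by simp [checkProg, countBack, countBackBody, recordViolation])
    (by simp [checkProg, countBack, countBackBody, recordViolation])
    (by simp [checkProg, countBack, countBackBody, recordViolation])
    (by simp [checkProg, countBack, countBackBody, recordViolation])
  replace hpos : ∀ v : Fin n, s3.arr 13 v = σ.idxOf v := fun v => by
    rw [hf3.arr 13 (by simp [checkProg, countBack, countBackBody, recordViolation]), hpos]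
  have hout : ∃ x, (∀ y, G.degree y ≤ G.degree x) ∧ IsTwoPassOutput G x σ :=
    ⟨x, hR.degree_le, hR.output⟩
  rcases hcheck with ⟨h11, hV⟩ | ⟨h11, c, h12, hV, hfirst⟩
  · refine Runs.ite hX (fun _ => Runs.of_loopFree hX trivial ⟨σ, ?_, hout, Or.inl ?_⟩)
      fun hlt => absurd hlt (by simp [h11])
    · exact hR.stores
    · have hLR : IsLeftRightOrdering G σ :=
        hR.layout₂.isLeftRight hR.nodup hR.mem fun b c h1 h2 => by
          by_contra hbc
          exact hV c ⟨b, h1, h2, hbc⟩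
      exact ⟨by simp, hLR.isUnit, hLR⟩
  refine Runs.ite hX (fun hlt => absurd hlt (by simp [h11])) fun _ => ?_
  refine Runs.seq (runs_gatherProg hL ⟨hg3, hR.stores, hR.root, hR.parents₁, hR.parents₂, hpos,
    fun i v hi => by simp at hi⟩ hR.nodup hR.mem h12 hV) ?_
  rintro s4 ⟨b, z, y, hb, hz, hy, hgath⟩ -
  set vs : List (Fin n) := [c, par c, b, z, y, par (par c), par (par (par c)), r, P r, P (P r),
    P z, P c] with hvs
  have hlen : vs.length = 12 := by simp [hvs]
  refine Runs.seq (Q := fun s' => s'.var 13 = 0) (Runs.of_loopFree hX trivial (by simp)) ?_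
  intro s5 h5 hf5
  have htest : IsTesting L σ (fun i : Fin 12 => vs[i]) s5 := by
    refine ⟨hgath.graph.frame hf5 (by simp) (by simp) (by simp),
      hgath.stores.congr fun i _ => by rw [hf5.arr 2 (by simp)], fun i => ?_⟩
    refine (hgath.slots.frame hf5 (fun i hi => ?_) (fun i hi => by simp at hi)) i _
      (List.getElem?_eq_getElem (by omega))
    simp at hi
    omega
  have hloc : IsLocated G (Set.range fun i : Fin 12 => vs[i]) := by
    refine isLocated_of_violation hR.layout₁ hR.last hR.layout₂ hb.1 hb.2.1 hb.2.2
      (fun c' hc' b' h1 h2 => ?_) hz hy fun v hv => ?_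
    · by_contra hbc
      exact hfirst c' hc' ⟨b', h1, h2, hbc⟩
    · obtain ⟨i, hi, rfl⟩ := List.getElem_of_mem hv
      exact ⟨⟨i, by rw [← hlen]; exact hi⟩, rfl⟩
  refine Runs.seq (tests_obstructionProg hL hnd s5 htest (Or.inl h5)) ?_
  rintro s6 ⟨⟨ht6, hflag⟩, -, hfound⟩ -
  have h13 := hfound hloc
  obtain ⟨w, hw1, hw2, hw3⟩ : HasObstruction G s6 := by
    rcases hflag with h0 | h1
    · omega
    · exact h1.2
  refine Runs.of_loopFree hX trivial ⟨σ, ht6.stores, hout, Or.inr ⟨by simp, hw3.not_isUnit,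
    w, ?_, hw2, hw3⟩⟩
  simpa using hw1

theorem isCertifyingRecognition_recognitionProg :
    IsCertifyingRecognition recognitionProg (3 * recognitionProg.size) := by
  intro n G _ hG s hs
  obtain ⟨L, hg, hnd, hL⟩ := hs.exists_hasGraph
  obtain ⟨t, s', h1, h2, h3⟩ := runs_recognitionProg hG hg hnd hL
  refine ⟨t, s', h1, h2.trans ?_, h3⟩
  have hn : 0 < n := Fin.pos_iff_nonempty.2 hG.nonempty
  rw [weight_eq (G := G) hnd hL]
  -- Since `n` is positive, the additive 1 is absorbed.
  calc (n + 2 * G.edgeFinset.card + 1) * recognitionProg.size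
      ≤ (3 * (n + G.edgeFinset.card)) * recognitionProg.size :=
        Nat.mul_le_mul_right _ (by omega)
    _ = 3 * recognitionProg.size * (n + G.edgeFinset.card) := by ring

end Recognition
end IUG

theorem mainTheorem1 :
    -- the ordering produced by the two-pass search characterizes unit (proper) interval graphs
    (∀ {V : Type*} [Fintype V] (G : SimpleGraph V) [DecidableRel G.Adj], G.Connected →
      ∀ (x : V) (σ : List V), IUG.IsTwoPassOutput G x σ →
        (IUG.IsUnitIntervalGraph G ↔ IUG.IsLeftRightOrdering G σ) ∧
        (IUG.IsProperIntervalGraph G ↔ IUG.IsLeftRightOrdering G σ)) ∧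
    -- certifying linear-time recognition
    (∃ (p : IUG.Program) (C : ℕ), IUG.IsCertifyingRecognition p C) ∧
    -- both kinds of certificates are conclusive
    (∀ {V : Type*} [Fintype V] (G : SimpleGraph V),
      (∀ σ : List V, IUG.IsLeftRightOrdering G σ → IUG.IsUnitIntervalGraph G) ∧
      (∀ w : List V, IUG.IsObstruction G w → ¬ IUG.IsUnitIntervalGraph G)) := by
  refine ⟨fun G _ hG x σ h => ⟨h.iff_unit hG, h.iff_proper hG⟩,
    ⟨_, _, IUG.isCertifyingRecognition_recognitionProg⟩,
    fun G => ⟨fun σ h => h.isUnit, fun w h => h.not_isUnit⟩⟩
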